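/- Graphs are finite and may have loops and parallel edges. A circuit of a graph is a set of edges that induces a connected subgraph in which every vertex has degree two (a loop contributes two to the degree of its end, so a single loop is a circuit), and a circuit is odd if it has an odd number of edges. A graph $H$ is an odd minor of a graph $G$ if $H$ is isomorphic to a graph obtained from some subgraph $G'$ of $G$ by contracting all the edges of a cut $\delta_{G'}(U)=\{uv\in E(G') : u\in U,\ v\notin U\}$, where $U\subseteq V(G')$ (possibly empty). Let $G$ be a graph in which every vertex has even degree and that does not contain $K_5$ as an odd minor. Then the minimum number of edges in a set $B\subseteq E(G)$ that meets every odd circuit of $G$ is equal to the maximum number of pairwise edge-disjoint odd circuits of $G$. -/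

import Mathlib

/-! Multigraphs (loops and parallel edges allowed) are Mathlib's `Graph α β`. -/

namespace Graph

/-- The degree of a vertex: the number of edges incident with it, loops counted twice. -/
noncomputable def degree {α β : Type*} (G : Graph α β) (v : α) : ℕ :=
  (G.incidenceSet v).ncard + (G.loopSet v).ncard

/-- A graph is connected if it has a vertex and any two of its vertices are joined by a walk. -/
def IsConnected {α β : Type*} (G : Graph α β) : Prop :=
  G.vertexSet.Nonempty ∧
    ∀ x ∈ G.vertexSet, ∀ y ∈ G.vertexSet, Relation.ReflTransGen G.Adj x y

/-- The subgraph `G[C]` induced by an edge set `C`: its edges are those in `C`, its vertices are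
the ends of the edges in `C`. -/
def edgeInduce {α β : Type*} (G : Graph α β) (C : Set β) : Graph α β :=
  (G.restrict C).induce {v | ∃ e ∈ C, G.Inc e v}

/-- A circuit is a set of edges that induces a connected subgraph in which every vertex has
degree two. A single loop and a pair of parallel edges are circuits. -/
def IsCircuit {α β : Type*} (G : Graph α β) (C : Set β) : Prop :=
  C ⊆ G.edgeSet ∧ (G.edgeInduce C).IsConnected ∧
    ∀ v ∈ (G.edgeInduce C).vertexSet, (G.edgeInduce C).degree v = 2

/-- An odd circuit is a circuit with an odd number of edges. -/
def IsOddCircuit {α β : Type*} (G : Graph α β) (C : Set β) : Prop :=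
  G.IsCircuit C ∧ Odd C.ncard

/-- The cut `δ(U)`: the edges with one end in `U` and the other end outside `U`. -/
def cut {α β : Type*} (G : Graph α β) (U : Set α) : Set β :=
  {e | ∃ x ∈ U, ∃ y ∉ U, G.IsLink e x y}

/-- The contraction `G / F`: the ends of every edge in `F` are identified and the edges in `F` are
removed; all other edges are kept (possibly as loops or parallel edges). -/
def contract {α β : Type*} (G : Graph α β) (F : Set β) :
    Graph (Quot fun x y : α => ∃ e ∈ F, G.IsLink e x y) β :=
  (G.map (Quot.mk _)).deleteEdges F

/-- Isomorphism of multigraphs. -/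
def IsIsomorphic {α β α' β' : Type*} (G : Graph α β) (H : Graph α' β') : Prop :=
  ∃ (f : G.vertexSet ≃ H.vertexSet) (g : G.edgeSet ≃ H.edgeSet),
    ∀ (e : G.edgeSet) (x y : G.vertexSet), G.IsLink e x y ↔ H.IsLink (g e) (f x) (f y)

/-- `H` is an odd minor of `G` if `H` is obtained (up to isomorphism) from a subgraph of `G` by
contracting all the edges of a cut of that subgraph. -/
def IsOddMinor {α β α' β' : Type*} (H : Graph α' β') (G : Graph α β) : Prop :=
  ∃ G' : Graph α β, G' ≤ G ∧ ∃ U ⊆ G'.vertexSet, (G'.contract (G'.cut U)).IsIsomorphic H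

/-- The complete graph `K₅` as a multigraph. -/
def K5 : Graph (Fin 5) (Sym2 (Fin 5)) := Graph.ofSimpleGraph (⊤ : SimpleGraph (Fin 5))

/-- A set of edges that meets every odd circuit. -/
def IsOddCircuitCover {α β : Type*} (G : Graph α β) (B : Finset β) : Prop :=
  (B : Set β) ⊆ G.edgeSet ∧ ∀ C : Set β, G.IsOddCircuit C → ((B : Set β) ∩ C).Nonempty

/-- A finite collection of pairwise (edge-)disjoint odd circuits. -/
def IsOddCircuitPacking {α β : Type*} (G : Graph α β) (P : Finset (Set β)) : Prop :=
  (∀ C ∈ P, G.IsOddCircuit C) ∧ (P : Set (Set β)).PairwiseDisjoint id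

end Graph

/-! Give every edge a sign, all odd at the start. For a 0/1 function `U` on the vertices, `hits F U`
consists of the edges of `F` that are odd after switching by `U`. It meets every odd cycle in `F`,
so its size bounds every packing from above. In an Eulerian graph all these sizes have the same
parity. The core is `packs_of_le_card_hits`: if, for every `U`, the size of `hits F U` is at least
`k` and congruent to `k` modulo 2, and there is no odd `K5`, then `F` contains `k` disjoint odd
cycles. With `k` the least size of a set of hits this gives the theorem, because every odd cycle
contains an odd circuit.

The induction is on the number of vertices and then on `k`. Switch so that a non-loop `e` becomes
even and contract it: the `k` cycles of the smaller graph lift once enough parallel copies of `e`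
are available. Copies added in pairs preserve the parity condition, and `packs_of_packs_insert`
removes them again, a pair at a time. If a pair cannot be removed, then `e` and its two copies lie
in three different cycles; these give three edge-disjoint paths joining the ends of `e`, and `k - 3`
further cycles remain. For an odd cycle `J` through `e`, the set `F \ J` has no packing of size `k -
1`, so by induction and parity some switching hits `F \ J` at most `k - 3` times. Such a switching
(a mate of `J`) is tight: it hits `e`, it hits each remaining cycle exactly once, and its other hits
lie on `J`.

Such a configuration forces an odd `K5`. The three paths form a flow of value three.
`FlowState.exists_tripod` rearranges it into disjoint connected sets `Nu`, `Nv` and three arcs `S i`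
between them, together with a set `Z`, such that some tight switching `U i` hits the flow only in `Z
∪ S i`, but none hits it only in `Z`. The three switchings agree on `Nu` and on `Nv`, and inside the
`i`-th arc only `U i` can differ from the other two. Colour a vertex by the switching that differs
from the others there. An exchange argument (`Pot.exists_link`) joins any two arcs by a chain in
their two colours, and `exists_oddTriangle` turns these chains into an odd triangle rooted at the
arcs. Its three branch sets, `Nu` and `Nv` are the branch sets of the odd `K5`; the edge `e` joins
the last two. -/

set_option linter.unusedSectionVars false

namespace OddPacking

/-! ### Directed flows in finite multidigraphs -/

section Digraph

variable {V A : Type*} (tl hd : A → V)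

/-- There is an edge of `X` from `p` to `q`. -/
def Step (X : Finset A) (p q : V) : Prop := ∃ a ∈ X, tl a = p ∧ hd a = q

/-- `q` can be reached from `p` by a directed walk in `X`. -/
abbrev Reach (X : Finset A) : V → V → Prop := Relation.ReflTransGen (Step tl hd X)

/-- There is an edge of `X` joining `p` and `q`, both of which lie in `N`. -/
def Joined (X : Finset A) (N : Set V) (p q : V) : Prop :=
  p ∈ N ∧ q ∈ N ∧ ∃ a ∈ X, (tl a = p ∧ hd a = q) ∨ (tl a = q ∧ hd a = p)

/-- The edge sets of simple directed paths that end in `q`. -/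
inductive IsDipath (q : V) [DecidableEq A] : V → Finset A → Prop
  | nil : IsDipath q q ∅
  | cons (a : A) (Q : Finset A) (h : IsDipath q (hd a) Q) (ha : tl a ≠ q)
      (hQ : ∀ b ∈ Q, tl b ≠ tl a) : IsDipath q (tl a) (insert a Q)

variable {tl hd}

lemma Step.mono {X Y : Finset A} (h : X ⊆ Y) {p q : V} (hs : Step tl hd X p q) :
    Step tl hd Y p q := by
  obtain ⟨a, ha, h1⟩ := hs
  exact ⟨a, h ha, h1⟩

lemma reach_mono {X Y : Finset A} (h : X ⊆ Y) {p q : V} (hs : Reach tl hd X p q) :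
    Reach tl hd Y p q :=
  Relation.ReflTransGen.mono (fun _ _ => Step.mono h) _ _ hs

lemma Joined.mono {X Y : Finset A} {N M : Set V} (h : X ⊆ Y) (hN : N ⊆ M) {p q : V}
    (hs : Joined tl hd X N p q) : Joined tl hd Y M p q := by
  obtain ⟨hp, hq, a, ha, h1⟩ := hs
  exact ⟨hN hp, hN hq, a, h ha, h1⟩

lemma joined_rtg_mono {X Y : Finset A} {N M : Set V} (h : X ⊆ Y) (hN : N ⊆ M) {p q : V}
    (hs : Relation.ReflTransGen (Joined tl hd X N) p q) :
    Relation.ReflTransGen (Joined tl hd Y M) p q :=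
  Relation.ReflTransGen.mono (fun _ _ => Joined.mono h hN) _ _ hs

lemma reach_joined {X : Finset A} {w x : V} (h : Reach tl hd X w x) :
    Relation.ReflTransGen (Joined tl hd X {y | Reach tl hd X w y}) w x := by
  induction h with
  | refl => exact .refl
  | @tail b c hb hbc ih =>
    refine ih.tail ⟨hb, hb.tail hbc, ?_⟩
    obtain ⟨a, ha, h1, h2⟩ := hbc
    exact ⟨a, ha, Or.inl ⟨h1, h2⟩⟩

variable [DecidableEq A]

lemma IsDipath.suffix {q p : V} {Q : Finset A} (h : IsDipath tl hd q p Q) {b : A} (hb : b ∈ Q) :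
    ∃ Q' ⊆ Q, IsDipath tl hd q (tl b) Q' := by
  induction h with
  | nil => simp at hb
  | cons a Q h ha hQ ih =>
    rcases Finset.mem_insert.1 hb with rfl | hb
    · exact ⟨_, subset_rfl, .cons _ _ h ha hQ⟩
    · obtain ⟨Q', h1, h2⟩ := ih hb
      exact ⟨Q', h1.trans (Finset.subset_insert _ _), h2⟩

lemma exists_isDipath {X : Finset A} {p q : V} (h : Reach tl hd X p q) :
    ∃ Q ⊆ X, IsDipath tl hd q p Q := by
  induction h using Relation.ReflTransGen.head_induction_on with
  | refl => exact ⟨∅, by simp, .nil⟩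
  | @head b c hbc _ ih =>
    obtain ⟨Q, hQX, hQ⟩ := ih
    obtain ⟨a, ha, rfl, rfl⟩ := hbc
    by_cases h1 : tl a = q
    · rw [h1]; exact ⟨∅, by simp, .nil⟩
    by_cases h2 : ∃ b ∈ Q, tl b = tl a
    · obtain ⟨b, hb, hba⟩ := h2
      obtain ⟨Q', h3, h4⟩ := hQ.suffix hb
      exact ⟨Q', h3.trans hQX, hba ▸ h4⟩
    · push Not at h2
      exact ⟨insert a Q, Finset.insert_subset ha hQX, .cons a Q hQ h1 h2⟩

lemma IsDipath.reach {q p : V} {Q : Finset A} (h : IsDipath tl hd q p Q) :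
    Reach tl hd Q p q := by
  induction h with
  | nil => exact .refl
  | cons a Q h ha hQ ih =>
    exact .head ⟨a, Finset.mem_insert_self _ _, rfl, rfl⟩
      (reach_mono (Finset.subset_insert _ _) ih)

lemma IsDipath.tl_ne {q p : V} {Q : Finset A} (h : IsDipath tl hd q p Q) {b : A} (hb : b ∈ Q) :
    tl b ≠ q := by
  induction h with
  | nil => simp at hb
  | cons a Q h ha hQ ih =>
    rcases Finset.mem_insert.1 hb with rfl | hb
    · exact ha
    · exact ih hb

lemma IsDipath.hd_mem {q p : V} {Q : Finset A} (h : IsDipath tl hd q p Q) {b : A} (hb : b ∈ Q) :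
    hd b = q ∨ ∃ c ∈ Q, tl c = hd b := by
  induction h with
  | nil => simp at hb
  | cons a Q h ha hQ ih =>
    rcases Finset.mem_insert.1 hb with rfl | hb
    · generalize hx : hd b = x at h
      cases h with
      | nil => exact Or.inl rfl
      | cons c Q h _ _ => exact Or.inr ⟨c, by simp, rfl⟩
    · rcases ih hb with h1 | ⟨c, hc, h1⟩
      · exact Or.inl h1
      · exact Or.inr ⟨c, Finset.mem_insert_of_mem hc, h1⟩

variable [DecidableEq V]

/-- The number of edges of `X` that leave `x`. -/
def outdeg (tl : A → V) (X : Finset A) (x : V) : ℕ := (X.filter (fun a => tl a = x)).card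

lemma outdeg_union {f : A → V} {X Y : Finset A} (h : Disjoint X Y) (x : V) :
    outdeg f (X ∪ Y) x = outdeg f X x + outdeg f Y x := by
  unfold outdeg
  rw [Finset.filter_union, Finset.card_union_of_disjoint]
  exact Finset.disjoint_filter_filter h

lemma outdeg_sdiff {f : A → V} {X Y : Finset A} (h : Y ⊆ X) (x : V) :
    outdeg f (X \ Y) x + outdeg f Y x = outdeg f X x := by
  rw [← outdeg_union Finset.sdiff_disjoint, Finset.sdiff_union_of_subset h]

lemma outdeg_insert {f : A → V} {X : Finset A} {a : A} (h : a ∉ X) (x : V) :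
    outdeg f (insert a X) x = outdeg f X x + if x = f a then 1 else 0 := by
  unfold outdeg
  rw [Finset.filter_insert]
  by_cases hx : f a = x
  · simp [hx, h]
  · simp [hx, Ne.symm hx]

lemma outdeg_pos {f : A → V} {X : Finset A} {x : V} :
    0 < outdeg f X x ↔ ∃ a ∈ X, f a = x := by
  simp [outdeg, Finset.card_pos, Finset.Nonempty, Finset.mem_filter]

lemma outdeg_eq_zero {f : A → V} {X : Finset A} {x : V} :
    outdeg f X x = 0 ↔ ∀ a ∈ X, f a ≠ x := by
  simp [outdeg, Finset.filter_eq_empty_iff]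

lemma IsDipath.div {q p : V} {Q : Finset A} (h : IsDipath tl hd q p Q) (x : V) :
    outdeg tl Q x + (if x = q then 1 else 0) = outdeg hd Q x + if x = p then 1 else 0 := by
  induction h with
  | nil => simp [outdeg]
  | cons a Q h ha hQ ih =>
    have haQ : a ∉ Q := fun h1 => hQ a h1 rfl
    rw [outdeg_insert haQ, outdeg_insert haQ]
    omega

lemma sum_outdeg [Fintype V] (f : A → V) (X : Finset A) (S : Finset V) :
    ∑ x ∈ S, outdeg f X x = (X.filter (fun a => f a ∈ S)).card := by
  classical
  unfold outdeg
  rw [Finset.card_eq_sum_card_fiberwise (f := f) (t := S)]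
  · refine Finset.sum_congr rfl fun x hx => ?_
    congr 1
    ext a
    simp only [Finset.mem_filter]
    constructor
    · rintro ⟨h1, rfl⟩; exact ⟨⟨h1, hx⟩, rfl⟩
    · rintro ⟨⟨h1, _⟩, h2⟩; exact ⟨h1, h2⟩
  · intro a ha
    simpa using (Finset.mem_filter.1 ha).2

/-- A set of edges with a net outflow at `u` only contains a walk from `u` to the net inflow. -/
lemma reach_of_flow [Fintype V] {X : Finset A} {u v : V} {m : ℕ} (hm : 0 < m)
    (h : ∀ x, outdeg tl X x + (if x = v then m else 0) =
      outdeg hd X x + if x = u then m else 0) : Reach tl hd X u v := by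
  classical
  by_contra hv
  set S : Finset V := Finset.univ.filter (fun x => Reach tl hd X u x) with hS
  -- The set reached from `u` has net outflow `m`, since it contains the source but not the sink;
  -- yet no edge of `X` leaves it.
  have h1 : ∑ x ∈ S, outdeg tl X x = ∑ x ∈ S, outdeg hd X x + m := by
    have h2 : ∑ x ∈ S, (outdeg tl X x + (if x = v then m else 0)) =
        ∑ x ∈ S, (outdeg hd X x + if x = u then m else 0) := Finset.sum_congr rfl fun x _ => h x
    rw [Finset.sum_add_distrib, Finset.sum_add_distrib, Finset.sum_ite_eq', Finset.sum_ite_eq',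
      if_neg (by simp [hS, hv]), if_pos (by simp [hS, Relation.ReflTransGen.refl])] at h2
    simpa using h2
  rw [sum_outdeg, sum_outdeg] at h1
  have h3 : (X.filter (fun a => tl a ∈ S)).card ≤ (X.filter (fun a => hd a ∈ S)).card := by
    refine Finset.card_le_card fun a ha => ?_
    simp only [Finset.mem_filter, hS, Finset.mem_univ, true_and] at ha ⊢
    exact ⟨ha.1, ha.2.tail ⟨a, ha.1, rfl, rfl⟩⟩
  omega

/-- An acyclic finite digraph has a rank function. -/
lemma exists_rank [Fintype V] {T : Finset A}
    (h : ∀ x, ¬ Relation.TransGen (Step tl hd T) x x) :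
    ∃ r : V → ℕ, ∀ a ∈ T, r (tl a) < r (hd a) := by
  classical
  -- The rank of a vertex is the number of its strict predecessors.
  refine ⟨fun x => (Finset.univ.filter
    (fun y => Relation.TransGen (Step tl hd T) y x)).card, fun a ha => ?_⟩
  have hs : Step tl hd T (tl a) (hd a) := ⟨a, ha, rfl, rfl⟩
  refine Finset.card_lt_card ⟨fun y hy => ?_, fun hsub => ?_⟩
  · simp only [Finset.mem_filter, Finset.mem_univ, true_and] at hy ⊢
    exact hy.tail hs
  · have : tl a ∈ Finset.univ.filter (fun y => Relation.TransGen (Step tl hd T) y (tl a)) :=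
      hsub (by simpa using Relation.TransGen.single hs)
    exact h (tl a) (by simpa using this)

lemma exists_cycle {T : Finset A} {x : V} (h : Relation.TransGen (Step tl hd T) x x) :
    ∃ W ⊆ T, W.Nonempty ∧ ∀ y, outdeg tl W y = outdeg hd W y := by
  obtain ⟨c, ⟨a, ha, rfl, rfl⟩, hc⟩ := Relation.TransGen.head'_iff.1 h
  obtain ⟨Q, hQ, hp⟩ := exists_isDipath hc
  have haQ : a ∉ Q := fun h1 => hp.tl_ne h1 rfl
  refine ⟨insert a Q, Finset.insert_subset ha hQ, by simp, fun y => ?_⟩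
  have := hp.div y
  rw [outdeg_insert haQ, outdeg_insert haQ]
  omega

/-- Walking backwards in an acyclic digraph one arrives at a source. -/
lemma reach_of_rank {T : Finset A} {N : Set V} {r : V → ℕ} (hr : ∀ a ∈ T, r (tl a) < r (hd a))
    (h : ∀ a ∈ T, tl a ∉ N → ∃ b ∈ T, hd b = tl a) {a : A} (ha : a ∈ T) :
    ∃ p ∈ N, Reach tl hd T p (tl a) := by
  induction hn : r (tl a) using Nat.strong_induction_on generalizing a with
  | _ n ih =>
    by_cases h1 : tl a ∈ N
    · exact ⟨_, h1, .refl⟩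
    · obtain ⟨b, hb, hba⟩ := h a ha h1
      obtain ⟨p, hp, hp'⟩ := ih (r (tl b)) (by have := hr b hb; rw [hba] at this; omega) hb rfl
      exact ⟨p, hp, hp'.tail ⟨b, hb, rfl, hba⟩⟩

lemma reach_of_rank_hd {T : Finset A} {N : Set V} {r : V → ℕ} (hr : ∀ a ∈ T, r (tl a) < r (hd a))
    (h : ∀ a ∈ T, tl a ∉ N → ∃ b ∈ T, hd b = tl a) {a : A} (ha : a ∈ T) :
    ∃ p ∈ N, Reach tl hd T p (hd a) := by
  obtain ⟨p, hp, hp'⟩ := reach_of_rank hr h ha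
  exact ⟨p, hp, hp'.tail ⟨a, ha, rfl, rfl⟩⟩

end Digraph

end OddPacking

namespace OddPacking

/-! ### Tripods: three arcs between two connected sets -/

section Tripod

variable {V A : Type*} (tl hd : A → V) [DecidableEq A]

/-- `Arc N S I h`: the set `S` is the edge set of a directed path from a vertex of `N` to `h`,
with interior `I` outside `N`. -/
inductive Arc (N : Set V) : Finset A → Set V → V → Prop
  | single (a : A) (h1 : tl a ∈ N) (h2 : hd a ∉ N) : Arc N {a} ∅ (hd a)
  | snoc (S : Finset A) (I : Set V) (a : A) (h : Arc N S I (tl a)) (h1 : hd a ∉ N)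
      (h2 : hd a ∉ I) (h3 : hd a ≠ tl a) : Arc N (insert a S) (insert (tl a) I) (hd a)

variable {tl hd}

lemma Arc.notMem {N : Set V} {S : Finset A} {I : Set V} {h : V} (H : Arc tl hd N S I h) :
    h ∉ N ∧ h ∉ I ∧ ∀ x ∈ I, x ∉ N := by
  induction H with
  | single a h1 h2 => exact ⟨h2, by simp, by simp⟩
  | snoc S I a h h1 h2 h3 ih =>
    refine ⟨h1, by simp [h2, h3], fun x hx => ?_⟩
    rcases hx with rfl | hx
    · exact ih.1
    · exact ih.2.2 x hx

lemma Arc.nonempty {N : Set V} {S : Finset A} {I : Set V} {h : V} (H : Arc tl hd N S I h) :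
    S.Nonempty := by
  cases H <;> simp

lemma Arc.ends {N : Set V} {S : Finset A} {I : Set V} {h : V} (H : Arc tl hd N S I h) :
    ∀ a ∈ S, (tl a ∈ N ∨ tl a ∈ I) ∧ (hd a = h ∨ hd a ∈ I) := by
  induction H with
  | single a h1 h2 => simp [h1]
  | snoc S I a h h1 h2 h3 ih =>
    intro b hb
    rcases Finset.mem_insert.1 hb with rfl | hb
    · simp
    · have := ih b hb
      simp only [Set.mem_insert_iff]
      tauto

lemma Arc.tl_ne {N : Set V} {S : Finset A} {I : Set V} {h : V} (H : Arc tl hd N S I h) {a : A}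
    (ha : a ∈ S) : tl a ≠ h := by
  rintro rfl
  have := H.notMem
  have := (H.ends a ha).1
  tauto

lemma Arc.reach {N : Set V} {S : Finset A} {I : Set V} {h : V} (H : Arc tl hd N S I h) :
    ∃ p ∈ N, Reach tl hd S p h := by
  induction H with
  | single a h1 h2 => exact ⟨tl a, h1, .single ⟨a, by simp, rfl, rfl⟩⟩
  | snoc S I a h h1 h2 h3 ih =>
    obtain ⟨p, hp, hr⟩ := ih
    exact ⟨p, hp, (reach_mono (Finset.subset_insert _ _) hr).tail ⟨a, by simp, rfl, rfl⟩⟩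

/-- Connectivity is recorded both without and with the head: the interior alone becomes the core of
a branch set, and the interior with its head is what gets absorbed into `N`. -/
lemma Arc.connected {N : Set V} {S : Finset A} {I : Set V} {h : V} (H : Arc tl hd N S I h) :
    ∃ a ∈ S, tl a ∈ N ∧ (hd a = h ∨ hd a ∈ I) ∧
      (I.Nonempty → hd a ∈ I ∧ ∃ b ∈ S, tl b ∈ I ∧ hd b = h) ∧
      (∀ x ∈ I, Relation.ReflTransGen (Joined tl hd S I) (hd a) x) ∧
      (∀ x ∈ insert h I, Relation.ReflTransGen (Joined tl hd S (insert h I)) (hd a) x) := by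
  induction H with
  | single a h1 h2 =>
    refine ⟨a, by simp, h1, Or.inl rfl, by simp, by simp, fun x hx => ?_⟩
    simp at hx
    rw [hx]
  | snoc S I a h h1 h2 h3 ih =>
    obtain ⟨c, hc, hcN, hch, hI, hx, hx'⟩ := ih
    have key : ∀ x ∈ insert (tl a) I, Relation.ReflTransGen
        (Joined tl hd (insert a S) (insert (tl a) I)) (hd c) x := fun x hxI =>
      joined_rtg_mono (Finset.subset_insert _ _) subset_rfl (hx' x hxI)
    refine ⟨c, by simp [hc], hcN, Or.inr (by simpa using hch), fun _ => ⟨by simpa using hch,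
      a, by simp, by simp, rfl⟩, key, fun x hxI => ?_⟩
    have key2 : ∀ x ∈ insert (tl a) I, Relation.ReflTransGen
        (Joined tl hd (insert a S) (insert (hd a) (insert (tl a) I))) (hd c) x := fun x hxI =>
      joined_rtg_mono subset_rfl (Set.subset_insert _ _) (key x hxI)
    rcases hxI with rfl | hxI
    · exact (key2 (tl a) (by simp)).tail ⟨by simp, by simp, a, by simp, Or.inl ⟨rfl, rfl⟩⟩
    · exact key2 x hxI

lemma Arc.connected_union {N : Set V} {S L : Finset A} {I : Set V} {h u : V}
    (H : Arc tl hd N S I h) (hN : ∀ x ∈ N, Relation.ReflTransGen (Joined tl hd L N) u x) :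
    ∀ x ∈ N ∪ insert h I,
      Relation.ReflTransGen (Joined tl hd (L ∪ S) (N ∪ insert h I)) u x := by
  obtain ⟨a, ha, haN, hah, -, -, hx⟩ := H.connected
  have key : ∀ x ∈ N, Relation.ReflTransGen (Joined tl hd (L ∪ S) (N ∪ insert h I)) u x :=
    fun x hxN => joined_rtg_mono Finset.subset_union_left Set.subset_union_left (hN x hxN)
  rintro x (hxN | hxI)
  · exact key x hxN
  · refine ((key _ haN).tail ⟨Or.inl haN, Or.inr (by simpa using hah), a, by simp [ha],
      Or.inl ⟨rfl, rfl⟩⟩).trans ?_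
    exact joined_rtg_mono Finset.subset_union_right Set.subset_union_right (hx x hxI)

variable [DecidableEq V]

lemma Arc.flow {N : Set V} {S : Finset A} {I : Set V} {h : V} (H : Arc tl hd N S I h) :
    ∀ x ∉ N, outdeg tl S x + (if x = h then 1 else 0) = outdeg hd S x := by
  induction H with
  | single a h1 h2 =>
    intro x hx
    have h3 : x ≠ tl a := by rintro rfl; exact hx h1
    rw [← insert_empty_eq a, outdeg_insert (by simp), outdeg_insert (by simp), if_neg h3]
    simp [outdeg]
  | snoc S I a h h1 h2 h3 ih =>
    intro x hx
    have haS : a ∉ S := fun ha => h.tl_ne ha rfl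
    rw [outdeg_insert haS, outdeg_insert haS]
    have := ih x hx
    omega

variable (tl hd) in
/-- Three disjoint arcs that start in `N`, and a rest `R` of `T` that carries flow from their heads
to `v`. -/
structure Fan (N : Set V) (v : V) (T : Finset A) (S : Fin 3 → Finset A) (I : Fin 3 → Set V)
    (h : Fin 3 → V) (R : Finset A) : Prop where
  arc : ∀ i, Arc tl hd N (S i) (I i) (h i)
  sub : ∀ i, S i ⊆ T
  Rsub : R ⊆ T
  disj : ∀ i j, i ≠ j → Disjoint (S i) (S j)
  Rdisj : ∀ i, Disjoint (S i) R
  Idisj : ∀ i j, i ≠ j → Disjoint (I i) (I j)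
  hI : ∀ i j, h i ∉ I j
  vI : ∀ i, v ∉ I i
  RI : ∀ a ∈ R, ∀ i, hd a ∉ I i
  flow : ∀ x, outdeg tl R x + (if x = v then 3 else 0) =
    outdeg hd R x + ∑ i, if x = h i then 1 else 0

lemma sum_update_fin_three {V : Type*} (h : Fin 3 → V) (f : V → ℕ) (i : Fin 3) (y : V) :
    ∑ j, f (Function.update h i y j) + f (h i) = ∑ j, f (h j) + f y := by
  fin_cases i <;> simp [Fin.sum_univ_three, Function.update] <;> omega

/-- No rest edge enters `h i` and no other arc ends there, so conservation forces `h i ≠ v` and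
exactly one rest edge leaving `h i`. That edge prolongs the arc. -/
lemma Fan.extend {N : Set V} {v : V} {T : Finset A} {S : Fin 3 → Finset A} {I : Fin 3 → Set V}
    {h : Fin 3 → V} {R : Finset A} (H : Fan tl hd N v T S I h R)
    (hN : ∀ a ∈ T, hd a ∉ N) (hne : ∀ a ∈ T, hd a ≠ tl a)
    {i : Fin 3} (h0 : outdeg hd R (h i) = 0) (hi : ∀ j, j ≠ i → h j ≠ h i) :
    ∃ S' I' h' R', Fan tl hd N v T S' I' h' R' ∧ R'.card < R.card := by
  have hsum : (∑ j, if h i = h j then 1 else 0) = 1 := by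
    rw [Finset.sum_eq_single i]
    · simp
    · intro j _ hj; rw [if_neg (hi j hj).symm]
    · simp
  have hfl := H.flow (h i)
  rw [hsum, h0] at hfl
  have hiv : h i ≠ v := by
    intro hv; rw [if_pos hv] at hfl; omega
  rw [if_neg hiv] at hfl
  obtain ⟨g, hg, hgi⟩ := (outdeg_pos (f := tl) (X := R) (x := h i)).1 (by omega)
  have hR : R = insert g (R.erase g) := (Finset.insert_erase hg).symm
  have hgT := H.Rsub hg
  refine ⟨Function.update S i (insert g (S i)), Function.update I i (insert (h i) (I i)),
    Function.update h i (hd g), R.erase g, ?_, Finset.card_erase_lt_of_mem hg⟩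
  have hR0 : ∀ a ∈ R, hd a ≠ h i := outdeg_eq_zero.1 h0
  constructor
  · intro j
    by_cases hj : j = i
    · subst hj
      simp only [Function.update_self]
      have h1 := H.arc j
      rw [← hgi] at h1 ⊢
      exact .snoc _ _ _ h1 (hN g hgT) (H.RI g hg j) (hne g hgT)
    · simp only [Function.update_of_ne hj]
      exact H.arc j
  · intro j
    by_cases hj : j = i
    · subst hj
      simp only [Function.update_self]
      exact Finset.insert_subset hgT (H.sub j)
    · simp only [Function.update_of_ne hj]
      exact H.sub j
  · exact (Finset.erase_subset _ _).trans H.Rsub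
  · have key : ∀ j, j ≠ i → Disjoint (insert g (S i)) (S j) := by
      intro j hj
      rw [Finset.disjoint_insert_left]
      exact ⟨fun h1 => Finset.disjoint_left.1 (H.Rdisj j) h1 hg, H.disj i j hj.symm⟩
    intro j k hjk
    by_cases hj : j = i
    · subst hj
      rw [Function.update_self, Function.update_of_ne hjk.symm]
      exact key k hjk.symm
    · rw [Function.update_of_ne hj]
      by_cases hk : k = i
      · subst hk
        rw [Function.update_self]
        exact (key j hj).symm
      · rw [Function.update_of_ne hk]
        exact H.disj j k hjk
  · intro j
    by_cases hj : j = i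
    · subst hj
      rw [Function.update_self, Finset.disjoint_insert_left]
      exact ⟨by simp, (H.Rdisj j).mono_right (Finset.erase_subset _ _)⟩
    · rw [Function.update_of_ne hj]
      exact (H.Rdisj j).mono_right (Finset.erase_subset _ _)
  · have key : ∀ j, j ≠ i → Disjoint (insert (h i) (I i)) (I j) := by
      intro j hj
      rw [Set.disjoint_insert_left]
      exact ⟨H.hI i j, H.Idisj i j hj.symm⟩
    intro j k hjk
    by_cases hj : j = i
    · subst hj
      rw [Function.update_self, Function.update_of_ne hjk.symm]
      exact key k hjk.symm
    · rw [Function.update_of_ne hj]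
      by_cases hk : k = i
      · subst hk
        rw [Function.update_self]
        exact (key j hj).symm
      · rw [Function.update_of_ne hk]
        exact H.Idisj j k hjk
  · intro j k
    have h1 : ∀ k, Function.update h i (hd g) j ∉ I k := by
      intro k
      by_cases hj : j = i
      · subst hj; rw [Function.update_self]; exact H.RI g hg k
      · rw [Function.update_of_ne hj]; exact H.hI j k
    by_cases hk : k = i
    · subst hk
      rw [Function.update_self, Set.mem_insert_iff, not_or]
      refine ⟨?_, h1 k⟩
      by_cases hj : j = k
      · subst hj; rw [Function.update_self]; exact hR0 g hg
      · rw [Function.update_of_ne hj]; exact hi j hj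
    · rw [Function.update_of_ne hk]; exact h1 k
  · intro j
    by_cases hj : j = i
    · subst hj
      rw [Function.update_self, Set.mem_insert_iff, not_or]
      exact ⟨hiv.symm, H.vI j⟩
    · rw [Function.update_of_ne hj]; exact H.vI j
  · intro a ha j
    have ha' := Finset.mem_of_mem_erase ha
    by_cases hj : j = i
    · subst hj
      rw [Function.update_self, Set.mem_insert_iff, not_or]
      exact ⟨hR0 a ha', H.RI a ha' j⟩
    · rw [Function.update_of_ne hj]; exact H.RI a ha' j
  · intro x
    have h1 := H.flow x
    rw [hR, outdeg_insert (by simp), outdeg_insert (by simp), hgi] at h1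
    have h2 := sum_update_fin_three h (fun y => if x = y then 1 else 0) i (hd g)
    omega

/-- Extending the arcs of a fan as long as possible, two of them meet. -/
lemma Fan.exists_merge {N : Set V} {v : V} {T : Finset A} {S : Fin 3 → Finset A}
    {I : Fin 3 → Set V} {h : Fin 3 → V} {R : Finset A} (H : Fan tl hd N v T S I h R)
    (hN : ∀ a ∈ T, hd a ∉ N) {r : V → ℕ} (hr : ∀ a ∈ T, r (tl a) < r (hd a)) :
    ∃ S' I' h' R', Fan tl hd N v T S' I' h' R' ∧ ∃ i j l : Fin 3, i ≠ j ∧ i ≠ l ∧ j ≠ l ∧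
      (∀ k, k = i ∨ k = j ∨ k = l) ∧ h' i = h' j ∧ outdeg hd R' (h' i) = 0 ∧
      (h' l = h' i ∨ 0 < outdeg hd R' (h' l)) := by
  have hne : ∀ a ∈ T, hd a ≠ tl a := fun a ha h1 => by have := hr a ha; rw [h1] at this; omega
  induction hn : R.card using Nat.strong_induction_on generalizing S I h R with
  | _ n ih =>
    -- A tail of minimal rank in `R` is entered by no edge of `R`, so by conservation it must be the
    -- head of an arc.
    have hex : ∃ i, outdeg hd R (h i) = 0 := by
      rcases R.eq_empty_or_nonempty with rfl | hRne
      · exact ⟨0, by simp [outdeg]⟩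
      · obtain ⟨a, ha, hmin⟩ := Finset.exists_min_image R (fun a => r (tl a)) hRne
        have h0 : outdeg hd R (tl a) = 0 := outdeg_eq_zero.2 fun b hb hba => by
          have h1 := hmin b hb
          have h2 := hr b (H.Rsub hb)
          rw [hba] at h2
          omega
        have h1 : 0 < outdeg tl R (tl a) := outdeg_pos.2 ⟨a, ha, rfl⟩
        have h2 := H.flow (tl a)
        have h3 : 0 < ∑ i, if tl a = h i then 1 else 0 := by omega
        obtain ⟨i, -, hi⟩ := Finset.exists_ne_zero_of_sum_ne_zero h3.ne'
        have hi' : tl a = h i := by by_contra h4; simp [h4] at hi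
        exact ⟨i, hi' ▸ h0⟩
    obtain ⟨i, h0⟩ := hex
    by_cases hi : ∀ j, j ≠ i → h j ≠ h i
    · obtain ⟨S', I', h', R', H', hlt⟩ := H.extend hN hne h0 hi
      exact ih _ (hn ▸ hlt) H' rfl
    push Not at hi
    obtain ⟨j, hji, hj⟩ := hi
    obtain ⟨l, hil, hjl, hall⟩ : ∃ l, i ≠ l ∧ j ≠ l ∧ ∀ k, k = i ∨ k = j ∨ k = l := by
      clear h0 hj
      revert i j
      decide
    -- Two heads already coincide. If the third stands alone and no rest edge enters it, that arc
    -- can still be extended.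
    by_cases hl : h l = h i ∨ 0 < outdeg hd R (h l)
    · exact ⟨S, I, h, R, H, i, j, l, hji.symm, hil, hjl, hall, hj.symm, h0, hl⟩
    · push Not at hl
      obtain ⟨S', I', h', R', H', hlt⟩ := H.extend hN hne (i := l) (by omega) fun k hk => by
        rcases hall k with rfl | rfl | rfl
        · exact hl.1.symm
        · rw [hj]; exact hl.1.symm
        · exact absurd rfl hk
      exact ih _ (hn ▸ hlt) H' rfl

end Tripod

end OddPacking

namespace OddPacking

/-! ### From a flow of value three to a tripod -/

section Star

variable {V A : Type*} (tl hd : A → V) [DecidableEq A]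

/-- Two disjoint connected sets `Nu`, `Nv` joined by three arcs `S i` with interiors `I i`, such
that `Z ∪ S i` is good while `Z` is not; the edges in `L` connect `Nu` and `Nv`. -/
structure Tripod (Good : Finset A → Prop) (T : Finset A) (u v : V) (Nu Nv : Set V)
    (Z L : Finset A) (S : Fin 3 → Finset A) (I : Fin 3 → Set V) : Prop where
  memu : u ∈ Nu
  memv : v ∈ Nv
  disj : Disjoint Nu Nv
  bad : ¬ Good Z
  good : ∀ i, Good (Z ∪ S i)
  Zsub : Z ⊆ T
  Lsub : L ⊆ T
  Ssub : ∀ i, S i ⊆ T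
  LZ : Disjoint L Z
  LS : ∀ i, Disjoint L (S i)
  SZ : ∀ i, Disjoint (S i) Z
  SS : ∀ i j, i ≠ j → Disjoint (S i) (S j)
  connu : ∃ r ∈ Nu, ∀ x ∈ Nu, Relation.ReflTransGen (Joined tl hd L Nu) r x
  connv : ∃ r ∈ Nv, ∀ x ∈ Nv, Relation.ReflTransGen (Joined tl hd L Nv) r x
  Iu : ∀ i, Disjoint (I i) Nu
  Iv : ∀ i, Disjoint (I i) Nv
  II : ∀ i j, i ≠ j → Disjoint (I i) (I j)
  ends : ∀ i, ∀ a ∈ S i, (tl a ∈ Nu ∨ tl a ∈ I i) ∧ (hd a ∈ Nv ∨ hd a ∈ I i)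
  first : ∀ i, (I i).Nonempty → ∃ a ∈ S i, tl a ∈ Nu ∧ hd a ∈ I i ∧
    ∀ x ∈ I i, Relation.ReflTransGen (Joined tl hd (S i) (I i)) (hd a) x
  last : ∀ i, (I i).Nonempty → ∃ a ∈ S i, tl a ∈ I i ∧ hd a ∈ Nv

variable [DecidableEq V]

/-- A connected set `N` containing `u`, a bad set `Z`, and a flow `T` of value three from `N` to
`v` such that `Z` becomes good when the edges of any walk of `T` from `N` to `v` are added. -/
structure FlowState (Good : Finset A → Prop) (T₀ : Finset A) (u v : V) (N : Set V)
    (L Z T : Finset A) : Prop where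
  memu : u ∈ N
  memv : v ∉ N
  conn : ∀ x ∈ N, Relation.ReflTransGen (Joined tl hd L N) u x
  LZ : Disjoint L Z
  LT : Disjoint L T
  ZT : Disjoint Z T
  Lsub : L ⊆ T₀
  Zsub : Z ⊆ T₀
  Tsub : T ⊆ T₀
  flow : ∀ x ∉ N, outdeg tl T x + (if x = v then 3 else 0) = outdeg hd T x
  good : ∀ X ⊆ T, ∀ p ∈ N, Reach tl hd X p v → Good (Z ∪ X)
  bad : ¬ Good Z

variable {tl hd}

/-- Discards a part of the flow that is balanced outside `N`, such as a directed cycle or a path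
that returns to `N`. -/
lemma FlowState.sdiff {Good : Finset A → Prop} {T₀ : Finset A} {u v : V} {N : Set V}
    {L Z T W : Finset A} (H : FlowState tl hd Good T₀ u v N L Z T) (hW : W ⊆ T)
    (hfl : ∀ x ∉ N, outdeg tl W x = outdeg hd W x) :
    FlowState tl hd Good T₀ u v N L Z (T \ W) where
  memu := H.memu
  memv := H.memv
  conn := H.conn
  LZ := H.LZ
  LT := H.LT.mono_right Finset.sdiff_subset
  ZT := H.ZT.mono_right Finset.sdiff_subset
  Lsub := H.Lsub
  Zsub := H.Zsub
  Tsub := Finset.sdiff_subset.trans H.Tsub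
  flow x hx := by
    have h1 := H.flow x hx
    have h2 := hfl x hx
    have h3 := outdeg_sdiff (f := tl) hW x
    have h4 := outdeg_sdiff (f := hd) hW x
    omega
  good X hX p hp h := H.good X (hX.trans Finset.sdiff_subset) p hp h
  bad := H.bad

/-- If nothing enters `N`, summing conservation over the complement of `N` shows that exactly three
edges of `T` leave `N`. Each of them is an initial arc. -/
lemma FlowState.exists_fan [Fintype V] {Good : Finset A → Prop} {T₀ : Finset A} {u v : V}
    {N : Set V} {L Z T : Finset A} (H : FlowState tl hd Good T₀ u v N L Z T)
    (hN : ∀ a ∈ T, hd a ∉ N) : ∃ S I h R, Fan tl hd N v T S I h R := by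
  classical
  set B := T.filter (fun a => tl a ∈ N) with hB
  have hcard : B.card = 3 := by
    set M : Finset V := Finset.univ.filter (fun x => x ∉ N) with hM
    have h1 : ∑ x ∈ M, (outdeg tl T x + (if x = v then 3 else 0)) = ∑ x ∈ M, outdeg hd T x :=
      Finset.sum_congr rfl fun x hx => H.flow x (by simpa [hM] using hx)
    rw [Finset.sum_add_distrib, Finset.sum_ite_eq', if_pos (by simp [hM, H.memv]), sum_outdeg,
      sum_outdeg] at h1
    have h2 : T.filter (fun a => hd a ∈ M) = T :=
      Finset.filter_true_of_mem fun a ha => by simpa [hM] using hN a ha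
    have h3 : T.filter (fun a => tl a ∈ M) = T.filter (fun a => ¬ tl a ∈ N) := by simp [hM]
    rw [h2, h3] at h1
    have h4 : B.card + (T.filter (fun a => ¬ tl a ∈ N)).card = T.card :=
      Finset.card_filter_add_card_filter_not _
    omega
  obtain ⟨φ⟩ : Nonempty (Fin 3 ≃ B) := ⟨(Finset.equivFinOfCardEq hcard).symm⟩
  have hmem : ∀ i, (φ i : A) ∈ T ∧ tl (φ i) ∈ N := fun i =>
    Finset.mem_filter.1 (φ i).2
  refine ⟨fun i => {(φ i : A)}, fun _ => ∅, fun i => hd (φ i), T \ B, ?_⟩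
  constructor
  · exact fun i => .single _ (hmem i).2 (hN _ (hmem i).1)
  · exact fun i => by simpa using (hmem i).1
  · exact Finset.sdiff_subset
  · intro i j hij
    simp only [Finset.disjoint_singleton]
    exact fun h => hij (φ.injective (Subtype.ext h))
  · intro i
    simp
  · simp
  · simp
  · simp
  · simp
  · intro x
    have hsum : ∀ f : A → V, outdeg f B x = ∑ i, if x = f (φ i) then 1 else 0 := by
      intro f
      unfold outdeg
      rw [Finset.card_filter, ← Finset.sum_coe_sort, ← φ.sum_comp]
      exact Finset.sum_congr rfl fun i _ => by simp [eq_comm]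
    have h3 : outdeg tl (T \ B) x + outdeg tl B x = outdeg tl T x :=
      outdeg_sdiff (Finset.filter_subset _ T) x
    have h4 : outdeg hd (T \ B) x + outdeg hd B x = outdeg hd T x :=
      outdeg_sdiff (Finset.filter_subset _ T) x
    rw [← hsum]
    by_cases hx : x ∈ N
    · have h5 : outdeg hd T x = 0 := outdeg_eq_zero.2 fun a ha h => hN a ha (h ▸ hx)
      have h6 : outdeg tl (T \ B) x = 0 := outdeg_eq_zero.2 fun a ha h => by
        simp only [Finset.mem_sdiff, hB, Finset.mem_filter, not_and] at ha
        exact ha.2 ha.1 (h ▸ hx)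
      have hxv : x ≠ v := by rintro rfl; exact H.memv hx
      rw [if_neg hxv]
      omega
    · have h5 : outdeg tl B x = 0 := outdeg_eq_zero.2 fun a ha h => by
        simp only [hB, Finset.mem_filter] at ha
        exact hx (h ▸ ha.2)
      have := H.flow x hx
      omega

lemma IsDipath.rank_le {q p : V} {Q : Finset A} (h : IsDipath tl hd q p Q) {r : V → ℕ}
    (hr : ∀ a ∈ Q, r (tl a) < r (hd a)) {b : A} (hb : b ∈ Q) : r p ≤ r (tl b) := by
  induction h with
  | nil => simp at hb
  | cons a Q h ha hQ ih =>
    rcases Finset.mem_insert.1 hb with rfl | hb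
    · exact le_rfl
    · exact (hr a (by simp)).le.trans (ih (fun c hc => hr c (by simp [hc])) hb)

/-- At an interior vertex of an arc no rest edge enters and no arc ends, so by conservation no rest
edge leaves. -/
lemma Fan.tl_ne {N : Set V} {v : V} {T : Finset A} {S : Fin 3 → Finset A} {I : Fin 3 → Set V}
    {h : Fin 3 → V} {R : Finset A} (H : Fan tl hd N v T S I h R) {i : Fin 3} {p : V}
    (hp : p ∈ I i) : ∀ a ∈ R, tl a ≠ p := by
  apply outdeg_eq_zero.1
  have h1 := H.flow p
  have h2 : outdeg hd R p = 0 := outdeg_eq_zero.2 fun a ha h' =>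
    H.RI a ha i (by rw [h']; exact hp)
  have h3 : (∑ j, if p = h j then 1 else 0) = 0 :=
    Finset.sum_eq_zero fun j _ => if_neg fun h' => H.hI j i (by rw [← h']; exact hp)
  omega

/-- Absorb an arc `S i` into `N`, where its head is `w`. -/
lemma FlowState.absorb {Good : Finset A → Prop} {T₀ : Finset A} {u v : V}
    {N : Set V} {L Z T Z' T' S : Finset A} {I : Set V} {w : V}
    (H : FlowState tl hd Good T₀ u v N L Z T) (hS : Arc tl hd N S I w) (hST : S ⊆ T)
    (hv : v ∉ insert w I) (hZ' : Disjoint L Z') (hSZ' : Disjoint S Z') (hZT' : Disjoint Z' T')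
    (hST' : Disjoint S T') (hZ'sub : Z' ⊆ T₀) (hT' : T' ⊆ T)
    (hflow : ∀ x ∉ N, x ≠ w → outdeg tl T' x + (if x = v then 3 else 0) = outdeg hd T' x)
    (hI : ∀ x ∈ I, ∀ a ∈ T', tl a ≠ x)
    (hgN : ∀ X ⊆ T', ∀ p ∈ N, Reach tl hd X p v → Good (Z' ∪ X))
    (hgw : ∀ X ⊆ T', Reach tl hd X w v → Good (Z' ∪ X)) (hbad : ¬ Good Z') :
    FlowState tl hd Good T₀ u v (N ∪ insert w I) (L ∪ S) Z' T' where
  memu := Or.inl H.memu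
  memv := by simp only [Set.mem_union, not_or]; exact ⟨H.memv, hv⟩
  conn := hS.connected_union H.conn
  LZ := Finset.disjoint_union_left.2 ⟨hZ', hSZ'⟩
  LT := Finset.disjoint_union_left.2 ⟨H.LT.mono_right hT', hST'⟩
  ZT := hZT'
  Lsub := Finset.union_subset H.Lsub (hST.trans H.Tsub)
  Zsub := hZ'sub
  Tsub := hT'.trans H.Tsub
  flow x hx := by
    simp only [Set.mem_union, Set.mem_insert_iff, not_or] at hx
    exact hflow x hx.1 hx.2.1
  good X hX p hp h := by
    rcases hp with hp | rfl | hp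
    · exact hgN X hX p hp h
    · exact hgw X hX h
    · exfalso
      rcases h.cases_head with rfl | ⟨c, ⟨a, ha, h1, -⟩, -⟩
      · exact hv (by simp [hp])
      · exact hI p hp a (hX ha) h1
  bad := hbad

/-- **Tripod lemma.** -/
theorem FlowState.exists_tripod [Fintype V] {Good : Finset A → Prop}
    (hmono : ∀ X Y, X ⊆ Y → Good X → Good Y) {T₀ : Finset A} {u v : V}
    {N : Set V} {L Z T : Finset A} (H : FlowState tl hd Good T₀ u v N L Z T) :
    ∃ Nu Nv Z L S I, Tripod tl hd Good T₀ u v Nu Nv Z L S I := by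
  induction hn : T.card using Nat.strong_induction_on generalizing N L Z T with
  | _ n ih =>
  -- After balanced parts are removed, `T` is acyclic and no edge of `T` enters `N`: an edge
  -- entering `N`, traced backwards to `N`, would complete a balanced path.
  by_cases hW : ∃ W ⊆ T, W.Nonempty ∧ ∀ x ∉ N, outdeg tl W x = outdeg hd W x
  · obtain ⟨W, hWT, hne, hfl⟩ := hW
    refine ih _ ?_ (H.sdiff hWT hfl) rfl
    rw [← hn]
    exact Finset.card_lt_card (Finset.sdiff_ssubset hWT hne)
  obtain ⟨r, hr⟩ : ∃ r : V → ℕ, ∀ a ∈ T, r (tl a) < r (hd a) := by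
    refine exists_rank fun x hx => hW ?_
    obtain ⟨W, h1, h2, h3⟩ := exists_cycle hx
    exact ⟨W, h1, h2, fun x _ => h3 x⟩
  have hN : ∀ a ∈ T, hd a ∉ N := by
    intro a ha haN
    obtain ⟨p, hp, hpa⟩ := reach_of_rank (N := N) hr (fun a ha haN => by
      have h1 := H.flow _ haN
      have h2 : 0 < outdeg tl T (tl a) := outdeg_pos.2 ⟨a, ha, rfl⟩
      exact outdeg_pos.1 (by omega)) ha
    obtain ⟨Q, hQ, hp'⟩ := exists_isDipath hpa
    have haQ : a ∉ Q := fun h1 => hp'.tl_ne h1 rfl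
    refine hW ⟨insert a Q, Finset.insert_subset ha hQ, by simp, fun x hx => ?_⟩
    have h1 := hp'.div x
    have h2 : x ≠ p := by rintro rfl; exact hx hp
    have h3 : x ≠ hd a := by rintro rfl; exact hx haN
    rw [outdeg_insert haQ, outdeg_insert haQ]
    simp only [h2, h3, if_false] at h1 ⊢
    omega
  obtain ⟨S, I, h, R, hF⟩ := H.exists_fan hN
  obtain ⟨S, I, h, R, hF, i, j, l, hij, hil, hjl, hall, hhij, h0, hl⟩ := hF.exists_merge hN hr
  have hsum : ∀ f : Fin 3 → ℕ, ∑ k, f k = f i + f j + f l := by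
    clear hF h0 hhij hl
    revert i j l
    intro i j l hij hil hjl _ f
    rw [Fin.sum_univ_three]
    fin_cases i <;> fin_cases j <;> fin_cases l <;> simp at hij hil hjl ⊢ <;> omega
  have hSlt : ∀ k, ∀ T' ⊆ T, Disjoint (S k) T' → T'.card < n := by
    intro k T' hT' hd'
    rw [← hn]
    refine Finset.card_lt_card ⟨hT', fun hsub => ?_⟩
    obtain ⟨a, ha⟩ := (hF.arc k).nonempty
    exact Finset.disjoint_left.1 hd' ha (hsub (hF.sub k ha))
  have hST' : ∀ k k', k ≠ k' → Disjoint (S k) (R ∪ S k') := fun k k' hk =>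
    Finset.disjoint_union_right.2 ⟨hF.Rdisj k, hF.disj k k' hk⟩
  have hgN : ∀ X ⊆ T, ∀ p ∈ N, Reach tl hd X p v → Good (Z ∪ X) := H.good
  have hsubT : ∀ k, R ∪ S k ⊆ T := fun k => Finset.union_subset hF.Rsub (hF.sub k)
  have hflow : ∀ k, ∀ x ∉ N, outdeg tl (R ∪ S k) x + (if x = v then 3 else 0) +
      (if x = h k then 1 else 0) = outdeg hd (R ∪ S k) x + ((if x = h i then 1 else 0) +
      (if x = h j then 1 else 0) + if x = h l then 1 else 0) := by
    intro k x hx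
    have h1 := hF.flow x
    have h2 := (hF.arc k).flow x hx
    rw [hsum] at h1
    rw [outdeg_union (hF.Rdisj k).symm, outdeg_union (hF.Rdisj k).symm]
    omega
  -- The terminal case. A path `Q` from `h l` to `v` that leaves `Z` bad is moved into `Z`. The rest
  -- `R \ Q` then carries two units from the merging vertex to `v`, and the vertices it reaches from
  -- there form `Nv`.
  have final : Good (Z ∪ S i) → Good (Z ∪ S j) →
      (∃ X ⊆ R, Reach tl hd X (h l) v ∧ ¬ Good (Z ∪ X)) →
      ∃ Nu Nv Z L S I, Tripod tl hd Good T₀ u v Nu Nv Z L S I := by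
    rintro hgi hgj ⟨X, hXR, hX, hbad⟩
    obtain ⟨Q, hQX, hQ⟩ := exists_isDipath hX
    have hQR := hQX.trans hXR
    have hQT := hQR.trans hF.Rsub
    have hX'T : R \ Q ⊆ T := Finset.sdiff_subset.trans hF.Rsub
    have hfl : ∀ x, outdeg tl (R \ Q) x + (if x = v then 2 else 0) =
        outdeg hd (R \ Q) x + if x = h i then 2 else 0 := by
      intro x
      have h1 := hF.flow x
      rw [hsum, ← hhij] at h1
      have h2 := hQ.div x
      have h3 := outdeg_sdiff (f := tl) hQR x
      have h4 := outdeg_sdiff (f := hd) hQR x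
      split_ifs at * <;> omega
    have hmeml : Reach tl hd (R \ Q) (h i) (h l) := by
      rcases hl with hl | hl
      · rw [hl]
      obtain ⟨a, haR, hal⟩ := outdeg_pos.1 hl
      -- Ranks increase along `Q`, which starts at `h l`, so no edge of `Q` enters `h l`.
      have haQ : a ∉ Q := fun haQ => by
        have h1 := hQ.rank_le (fun a ha => hr a (hQT ha)) haQ
        have h2 := hr a (hQT haQ)
        rw [hal] at h2
        omega
      obtain ⟨p, hp, hpa⟩ := reach_of_rank_hd (T := R \ Q) (N := {h i})
        (fun a ha => hr a (hX'T ha)) (fun b hb hbi => by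
          have h1 := hfl (tl b)
          rw [if_neg (show tl b ≠ h i by simpa using hbi)] at h1
          have h2 : 0 < outdeg tl (R \ Q) (tl b) := outdeg_pos.2 ⟨b, hb, rfl⟩
          exact outdeg_pos.1 (by omega)) (a := a) (by simp [haR, haQ])
      rw [Set.mem_singleton_iff] at hp
      rwa [hp, hal] at hpa
    have hhN : ∀ k, Reach tl hd (R \ Q) (h i) (h k) := fun k => by
      rcases hall k with rfl | rfl | rfl
      · exact .refl
      · rw [hhij]
      · exact hmeml
    have hNv : ∀ x, Reach tl hd (R \ Q) (h i) x → x ∉ N ∧ ∀ k, x ∉ I k := by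
      intro x hx
      rcases hx.cases_tail with rfl | ⟨c, -, a, ha, -, rfl⟩
      · exact ⟨(hF.arc i).notMem.1, fun k => hF.hI i k⟩
      · have haR := Finset.sdiff_subset ha
        exact ⟨hN a (hF.Rsub haR), hF.RI a haR⟩
    refine ⟨N, {x | Reach tl hd (R \ Q) (h i) x}, Z ∪ Q, L ∪ (R \ Q), S, I, ?_⟩
    constructor
    · exact H.memu
    · exact reach_of_flow (by norm_num) hfl
    · exact Set.disjoint_left.2 fun x hx hx' => (hNv x hx').1 hx
    · exact fun hg => hbad (hmono _ _ (Finset.union_subset_union_right hQX) hg)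
    · intro k
      have hsub : Z ∪ S k ⊆ Z ∪ Q ∪ S k :=
        Finset.union_subset_union_left Finset.subset_union_left
      rcases hall k with rfl | rfl | rfl
      · exact hmono _ _ hsub hgi
      · exact hmono _ _ hsub hgj
      -- The third arc followed by `Q` is a walk from `N` to `v`, so goodness comes from the flow
      -- state.
      · obtain ⟨p, hp, hpw⟩ := (hF.arc k).reach
        have := hgN (Q ∪ S k) (Finset.union_subset hQT (hF.sub k)) p hp
          ((reach_mono Finset.subset_union_right hpw).trans
            (reach_mono Finset.subset_union_left hQ.reach))
        rwa [← Finset.union_assoc] at this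
    · exact Finset.union_subset H.Zsub (hQT.trans H.Tsub)
    · exact Finset.union_subset H.Lsub (hX'T.trans H.Tsub)
    · exact fun k => (hF.sub k).trans H.Tsub
    · refine Finset.disjoint_union_left.2 ⟨Finset.disjoint_union_right.2
        ⟨H.LZ, H.LT.mono_right hQT⟩, Finset.disjoint_union_right.2
        ⟨(H.ZT.mono_right hX'T).symm, Finset.sdiff_disjoint⟩⟩
    · exact fun k => Finset.disjoint_union_left.2 ⟨H.LT.mono_right (hF.sub k),
        ((hF.Rdisj k).mono_right Finset.sdiff_subset).symm⟩
    · exact fun k => Finset.disjoint_union_right.2 ⟨(H.ZT.mono_right (hF.sub k)).symm,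
        (hF.Rdisj k).mono_right hQR⟩
    · exact hF.disj
    · exact ⟨u, H.memu, fun x hx =>
        joined_rtg_mono Finset.subset_union_left subset_rfl (H.conn x hx)⟩
    · exact ⟨h i, .refl, fun x hx =>
        joined_rtg_mono Finset.subset_union_right subset_rfl (reach_joined hx)⟩
    · exact fun k => Set.disjoint_left.2 fun x hx => (hF.arc k).notMem.2.2 x hx
    · exact fun k => Set.disjoint_left.2 fun x hx hx' => (hNv x hx').2 k hx
    · exact hF.Idisj
    · intro k a ha
      refine ⟨((hF.arc k).ends a ha).1, ((hF.arc k).ends a ha).2.imp_left fun h1 => ?_⟩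
      rw [h1]
      exact hhN k
    · intro k hne
      obtain ⟨a, ha, h1, -, h2, h3, -⟩ := (hF.arc k).connected
      exact ⟨a, ha, h1, (h2 hne).1, h3⟩
    · intro k hne
      obtain ⟨a, ha, h1, -, h2, h3, -⟩ := (hF.arc k).connected
      obtain ⟨b, hb, hb1, hb2⟩ := (h2 hne).2
      exact ⟨b, hb, hb1, by rw [hb2]; exact hhN k⟩
  by_cases hwv : h i = v
  swap
  -- the merging vertex is not `v`
  · have hwI : ∀ k, v ∉ insert (h i) (I k) := fun k => by
      simp only [Set.mem_insert_iff, not_or]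
      exact ⟨Ne.symm hwv, hF.vI k⟩
    have hIT : ∀ k k', k ≠ k' → ∀ x ∈ I k, ∀ a ∈ R ∪ S k', tl a ≠ x := by
      intro k k' hk x hx a ha hax
      rcases Finset.mem_union.1 ha with ha | ha
      · exact hF.tl_ne hx a ha hax
      · rcases ((hF.arc k').ends a ha).1 with h1 | h1
        · exact (hF.arc k).notMem.2.2 x hx (hax ▸ h1)
        · exact Set.disjoint_left.1 (hF.Idisj k k' hk) hx (hax ▸ h1)
    -- If adding `S i'` keeps `Z` bad, move `S i'` into `Z` and absorb the parallel arc `j'` into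
    -- `N`. A walk from the merging vertex is still good, since `S i'`, now in `Z`, leads from the
    -- old `N` to that vertex.
    have merge : ∀ i' j' : Fin 3, i' ≠ j' → i' ≠ l → j' ≠ l → h i' = h i → h j' = h i →
        ¬ Good (Z ∪ S i') → ∃ Nu Nv Z L S I, Tripod tl hd Good T₀ u v Nu Nv Z L S I := by
      intro i' j' hij' hil' hjl' hi' hj' hng
      refine ih _ (hSlt j' (R ∪ S l) (hsubT l) (hST' j' l hjl'))
        (H.absorb (Z' := Z ∪ S i') (T' := R ∪ S l) (hj' ▸ hF.arc j') (hF.sub j') (hwI j')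
          ?_ ?_ ?_ (hST' j' l hjl') ?_ (hsubT l) ?_ (hIT j' l hjl') ?_ ?_ hng) rfl
      · exact Finset.disjoint_union_right.2 ⟨H.LZ, H.LT.mono_right (hF.sub i')⟩
      · exact Finset.disjoint_union_right.2
          ⟨(H.ZT.mono_right (hF.sub j')).symm, hF.disj j' i' hij'.symm⟩
      · exact Finset.disjoint_union_left.2 ⟨H.ZT.mono_right (hsubT l), hST' i' l hil'⟩
      · exact Finset.union_subset H.Zsub ((hF.sub i').trans H.Tsub)
      · intro x hx hxw
        have h1 := hflow l x hx
        rw [← hhij, if_neg hxw] at h1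
        omega
      · intro X hX p hp hr'
        refine hmono _ _ ?_ (hgN X (hX.trans (hsubT l)) p hp hr')
        exact Finset.union_subset_union_left Finset.subset_union_left
      · intro X hX hr'
        obtain ⟨p, hp, hpw⟩ := (hF.arc i').reach
        rw [hi'] at hpw
        have := hgN (S i' ∪ X) (Finset.union_subset (hF.sub i') (hX.trans (hsubT l))) p hp
          ((reach_mono Finset.subset_union_left hpw).trans
            (reach_mono Finset.subset_union_right hr'))
        rwa [← Finset.union_assoc] at this
    by_cases hgi : Good (Z ∪ S i)
    swap
    · exact merge i j hij hil hjl rfl hhij.symm hgi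
    by_cases hgj : Good (Z ∪ S j)
    swap
    · exact merge j i hij.symm hjl hil hhij.symm rfl hgj
    by_cases hX : ∃ X ⊆ R, Reach tl hd X (h l) v ∧ ¬ Good (Z ∪ X)
    · exact final hgi hgj hX
    push Not at hX
    -- Now every walk of the rest from `h l` to `v` is good together with `Z`, so the third arc can
    -- be absorbed with `Z` unchanged. Were `h l` equal to `v`, the empty walk would make `Z` good.
    have hlv : h l ≠ v := fun h1 => H.bad (by
      simpa using hX ∅ (Finset.empty_subset _) (by rw [h1]))
    have hT'sub : R ∪ S i ∪ S j ⊆ T := Finset.union_subset (hsubT i) (hF.sub j)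
    have hlT' : Disjoint (S l) (R ∪ S i ∪ S j) :=
      Finset.disjoint_union_right.2 ⟨hST' l i hil.symm, hF.disj l j hjl.symm⟩
    have hjd : Disjoint (R ∪ S i) (S j) := (hST' j i hij.symm).symm
    refine ih _ (hSlt l _ hT'sub hlT') (H.absorb (Z' := Z) (T' := R ∪ S i ∪ S j) (hF.arc l)
      (hF.sub l) ?_ H.LZ (H.ZT.mono_right (hF.sub l)).symm (H.ZT.mono_right hT'sub) hlT' H.Zsub
      hT'sub ?_ ?_ ?_ ?_ H.bad) rfl
    · simp only [Set.mem_insert_iff, not_or]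
      exact ⟨hlv.symm, hF.vI l⟩
    · intro x hx hxw
      have h1 := hflow i x hx
      have h2 := (hF.arc j).flow x hx
      rw [outdeg_union hjd, outdeg_union hjd]
      rw [if_neg hxw] at h1
      omega
    · intro x hx a ha
      rcases Finset.mem_union.1 ha with ha | ha
      · exact hIT l i hil.symm x hx a ha
      · exact hIT l j hjl.symm x hx a (Finset.mem_union_right _ ha)
    · exact fun X hXT => hgN X (hXT.trans hT'sub)
    · intro X hXT hXv
      -- A walk from `h l` never enters `N` or the interior of an arc, so it uses rest edges only.
      have key : ∀ y, Reach tl hd X (h l) y →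
          Reach tl hd (X ∩ R) (h l) y ∧ y ∉ N ∧ ∀ k, y ∉ I k := by
        intro y hy
        induction hy with
        | refl => exact ⟨.refl, (hF.arc l).notMem.1, hF.hI l⟩
        | tail _ hs ih' =>
          obtain ⟨a, ha, rfl, rfl⟩ := hs
          have haS : ∀ k, a ∉ S k := fun k hk =>
            ((hF.arc k).ends a hk).1.elim ih'.2.1 (ih'.2.2 k)
          have haR : a ∈ R := by
            have := hXT ha
            simp only [Finset.mem_union] at this
            have := haS i
            have := haS j
            tauto
          exact ⟨ih'.1.tail ⟨a, Finset.mem_inter.2 ⟨ha, haR⟩, rfl, rfl⟩, hN a (hF.Rsub haR),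
            hF.RI a haR⟩
      exact hmono _ _ (Finset.union_subset_union_right Finset.inter_subset_left)
        (hX _ Finset.inter_subset_right (key v hXv).1)
  -- If two arcs meet at `v`, no rest edge enters `v`, and absorbing three units there requires the
  -- third arc to end at `v` as well.
  · have hlv : h l = v := by
      have h1 := hF.flow (h i)
      by_contra h2
      rw [hsum, h0, if_pos hwv, ← hhij, if_neg (show h i ≠ h l from hwv ▸ Ne.symm h2),
        if_pos rfl] at h1
      omega
    have hgood : ∀ k, h k = v → Good (Z ∪ S k) := fun k hk => by
      obtain ⟨p, hp, hpw⟩ := (hF.arc k).reach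
      exact hgN (S k) (hF.sub k) p hp (hk ▸ hpw)
    refine final (hgood i hwv) (hgood j (hhij ▸ hwv)) ⟨∅, Finset.empty_subset _, ?_, ?_⟩
    · rw [hlv]
    · simpa using H.bad

end Star

end OddPacking

namespace OddPacking

/-! ### Rooted odd triangles in three-coloured graphs -/

section Triangle

variable {W : Type*}

/-- Adjacency inside `S`. -/
def Link (Adj : W → W → Prop) (S : Set W) (p q : W) : Prop := p ∈ S ∧ q ∈ S ∧ Adj p q

lemma Link.mono {Adj Adj' : W → W → Prop} {S S' : Set W} (h : ∀ p q, Adj p q → Adj' p q)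
    (hS : S ⊆ S') {p q : W} (hl : Link Adj S p q) : Link Adj' S' p q :=
  ⟨hS hl.1, hS hl.2.1, h _ _ hl.2.2⟩

lemma link_rtg_mono {Adj Adj' : W → W → Prop} {S S' : Set W} (h : ∀ p q, Adj p q → Adj' p q)
    (hS : S ⊆ S') {p q : W} (hl : Relation.ReflTransGen (Link Adj S) p q) :
    Relation.ReflTransGen (Link Adj' S') p q :=
  Relation.ReflTransGen.mono (fun _ _ => Link.mono h hS) _ _ hl

lemma link_rtg_symm {Adj : W → W → Prop} (hs : ∀ p q, Adj p q → Adj q p) {S : Set W} {p q : W}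
    (hl : Relation.ReflTransGen (Link Adj S) p q) : Relation.ReflTransGen (Link Adj S) q p := by
  induction hl with
  | refl => exact .refl
  | tail _ h ih => exact .head ⟨h.2.1, h.1, hs _ _ h.2.2⟩ ih

/-- A walk between distinct vertices is an edge, or can be shortened to one that does not return to
its ends. -/
lemma link_rtg_interior {Adj : W → W → Prop} {S : Set W} {z z' : W} (hne : z ≠ z')
    (h : Relation.ReflTransGen (Link Adj S) z z') :
    Adj z z' ∨ ∃ p q, p ∈ S \ {z, z'} ∧ q ∈ S \ {z, z'} ∧ Adj z p ∧ Adj q z' ∧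
      Relation.ReflTransGen (Link Adj (S \ {z, z'})) p q := by
  set goal := Adj z z' ∨ ∃ p q, p ∈ S \ {z, z'} ∧ q ∈ S \ {z, z'} ∧ Adj z p ∧ Adj q z' ∧
      Relation.ReflTransGen (Link Adj (S \ {z, z'})) p q with hgoal
  -- The invariant remembers only the part of the walk after the last visit to `z`, and stops at the
  -- first visit to `z'`.
  have key : ∀ x, Relation.ReflTransGen (Link Adj S) z x → goal ∨ x = z ∨
      (x ∈ S \ {z, z'} ∧ ∃ p ∈ S \ {z, z'}, Adj z p ∧
        Relation.ReflTransGen (Link Adj (S \ {z, z'})) p x) := by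
    intro x hx
    induction hx with
    | refl => exact Or.inr (Or.inl rfl)
    | @tail x y _ hxy ih =>
      by_cases hyz : y = z
      · exact Or.inr (Or.inl hyz)
      by_cases hyz' : y = z'
      · subst hyz'
        rcases ih with h1 | rfl | ⟨hx, p, hp, hzp, hpx⟩
        · exact Or.inl h1
        · exact Or.inl (Or.inl hxy.2.2)
        · exact Or.inl (Or.inr ⟨p, x, hp, hx, hzp, hxy.2.2, hpx⟩)
      · have hy : y ∈ S \ {z, z'} := ⟨hxy.2.1, by simp [hyz, hyz']⟩
        rcases ih with h1 | rfl | ⟨hx, p, hp, hzp, hpx⟩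
        · exact Or.inl h1
        · exact Or.inr (Or.inr ⟨hy, y, hy, hxy.2.2, .refl⟩)
        · exact Or.inr (Or.inr ⟨hy, p, hp, hzp, hpx.tail ⟨hx, hy, hxy.2.2⟩⟩)
  rcases key z' h with h1 | h1 | ⟨h1, -⟩
  · exact h1
  · exact absurd h1.symm hne
  · exact absurd h1.2 (by simp)

/-- `1` if the colours of `x` and `y` differ. -/
def colDiff (col : W → Fin 3) (x y : W) : ZMod 2 := if col x = col y then 0 else 1

lemma colDiff_comm (col : W → Fin 3) (x y : W) : colDiff col x y = colDiff col y x := by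
  simp [colDiff, eq_comm]

/-- The vertices of `Y` that have colour `i` or `j`. -/
def kempe (col : W → Fin 3) (Y : Finset W) (i j : Fin 3) : Set W :=
  {x | x ∈ Y ∧ (col x = i ∨ col x = j)}

/-- Three disjoint sets `{x | M x = some i}` with roots `z i`, each connected by edges that are
even after switching by `t`, and pairwise joined by odd edges; edges are odd if they join
vertices of different colours. -/
structure OddTriangle (Adj : W → W → Prop) (col : W → Fin 3) (Y : Finset W) (z : Fin 3 → W)
    (M : W → Option (Fin 3)) (t : W → ZMod 2) : Prop where
  root : ∀ i, M (z i) = some i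
  troot : ∀ i, t (z i) = 0
  sub : ∀ x i, M x = some i → x ∈ Y
  conn : ∀ x i, M x = some i → Relation.ReflTransGen (fun p q => M p = some i ∧ M q = some i ∧
    Adj p q ∧ t p + t q = colDiff col p q) (z i) x
  odd : ∀ i j, i ≠ j → ∃ p q, M p = some i ∧ M q = some j ∧ Adj p q ∧
    t p + t q = 1 + colDiff col p q

/-- The adjacency after identifying `a` with its neighbour `b`. -/
def mergeAdj (Adj : W → W → Prop) (col : W → Fin 3) (a b : W) (p q : W) : Prop :=
  Adj p q ∨ (p = b ∧ Adj a q ∧ colDiff col a q = colDiff col a b + colDiff col b q) ∨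
    (q = b ∧ Adj a p ∧ colDiff col a p = colDiff col a b + colDiff col b p)

variable [DecidableEq W]

/-- The vertex `a` joins the branch set of `b`, with switching value shifted by the sign of `ab`.
This makes `ab` even, so an edge inherited from `a` can be rerouted through `a`. -/
lemma OddTriangle.of_merge {Adj : W → W → Prop} (hs : ∀ p q, Adj p q → Adj q p)
    {col : W → Fin 3} {Y : Finset W} {z : Fin 3 → W} {a b : W} (haY : a ∈ Y)
    (hab : Adj a b) (haz : ∀ i, z i ≠ a) (hne : b ≠ a)
    {M : W → Option (Fin 3)} {t : W → ZMod 2}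
    (H : OddTriangle (mergeAdj Adj col a b) col (Y.erase a) z M t) :
    ∃ M t, OddTriangle Adj col Y z M t := by
  set M' : W → Option (Fin 3) := fun x => if x = a then M b else M x with hM'
  set t' : W → ZMod 2 := fun x => if x = a then t b + colDiff col a b else t x with ht'
  have hMa : M' a = M b := by simp [hM']
  have hta : t' a = t b + colDiff col a b := by simp [ht']
  have hMx : ∀ x, x ≠ a → M' x = M x := fun x hx => by simp [hM', hx]
  have htx : ∀ x, x ≠ a → t' x = t x := fun x hx => by simp [ht', hx]
  have hMn : ∀ x i, M x = some i → x ≠ a := fun x i hx =>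
    (Finset.mem_erase.1 (H.sub x i hx)).1
  have hM : ∀ x i, M x = some i → M' x = some i := fun x i hx => by rw [hMx x (hMn x i hx), hx]
  have e1 : ∀ x y d s c : ZMod 2, x + y = c → s = d + c → x + d + y = s := by decide
  have e1' : ∀ x y d s c : ZMod 2, x + y = c → s = d + c → x + (y + d) = s := by decide
  have e2 : ∀ x d : ZMod 2, x + (x + d) = d := by decide
  have e2' : ∀ x d : ZMod 2, x + d + x = d := by decide
  have e3 : ∀ x y d s c : ZMod 2, x + y = 1 + c → s = d + c → x + d + y = 1 + s := by decide
  have e3' : ∀ x y d s c : ZMod 2, x + y = 1 + c → s = d + c → x + (y + d) = 1 + s := by decide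
  have hconn : ∀ x i, M x = some i → Relation.ReflTransGen (fun p q => M' p = some i ∧
      M' q = some i ∧ Adj p q ∧ t' p + t' q = colDiff col p q) (z i) x := by
    intro x i hx
    have hx2 := H.conn x i hx
    clear hx
    induction hx2 with
    | refl => exact .refl
    | @tail p q _ hpq ihx =>
    refine ihx.trans ?_
    obtain ⟨hp, hq, hadj, htt⟩ := hpq
    have hp' := hMn p i hp
    have hq' := hMn q i hq
    rcases hadj with hadj | ⟨rfl, hadj, hc⟩ | ⟨rfl, hadj, hc⟩
    · exact .single ⟨hM p i hp, hM q i hq, hadj, by rw [htx p hp', htx q hq', htt]⟩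
    · refine .head (b := a) ⟨hM p i hp, by rw [hMa, hp], hs _ _ hab, ?_⟩
        (.single ⟨by rw [hMa, hp], hM q i hq, hadj, ?_⟩)
      · rw [htx p hp', hta, e2, colDiff_comm]
      · rw [hta, htx q hq']
        exact e1 _ _ _ _ _ htt hc
    · refine .head (b := a) ⟨hM p i hp, by rw [hMa, hq], hs _ _ hadj, ?_⟩
        (.single ⟨by rw [hMa, hq], hM q i hq, hab, ?_⟩)
      · rw [htx p hp', hta, colDiff_comm col p a]
        exact e1' _ _ _ _ _ htt (by rw [hc, colDiff_comm col q p])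
      · rw [hta, htx q hq', e2']
  refine ⟨M', t', ⟨fun i => by rw [hMx _ (haz i), H.root], fun i => by rw [htx _ (haz i), H.troot],
    fun x i hx => ?_, fun x i hx => ?_, fun i j hij => ?_⟩⟩
  · by_cases hxa : x = a
    · rw [hxa]; exact haY
    · rw [hMx x hxa] at hx
      exact Finset.mem_of_mem_erase (H.sub x i hx)
  · by_cases hxa : x = a
    · subst hxa
      rw [hMa] at hx
      refine (hconn b i hx).tail ⟨hM b i hx, by rw [hMa, hx], hs _ _ hab, ?_⟩
      rw [hta, htx b hne, e2, colDiff_comm]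
    · rw [hMx x hxa] at hx
      exact hconn x i hx
  · obtain ⟨p, q, hp, hq, hadj, htt⟩ := H.odd i j hij
    have hp' := hMn p i hp
    have hq' := hMn q j hq
    rcases hadj with hadj | ⟨rfl, hadj, hc⟩ | ⟨rfl, hadj, hc⟩
    · exact ⟨p, q, hM p i hp, hM q j hq, hadj, by rw [htx p hp', htx q hq', htt]⟩
    · refine ⟨a, q, by rw [hMa, hp], hM q j hq, hadj, ?_⟩
      rw [hta, htx q hq']
      exact e3 _ _ _ _ _ htt hc
    · refine ⟨p, a, hM p i hp, by rw [hMa, hq], hs _ _ hadj, ?_⟩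
      rw [hta, htx p hp', colDiff_comm col p a]
      exact e3' _ _ _ _ _ htt (by rw [hc, colDiff_comm col q p])

lemma exists_link_of_not_erase {Adj : W → W → Prop} {col : W → Fin 3} {Y : Finset W} {i j : Fin 3}
    {z z' a : W} (hza : z ≠ a) (h : Relation.ReflTransGen (Link Adj (kempe col Y i j)) z z')
    (hn : ¬ Relation.ReflTransGen (Link Adj (kempe col (Y.erase a) i j)) z z') :
    a ∈ kempe col Y i j ∧ ∃ b ∈ kempe col Y i j, b ≠ a ∧ Adj b a := by
  by_contra hcon
  refine hn ?_
  have key : ∀ x, Relation.ReflTransGen (Link Adj (kempe col Y i j)) z x →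
      Relation.ReflTransGen (Link Adj (kempe col (Y.erase a) i j)) z x ∧ x ≠ a := by
    intro x hx
    induction hx with
    | refl => exact ⟨.refl, hza⟩
    | @tail x y _ hxy ih =>
      have hya : y ≠ a := by
        rintro rfl
        exact hcon ⟨hxy.2.1, x, hxy.1, ih.2, hxy.2.2⟩
      exact ⟨ih.1.tail ⟨⟨Finset.mem_erase.2 ⟨ih.2, hxy.1.1⟩, hxy.1.2⟩,
        ⟨Finset.mem_erase.2 ⟨hya, hxy.2.1.1⟩, hxy.2.1.2⟩, hxy.2.2⟩, hya⟩
  exact (key z' h).1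

/-- Chains survive identification of `a` with `b`. -/
lemma link_rtg_merge {Adj : W → W → Prop} (hs : ∀ p q, Adj p q → Adj q p)
    {col : W → Fin 3} {Y : Finset W} {i j : Fin 3}
    {z z' a b : W} (hza : z ≠ a) (hz'a : z' ≠ a) (hb : b ∈ kempe col Y i j) (hne : b ≠ a)
    (hcol : ∀ q, (col q = i ∨ col q = j) → colDiff col a q = colDiff col a b + colDiff col b q)
    (h : Relation.ReflTransGen (Link Adj (kempe col Y i j)) z z') :
    Relation.ReflTransGen (Link (mergeAdj Adj col a b) (kempe col (Y.erase a) i j)) z z' := by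
  have hb' : b ∈ kempe col (Y.erase a) i j := ⟨Finset.mem_erase.2 ⟨hne, hb.1⟩, hb.2⟩
  have hmem : ∀ x, x ≠ a → x ∈ kempe col Y i j → x ∈ kempe col (Y.erase a) i j :=
    fun x hx h1 => ⟨Finset.mem_erase.2 ⟨hx, h1.1⟩, h1.2⟩
  have key : ∀ x, Relation.ReflTransGen (Link Adj (kempe col Y i j)) z x →
      Relation.ReflTransGen (Link (mergeAdj Adj col a b) (kempe col (Y.erase a) i j)) z
        (if x = a then b else x) := by
    intro x hx
    induction hx with
    | refl => rw [if_neg hza]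
    | @tail x y _ hxy ih =>
      by_cases hx : x = a
      · rw [if_pos hx] at ih
        by_cases hy : y = a
        · rwa [if_pos hy]
        · rw [if_neg hy]
          exact ih.tail ⟨hb', hmem y hy hxy.2.1, Or.inr (Or.inl
            ⟨rfl, hx ▸ hxy.2.2, hcol y hxy.2.1.2⟩)⟩
      · rw [if_neg hx] at ih
        by_cases hy : y = a
        · rw [if_pos hy]
          exact ih.tail ⟨hmem x hx hxy.1, hb', Or.inr (Or.inr
            ⟨rfl, hs _ _ (hy ▸ hxy.2.2), hcol x hxy.1.2⟩)⟩
        · rw [if_neg hy]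
          exact ih.tail ⟨hmem x hx hxy.1, hmem y hy hxy.2.1, Or.inl hxy.2.2⟩
  simpa [hz'a] using key z' h

/-- In a three-coloured graph in which roots of three colours are pairwise joined by two-coloured
chains, there is an odd triangle on the roots. -/
theorem exists_oddTriangle (col : W → Fin 3) (Adj : W → W → Prop)
    (hs : ∀ p q, Adj p q → Adj q p) (Y : Finset W) (z : Fin 3 → W) (hzY : ∀ i, z i ∈ Y)
    (hzc : ∀ i, col (z i) = i)
    (hch : ∀ i j, i ≠ j → Relation.ReflTransGen (Link Adj (kempe col Y i j)) (z i) (z j)) :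
    ∃ M t, OddTriangle Adj col Y z M t := by
  induction hn : Y.card using Nat.strong_induction_on generalizing Adj Y z with
  | _ n ih =>
  have hzinj : ∀ i j, z i = z j → i = j := fun i j h => by rw [← hzc i, h, hzc]
  have hlt : ∀ a ∈ Y, (Y.erase a).card < n := fun a ha => hn ▸ Finset.card_erase_lt_of_mem ha
  have hsm : ∀ a b p q, mergeAdj Adj col a b p q → mergeAdj Adj col a b q p := by
    intro a b p q h
    rcases h with h | h | h
    · exact Or.inl (hs _ _ h)
    · exact Or.inr (Or.inr h)
    · exact Or.inr (Or.inl h)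
  -- identification of `a` with `b`
  have merge : ∀ a ∈ Y, (∀ i, z i ≠ a) → ∀ b ∈ Y, b ≠ a → Adj a b →
      (∀ i j, i ≠ j → Relation.ReflTransGen (Link Adj (kempe col (Y.erase a) i j)) (z i) (z j) ∨
        ((col b = i ∨ col b = j) ∧ ∀ q, (col q = i ∨ col q = j) →
          colDiff col a q = colDiff col a b + colDiff col b q)) →
      ∃ M t, OddTriangle Adj col Y z M t := by
    intro a ha haz b hb hba hab h
    obtain ⟨M, t, H⟩ := ih _ (hlt a ha) (mergeAdj Adj col a b) (hsm a b) (Y.erase a) z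
      (fun i => Finset.mem_erase.2 ⟨haz i, hzY i⟩) hzc (fun i j hij => by
        rcases h i j hij with h1 | ⟨h1, h2⟩
        · exact link_rtg_mono (fun _ _ => Or.inl) subset_rfl h1
        · exact link_rtg_merge hs (haz i) (haz j) ⟨hb, h1⟩ hba h2 (hch i j hij)) rfl
    exact H.of_merge hs ha hab haz hba
  have skip : ∀ a, ∀ i j, i ≠ j → (∀ i, z i ≠ a) → col a ≠ i → col a ≠ j →
      Relation.ReflTransGen (Link Adj (kempe col (Y.erase a) i j)) (z i) (z j) := by
    intro a i j hij haz hi hj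
    by_contra hcon
    have := (exists_link_of_not_erase (haz i) (hch i j hij) hcon).1.2
    tauto
  -- An edge between vertices of one colour is even, so it can be contracted into its end `b` with
  -- all chains preserved.
  by_cases hsame : ∃ a ∈ Y, (∀ i, z i ≠ a) ∧ ∃ b ∈ Y, b ≠ a ∧ Adj a b ∧ col a = col b
  · obtain ⟨a, ha, haz, b, hb, hba, hab, hcol⟩ := hsame
    refine merge a ha haz b hb hba hab fun i j hij => ?_
    by_cases hc : col a = i ∨ col a = j
    · refine Or.inr ⟨hcol ▸ hc, fun q _ => ?_⟩
      simp [colDiff, hcol]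
    · push Not at hc
      exact Or.inl (skip a i j hij haz hc.1 hc.2)
  -- A vertex that is dispensable for one of the two pairs containing its colour is either deleted
  -- or contracted into a neighbour on the other chain.
  by_cases hsep : ∃ a ∈ Y, (∀ i, z i ≠ a) ∧ ∃ i j, i ≠ j ∧ (col a = i ∨ col a = j) ∧
      Relation.ReflTransGen (Link Adj (kempe col (Y.erase a) i j)) (z i) (z j)
  · obtain ⟨a, ha, haz, i, j, hij, hc, hch1⟩ := hsep
    by_cases hdel : ∀ i j, i ≠ j →
        Relation.ReflTransGen (Link Adj (kempe col (Y.erase a) i j)) (z i) (z j)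
    · obtain ⟨M, t, H⟩ := ih _ (hlt a ha) Adj hs (Y.erase a) z
        (fun i => Finset.mem_erase.2 ⟨haz i, hzY i⟩) hzc hdel rfl
      exact ⟨M, t, H.root, H.troot, fun x i hx => Finset.mem_of_mem_erase (H.sub x i hx),
        H.conn, H.odd⟩
    push Not at hdel
    obtain ⟨i', j', hij', hch2⟩ := hdel
    obtain ⟨⟨-, hac⟩, b, hb, hba, hadj⟩ := exists_link_of_not_erase (haz i') (hch i' j' hij') hch2
    have hbc : col a ≠ col b := fun hc => hsame ⟨a, ha, haz, b, hb.1, hba, hs _ _ hadj, hc⟩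
    -- The broken chain uses the colour of `a` and a colour outside the surviving pair; the latter
    -- is the colour of `b`, as no edge at `a` is monochromatic.
    have hbij : col b ≠ i ∧ col b ≠ j := by
      have hpair : ({i, j} : Finset (Fin 3)) ≠ {i', j'} := by
        intro hpair
        have h1 : (i = i' ∧ j = j') ∨ (i = j' ∧ j = i') := by
          clear hch1 hch2 hc hac hb
          revert i j i' j'
          decide
        rcases h1 with ⟨rfl, rfl⟩ | ⟨rfl, rfl⟩
        · exact hch2 hch1
        · refine hch2 (link_rtg_symm hs (link_rtg_mono (fun _ _ => id) ?_ hch1))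
          exact fun x hx => ⟨hx.1, hx.2.symm⟩
      have := hb.2
      generalize col a = ca at *
      generalize col b = cb at *
      clear hch1 hch2 hb
      revert i j i' j' ca cb
      decide
    -- Among the three pairs of colours, the chain of `{col a, col b}` survives the contraction, the
    -- one of `{i, j}` survives deletion of `a`, and the remaining one never uses `a`.
    refine merge a ha haz b hb.1 hba (hs _ _ hadj) fun i₁ j₁ hij₁ => ?_
    by_cases hcb : col b = i₁ ∨ col b = j₁
    · by_cases hca : col a = i₁ ∨ col a = j₁
      · refine Or.inr ⟨hcb, fun q hq => ?_⟩
        unfold colDiff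
        have h1 : col q = col a ∨ col q = col b := by
          generalize col a = ca at *
          generalize col b = cb at *
          generalize col q = cq at *
          omega
        rcases h1 with h1 | h1
        · rw [h1, if_pos rfl, if_neg hbc, if_neg hbc.symm]; decide
        · rw [h1, if_pos rfl, if_neg hbc, add_zero]
      · push Not at hca
        exact Or.inl (skip a i₁ j₁ hij₁ haz hca.1 hca.2)
    · left
      push Not at hcb
      have h1 : (i = i₁ ∧ j = j₁) ∨ (i = j₁ ∧ j = i₁) := by
        generalize col b = cb at *
        omega
      rcases h1 with ⟨rfl, rfl⟩ | ⟨rfl, rfl⟩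
      · exact hch1
      · refine (link_rtg_symm hs (link_rtg_mono (fun _ _ => id) ?_ hch1))
        exact fun x hx => ⟨hx.1, hx.2.symm⟩
  push Not at hsame hsep
  -- every vertex that is not a root separates its two chains
  have hroots : ∀ i j x, x ∈ kempe col Y i j → x ≠ z i → x ≠ z j → ∀ k, z k ≠ x := by
    rintro i j x ⟨hxY, hx⟩ hxi hxj k rfl
    rw [hzc] at hx
    rcases hx with rfl | rfl
    · exact hxi rfl
    · exact hxj rfl
  have hdirect : ∀ i j, i ≠ j → Adj (z i) (z j) → ∀ x ∈ Y, (∀ k, z k ≠ x) → col x ≠ i := by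
    intro i j hij hadj x hx hxz hxi
    refine hsep x hx hxz i j hij (Or.inl hxi) (.single ⟨⟨?_, Or.inl (hzc i)⟩,
      ⟨?_, Or.inr (hzc j)⟩, hadj⟩)
    · exact Finset.mem_erase.2 ⟨hxz i, hzY i⟩
    · exact Finset.mem_erase.2 ⟨hxz j, hzY j⟩
  have hindirect : ∀ i j, i ≠ j → ¬ Adj (z i) (z j) → ∃ p ∈ Y, (∀ k, z k ≠ p) ∧ Adj (z i) p ∧
      col p = j ∧ (∃ q ∈ Y, (∀ k, z k ≠ q) ∧ col q = i) ∧
      ∀ x ∈ kempe col Y i j \ {z i, z j}, Relation.ReflTransGen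
        (Link Adj (kempe col Y i j \ {z i, z j})) p x := by
    intro i j hij hadj
    rcases link_rtg_interior (fun h => hij (hzinj _ _ h)) (hch i j hij) with h1 | h1
    · exact absurd h1 hadj
    obtain ⟨p, q, hp, hq, hzp, hqz, hpq⟩ := h1
    have hp2 := hp.2
    have hq2 := hq.2
    simp only [Set.mem_insert_iff, Set.mem_singleton_iff, not_or] at hp2 hq2
    have hpz := hroots i j p hp.1 hp2.1 hp2.2
    have hqz' := hroots i j q hq.1 hq2.1 hq2.2
    refine ⟨p, hp.1.1, hpz, hzp, ?_, ⟨q, hq.1.1, hqz', ?_⟩, fun x hx => ?_⟩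
    · have := hsame p hp.1.1 hpz (z i) (hzY i) (hpz i) (hs _ _ hzp)
      rw [hzc] at this
      exact hp.1.2.resolve_left this
    · have := hsame q hq.1.1 hqz' (z j) (hzY j) (hqz' j) hqz
      rw [hzc] at this
      exact hq.1.2.resolve_right this
    · by_contra hcon
      have hx2 := hx.2
      simp only [Set.mem_insert_iff, Set.mem_singleton_iff, not_or] at hx2
      have hxz := hroots i j x hx.1 hx2.1 hx2.2
      refine hsep x hx.1.1 hxz i j hij hx.1.2 ?_
      have hpx : p ≠ x := by rintro rfl; exact hcon .refl
      have key : ∀ y, Relation.ReflTransGen (Link Adj (kempe col Y i j \ {z i, z j})) p y →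
          Relation.ReflTransGen (Link Adj (kempe col (Y.erase x) i j)) p y ∧ y ≠ x := by
        intro y hy
        induction hy with
        | refl => exact ⟨.refl, hpx⟩
        | @tail y w hpy hyw ih' =>
          have hwx : w ≠ x := by rintro rfl; exact hcon (hpy.tail hyw)
          exact ⟨ih'.1.tail ⟨⟨Finset.mem_erase.2 ⟨ih'.2, hyw.1.1.1⟩, hyw.1.1.2⟩,
            ⟨Finset.mem_erase.2 ⟨hwx, hyw.2.1.1.1⟩, hyw.2.1.1.2⟩, hyw.2.2⟩, hwx⟩
      have hzi : z i ∈ kempe col (Y.erase x) i j :=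
        ⟨Finset.mem_erase.2 ⟨hxz i, hzY i⟩, Or.inl (hzc i)⟩
      have hzj : z j ∈ kempe col (Y.erase x) i j :=
        ⟨Finset.mem_erase.2 ⟨hxz j, hzY j⟩, Or.inr (hzc j)⟩
      have hp' : p ∈ kempe col (Y.erase x) i j :=
        ⟨Finset.mem_erase.2 ⟨hpx, hp.1.1⟩, hp.1.2⟩
      have hq' : q ∈ kempe col (Y.erase x) i j :=
        ⟨Finset.mem_erase.2 ⟨(key q hpq).2, hq.1.1⟩, hq.1.2⟩
      exact .head ⟨hzi, hp', hzp⟩ ((key q hpq).1.tail ⟨hq', hzj, hqz⟩)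
  by_cases hall : ∀ i j, i ≠ j → Adj (z i) (z j)
  · classical
    obtain ⟨M, hM⟩ : ∃ M : W → Option (Fin 3), ∀ x i, M x = some i ↔ x = z i := by
      refine ⟨fun x => if h : ∃ k, z k = x then some h.choose else none, fun x i => ?_⟩
      by_cases h : ∃ k, z k = x
      · simp only [dif_pos h, Option.some.injEq]
        refine ⟨fun h1 => by rw [← h1, h.choose_spec], fun h1 => hzinj _ _ ?_⟩
        rw [h.choose_spec, h1]
      · simp only [dif_neg h, reduceCtorEq, false_iff]
        exact fun h1 => h ⟨i, h1.symm⟩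
    refine ⟨M, fun _ => 0, fun i => (hM _ _).2 rfl, fun _ => rfl, fun x i hx => ?_,
      fun x i hx => ?_, fun i j hij => ⟨z i, z j, (hM _ _).2 rfl, (hM _ _).2 rfl, hall i j hij, ?_⟩⟩
    · rw [(hM x i).1 hx]; exact hzY i
    · rw [(hM x i).1 hx]
    · rw [colDiff, hzc, hzc, if_neg hij]; decide
  -- Adjacent roots exclude further vertices of their two colours, while a non-adjacent pair
  -- provides further vertices of both of its colours. Any two pairs of three colours intersect.
  have hnone : ∀ i j, i ≠ j → ¬ Adj (z i) (z j) := by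
    push Not at hall
    obtain ⟨i, j, hij, hnadj⟩ := hall
    obtain ⟨p, hpY, hpz, -, hpj, ⟨q, hqY, hqz, hqi⟩, -⟩ := hindirect i j hij hnadj
    intro i' j' hij' hadj
    have h1 := hdirect i' j' hij' hadj
    have h2 := hdirect j' i' hij'.symm (hs _ _ hadj)
    have a1 := h1 p hpY hpz
    have a2 := h2 p hpY hpz
    have b1 := h1 q hqY hqz
    have b2 := h2 q hqY hqz
    rw [hpj] at a1 a2
    rw [hqi] at b1 b2
    omega
  have hp := fun i j hij => hindirect i j hij (hnone i j hij)
  have hne : ∀ i : Fin 3, i ≠ i + 1 := by decide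
  -- Drop the old roots and take as new ones the neighbours `a i` of `z i` on the chain towards `z
  -- (i + 1)`. Since `a i` has colour `i + 1`, the root of colour `i` is `a (i + 2)`.
  choose a haY haz hza hac _ hconn using fun i => hp i (i + 1) (hne i)
  set Y' := Y.filter (fun x => ∀ k, z k ≠ x) with hY'
  have hY'mem : ∀ x, x ∈ Y' ↔ x ∈ Y ∧ ∀ k, z k ≠ x := fun x => by simp [hY']
  have hkempe : ∀ i j, kempe col Y i j \ {z i, z j} = kempe col Y' i j := by
    intro i j
    ext x
    constructor
    · rintro ⟨h1, h2⟩
      simp only [Set.mem_insert_iff, Set.mem_singleton_iff, not_or] at h2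
      exact ⟨(hY'mem x).2 ⟨h1.1, hroots i j x h1 h2.1 h2.2⟩, h1.2⟩
    · rintro ⟨h1, h2⟩
      rw [hY'mem] at h1
      refine ⟨⟨h1.1, h2⟩, ?_⟩
      simp only [Set.mem_insert_iff, Set.mem_singleton_iff, not_or]
      exact ⟨(h1.2 i).symm, (h1.2 j).symm⟩
  have hadd : ∀ i : Fin 3, i + 2 + 1 = i := by decide
  have hadd' : ∀ i : Fin 3, i + 1 + 2 = i := by decide
  obtain ⟨M, t, H⟩ := ih Y'.card (by
      rw [← hn]
      exact Finset.card_lt_card ⟨Finset.filter_subset _ _, fun h =>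
        ((hY'mem _).1 (h (hzY 0))).2 0 rfl⟩) Adj hs Y' (fun i => a (i + 2))
    (fun i => (hY'mem _).2 ⟨haY _, haz _⟩) (fun i => by simp only [hac, hadd]) (by
      intro i j hij
      obtain ⟨p, -, -, -, -, -, hpc⟩ := hp i j hij
      rw [hkempe] at hpc
      refine (link_rtg_symm hs (hpc _ ?_)).trans (hpc _ ?_)
      · exact ⟨(hY'mem _).2 ⟨haY _, haz _⟩, Or.inl (by rw [hac, hadd])⟩
      · exact ⟨(hY'mem _).2 ⟨haY _, haz _⟩, Or.inr (by rw [hac, hadd])⟩) rfl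
  classical
  set M' : W → Option (Fin 3) := fun x => if h : ∃ k, z k = x then some h.choose
    else (M x).map (fun i => i + 2) with hM'
  -- Each old root `z i` is attached to the branch set of `a i`, so indices shift back by one, that
  -- is by two modulo 3. Adding 1 to the switching off the old roots makes the odd edges `z i`–`a i`
  -- even and changes no other sign that is used.
  set t' : W → ZMod 2 := fun x => if ∃ k, z k = x then 0 else t x + 1 with ht'
  have hMz : ∀ k, M' (z k) = some k := fun k => by
    have hk : ∃ k', z k' = z k := ⟨k, rfl⟩
    rw [hM']
    simp only [dif_pos hk]
    rw [hzinj _ _ hk.choose_spec]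
  have htz : ∀ k, t' (z k) = 0 := fun k => by
    rw [ht']; exact if_pos ⟨k, rfl⟩
  have hMn : ∀ x i, M x = some i → ∀ k, z k ≠ x := fun x i hx => ((hY'mem x).1 (H.sub x i hx)).2
  have hMx : ∀ x i, M x = some (i + 1) → M' x = some i := fun x i hx => by
    have h1 : ¬ ∃ k, z k = x := fun ⟨k, hk⟩ => hMn x _ hx k hk
    rw [hM']
    simp only [dif_neg h1, hx, Option.map_some, hadd']
  have htx : ∀ x i, M x = some i → t' x = t x + 1 := fun x i hx => by
    rw [ht']; exact if_neg fun ⟨k, hk⟩ => hMn x _ hx k hk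
  have hMinv : ∀ x i, M' x = some i → x = z i ∨ M x = some (i + 1) := by
    intro x i hx
    by_cases h1 : ∃ k, z k = x
    · obtain ⟨k, rfl⟩ := h1
      rw [hMz] at hx
      left
      rw [Option.some.inj hx]
    · right
      rw [hM'] at hx
      simp only [dif_neg h1, Option.map_eq_some_iff] at hx
      obtain ⟨k, hk, rfl⟩ := hx
      rw [hk, hadd]
  have e1 : ∀ x y c : ZMod 2, x + y = c → x + 1 + (y + 1) = c := by decide
  refine ⟨M', t', hMz, htz, fun x i hx => ?_, fun x i hx => ?_, fun i j hij => ?_⟩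
  · rcases hMinv x i hx with rfl | h1
    · exact hzY i
    · exact ((hY'mem x).1 (H.sub x _ h1)).1
  · rcases hMinv x i hx with rfl | h1
    · exact .refl
    · have h2 := H.conn x _ h1
      have hai := hadd' i
      simp only [hai] at h2
      have hMa : M (a i) = some (i + 1) := by
        have := H.root (i + 1)
        simpa only [hai] using this
      have hta : t (a i) = 0 := by
        have := H.troot (i + 1)
        simpa only [hai] using this
      refine .head ⟨hMz i, hMx _ _ hMa, hza i, ?_⟩ (Relation.ReflTransGen.mono ?_ _ _ h2)
      · rw [htz, htx _ _ hMa, hta, colDiff, hzc, hac, if_neg (hne i)]; decide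
      · rintro p q ⟨hp, hq, hadj, htt⟩
        exact ⟨hMx _ _ hp, hMx _ _ hq, hadj, by rw [htx _ _ hp, htx _ _ hq, e1 _ _ _ htt]⟩
  · obtain ⟨p, q, hp, hq, hadj, htt⟩ := H.odd (i + 1) (j + 1) (fun h => hij (add_right_cancel h))
    exact ⟨p, q, hMx _ _ hp, hMx _ _ hq, hadj, by rw [htx _ _ hp, htx _ _ hq, e1 _ _ _ htt]⟩

end Triangle

end OddPacking

namespace OddPacking

/-! ### Signed graphs -/

/-- A graph with a sign for every edge; `1` stands for odd. -/
structure SignedGraph (V E : Type*) where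
  src : E → V
  tgt : E → V
  sg : E → ZMod 2

namespace SignedGraph

variable {V E : Type*} (Γ : SignedGraph V E)

/-- The sign of `f` after switching by `U`. -/
def hit (U : V → ZMod 2) (f : E) : ZMod 2 := Γ.sg f + U (Γ.src f) + U (Γ.tgt f)

/-- An element of the cycle space with an odd number of odd edges. -/
def OddCycle (C : Finset E) : Prop := ∀ U : V → ZMod 2, ∑ f ∈ C, Γ.hit U f = 1

/-- The edges of `F` that are odd after switching by `U`. -/
def hits (F : Finset E) (U : V → ZMod 2) : Finset E := F.filter (fun f => Γ.hit U f = 1)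

/-- `F` contains `k` pairwise disjoint odd cycles. -/
def Packs (F : Finset E) (k : ℕ) : Prop :=
  ∃ C : Fin k → Finset E, (∀ i, C i ⊆ F) ∧ (∀ i, Γ.OddCycle (C i)) ∧
    ∀ i j, i ≠ j → Disjoint (C i) (C j)

/-- `p` and `q` are the ends of `f`. -/
def Joins (f : E) (p q : V) : Prop :=
  (Γ.src f = p ∧ Γ.tgt f = q) ∨ (Γ.src f = q ∧ Γ.tgt f = p)

/-- Adjacency inside `N` by an edge that is even after switching by `s`. -/
def EvenAdj (s : V → ZMod 2) (N : Set V) (p q : V) : Prop :=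
  p ∈ N ∧ q ∈ N ∧ ∃ f, Γ.hit s f = 0 ∧ Γ.Joins f p q

/-- A model of `K₅` as an odd minor, with branch sets `N i`. -/
structure IsOddModel {ι : Type*} (s : V → ZMod 2) (N : ι → Set V) : Prop where
  disj : ∀ i j, i ≠ j → Disjoint (N i) (N j)
  conn : ∀ i, ∃ r ∈ N i, ∀ x ∈ N i, Relation.ReflTransGen (Γ.EvenAdj s (N i)) r x
  odd : ∀ i j, i ≠ j → ∃ f, Γ.hit s f = 1 ∧ ∃ p ∈ N i, ∃ q ∈ N j, Γ.Joins f p q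

/-- `K₅` is an odd minor. -/
def HasOddK5 : Prop := ∃ (s : V → ZMod 2) (N : Fin 5 → Set V), Γ.IsOddModel s N

variable {Γ}

lemma Joins.symm {f : E} {p q : V} (h : Γ.Joins f p q) : Γ.Joins f q p := Or.symm h

lemma Joins.hit {f : E} {p q : V} (h : Γ.Joins f p q) (U : V → ZMod 2) :
    Γ.hit U f = Γ.sg f + U p + U q := by
  rcases h with ⟨rfl, rfl⟩ | ⟨rfl, rfl⟩
  · rfl
  · unfold SignedGraph.hit; ring

lemma IsOddModel.hasOddK5 {ι : Type*} [Fintype ι] (hι : Fintype.card ι = 5) {s : V → ZMod 2}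
    {N : ι → Set V} (h : Γ.IsOddModel s N) : Γ.HasOddK5 := by
  have φ := (Fintype.equivFinOfCardEq hι).symm
  exact ⟨s, N ∘ φ, fun i j hij => h.disj _ _ (φ.injective.ne hij), fun i => h.conn _,
    fun i j hij => h.odd _ _ (φ.injective.ne hij)⟩

lemma zmod_two_ne {x : ZMod 2} : x ≠ 1 ↔ x = 0 := by revert x; decide

lemma hit_add_const (U : V → ZMod 2) (c : ZMod 2) (f : E) :
    Γ.hit (fun x => U x + c) f = Γ.hit U f := by
  have e1 : ∀ a b d c : ZMod 2, a + (b + c) + (d + c) = a + b + d := by decide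
  exact e1 _ _ _ _

lemma sum_hit_eq_card (F : Finset E) (U : V → ZMod 2) :
    ∑ f ∈ F, Γ.hit U f = ((Γ.hits F U).card : ZMod 2) := by
  rw [hits, Finset.natCast_card_filter]
  refine Finset.sum_congr rfl fun f _ => ?_
  generalize Γ.hit U f = x
  revert x; decide

lemma OddCycle.hits_nonempty {C : Finset E} (h : Γ.OddCycle C) (U : V → ZMod 2) :
    0 < (Γ.hits C U).card := by
  have h1 := h U
  rw [sum_hit_eq_card] at h1
  by_contra h2
  rw [show (Γ.hits C U).card = 0 by omega] at h1
  exact absurd h1 (by decide)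

lemma OddCycle.hits_odd {C : Finset E} (h : Γ.OddCycle C) (U : V → ZMod 2) :
    Odd (Γ.hits C U).card := by
  have h1 := h U
  rw [sum_hit_eq_card] at h1
  exact (ZMod.natCast_eq_one_iff_odd).1 h1

lemma mem_hits {F : Finset E} {U : V → ZMod 2} {f : E} :
    f ∈ Γ.hits F U ↔ f ∈ F ∧ Γ.hit U f = 1 := Finset.mem_filter

/-! #### Directed edges -/

variable (Γ) in
/-- The tail of a directed edge. -/
def tl (a : E × Bool) : V := if a.2 then Γ.tgt a.1 else Γ.src a.1

variable (Γ) in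
/-- The head of a directed edge. -/
def hd (a : E × Bool) : V := if a.2 then Γ.src a.1 else Γ.tgt a.1

lemma joins_tl_hd (a : E × Bool) : Γ.Joins a.1 (Γ.tl a) (Γ.hd a) := by
  obtain ⟨f, b⟩ := a
  cases b
  · exact Or.inl ⟨rfl, rfl⟩
  · exact Or.inr ⟨rfl, rfl⟩

variable (Γ) in
/-- The boundary of `J` is `u + v`. -/
def IsJoin (u v : V) (J : Finset E) : Prop :=
  ∀ U : V → ZMod 2, ∑ f ∈ J, (U (Γ.src f) + U (Γ.tgt f)) = U u + U v

lemma IsJoin.sum_hit {u v : V} {J : Finset E} (h : Γ.IsJoin u v J) (U : V → ZMod 2) :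
    ∑ f ∈ J, Γ.hit U f = ∑ f ∈ J, Γ.sg f + (U u + U v) := by
  rw [← h U, ← Finset.sum_add_distrib]
  exact Finset.sum_congr rfl fun f _ => by rw [hit, add_assoc]

variable [DecidableEq E]

/-- The boundaries of `J` and `e` cancel, so the number of hits modulo 2 does not depend on the
switching; one switching decides. -/
lemma IsJoin.oddCycle {J : Finset E} {e : E} (h : Γ.IsJoin (Γ.src e) (Γ.tgt e) J) (he : e ∉ J)
    {U : V → ZMod 2} (hU : ∑ f ∈ insert e J, Γ.hit U f = 1) : Γ.OddCycle (insert e J) := by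
  intro U'
  rw [Finset.sum_insert he, h.sum_hit] at hU ⊢
  rw [hit] at hU ⊢
  rw [← hU]
  have e1 : ∀ s a b a' b' x : ZMod 2, s + a + b + (x + (a + b)) = s + a' + b' + (x + (a' + b')) := by
    decide
  exact e1 _ _ _ _ _ _

/-- Each edge occurs in both directions as a directed edge. Traversing the reverse of `a` later
would bring the path back to the tail of `a`. -/
lemma _root_.OddPacking.IsDipath.fst_notMem {v : V} {a : E × Bool} {Q : Finset (E × Bool)}
    (h : IsDipath Γ.tl Γ.hd v (Γ.hd a) Q) (ha : Γ.tl a ≠ v) (hQ : ∀ b ∈ Q, Γ.tl b ≠ Γ.tl a) :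
    a.1 ∉ Q.image Prod.fst := by
  intro h1
  obtain ⟨b, hb, hba⟩ := Finset.mem_image.1 h1
  by_cases hab : b = a
  · exact hQ b hb (by rw [hab])
  · have hab2 : b.2 = !a.2 := by
      by_contra h2
      exact hab (Prod.ext hba (by simpa using h2))
    have h3 : Γ.hd b = Γ.tl a := by
      simp only [hd, tl, hba, hab2]
      cases a.2 <;> rfl
    rcases h.hd_mem hb with h4 | ⟨c, hc, h4⟩
    · exact ha (h3 ▸ h4)
    · exact hQ c hc (h4.trans h3)

lemma _root_.OddPacking.IsDipath.injOn_fst {u v : V} {Q : Finset (E × Bool)}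
    (h : IsDipath Γ.tl Γ.hd v u Q) : Set.InjOn Prod.fst (Q : Set (E × Bool)) := by
  induction h with
  | nil => simp
  | cons a Q h ha hQ ih =>
    have haQ := h.fst_notMem ha hQ
    rw [Finset.coe_insert, Set.injOn_insert]
    · refine ⟨ih, fun h1 => haQ ?_⟩
      simpa using h1
    · exact fun h1 => haQ (Finset.mem_image_of_mem _ h1)

lemma _root_.OddPacking.IsDipath.isJoin {u v : V} {Q : Finset (E × Bool)}
    (h : IsDipath Γ.tl Γ.hd v u Q) : Γ.IsJoin u v (Q.image Prod.fst) := by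
  induction h with
  | nil =>
    intro U
    have e1 : ∀ a : ZMod 2, 0 = a + a := by decide
    simpa using e1 _
  | cons a Q h ha hQ ih =>
    intro U
    have haQ := h.fst_notMem ha hQ
    rw [Finset.image_insert, Finset.sum_insert haQ, ih U]
    have e1 : ∀ a b c : ZMod 2, a + b + (b + c) = a + c := by decide
    rcases joins_tl_hd (Γ := Γ) a with ⟨h1, h2⟩ | ⟨h1, h2⟩
    · rw [h1, h2, e1]
    · rw [h1, h2, add_comm (U (Γ.hd a)), e1]

/-! #### Tight switchings -/

variable (Γ) in
/-- An edge `e`, three directed paths with union `T` joining its ends, and further odd cycles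
`C j`, all disjoint and contained in `F`. -/
structure Config (F : Finset E) (e : E) (T : Finset (E × Bool)) {n : ℕ} (C : Fin n → Finset E) :
    Prop where
  eF : e ∈ F
  TF : T.image Prod.fst ⊆ F
  eT : e ∉ T.image Prod.fst
  inj : Set.InjOn Prod.fst (T : Set (E × Bool))
  CF : ∀ j, C j ⊆ F
  eC : ∀ j, e ∉ C j
  CT : ∀ j, Disjoint (C j) (T.image Prod.fst)
  CC : ∀ i j, i ≠ j → Disjoint (C i) (C j)
  odd : ∀ j, Γ.OddCycle (C j)

variable (Γ) in
/-- A switching that hits `e`, each `C j` once and nothing else outside `D`. -/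
structure Tight (F : Finset E) (e : E) (D : Finset E) {n : ℕ} (C : Fin n → Finset E)
    (U : V → ZMod 2) : Prop where
  he : Γ.hit U e = 1
  out : ∀ f ∈ F, f ∉ D → f ≠ e → (∀ j, f ∉ C j) → Γ.hit U f = 0
  one : ∀ j, (Γ.hits (C j) U).card = 1

variable (Γ) in
/-- Some tight switching hits no edge of `D \ X`. -/
def Good (F : Finset E) (e : E) (D : Finset E) {n : ℕ} (C : Fin n → Finset E) (X : Finset E) :
    Prop :=
  ∃ U, Γ.Tight F e D C U ∧ ∀ f ∈ D, Γ.hit U f = 1 → f ∈ X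

lemma Good.mono {F : Finset E} {e : E} {D : Finset E} {n : ℕ} {C : Fin n → Finset E}
    {X X' : Finset E} (h : X ⊆ X') (hg : Γ.Good F e D C X) : Γ.Good F e D C X' := by
  obtain ⟨U, h1, h2⟩ := hg
  exact ⟨U, h1, fun f hf hh => h (h2 f hf hh)⟩

lemma Good.normalize {F : Finset E} {e : E} {D : Finset E} {n : ℕ} {C : Fin n → Finset E}
    {X : Finset E} (hg : Γ.Good F e D C X) (u : V) :
    ∃ U, Γ.Tight F e D C U ∧ (∀ f ∈ D, Γ.hit U f = 1 → f ∈ X) ∧ U u = 0 := by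
  obtain ⟨U, h1, h2⟩ := hg
  have h3 : Γ.hit (fun x => U x + U u) = Γ.hit U := funext fun f => hit_add_const U (U u) f
  refine ⟨fun x => U x + U u, ⟨by rw [h3, h1.he], fun f hf hfD hfe hfC => ?_, fun j => ?_⟩,
    fun f hf hh => h2 f hf (by rwa [h3] at hh), ?_⟩
  · rw [h3]; exact h1.out f hf hfD hfe hfC
  · have := h1.one j
    rwa [hits, ← h3] at this
  · have e1 : ∀ a : ZMod 2, a + a = 0 := by decide
    exact e1 _

namespace Config

variable {F : Finset E} {e : E} {T : Finset (E × Bool)} {n : ℕ} {C : Fin n → Finset E}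

lemma card_hits_biUnion (H : Γ.Config F e T C) (U : V → ZMod 2) :
    (Γ.hits (Finset.univ.biUnion C) U).card = ∑ j, (Γ.hits (C j) U).card := by
  rw [hits, Finset.filter_biUnion, Finset.card_biUnion]
  · rfl
  · exact fun i _ j _ hij => Finset.disjoint_filter_filter (H.CC i j hij)

/-- A switching with few hits outside `J + e` is tight. -/
lemma tight_of_card_le (H : Γ.Config F e T C) {J K : Finset E}
    (hJ : J ⊆ T.image Prod.fst) (hK : K ⊆ T.image Prod.fst)
    (hJK : Disjoint K J) (hKo : Γ.OddCycle (insert e K)) {U : V → ZMod 2}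
    (hU : (Γ.hits (F \ insert e J) U).card ≤ n) :
    Γ.Tight F e (T.image Prod.fst) C U ∧ ∀ f ∈ T.image Prod.fst, Γ.hit U f = 1 → f ∈ J := by
  have hsub : Γ.hits (Finset.univ.biUnion C) U ⊆ Γ.hits (F \ insert e J) U := by
    refine Finset.filter_subset_filter _ fun f hf => ?_
    obtain ⟨j, -, hj⟩ := Finset.mem_biUnion.1 hf
    simp only [Finset.mem_sdiff, Finset.mem_insert, not_or]
    exact ⟨H.CF j hj, fun h => H.eC j (h ▸ hj), fun h =>
      Finset.disjoint_left.1 (H.CT j) hj (hJ h)⟩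
  -- The at most `n` hits outside `J` and `e` are used up by the `n` disjoint odd cycles, one in
  -- each.
  have hge : ∀ j ∈ (Finset.univ : Finset (Fin n)), 1 ≤ (Γ.hits (C j) U).card :=
    fun j _ => (H.odd j).hits_nonempty U
  have hsum : ∑ j, (Γ.hits (C j) U).card ≤ ∑ j : Fin n, 1 := by
    rw [← H.card_hits_biUnion]
    simpa using (Finset.card_le_card hsub).trans hU
  have hone : ∀ j, (Γ.hits (C j) U).card = 1 := fun j =>
    ((Finset.sum_eq_sum_iff_of_le hge).1 (le_antisymm (Finset.sum_le_sum hge) hsum) j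
      (Finset.mem_univ j)).symm
  have heq : Γ.hits (Finset.univ.biUnion C) U = Γ.hits (F \ insert e J) U := by
    refine Finset.eq_of_subset_of_card_le hsub (hU.trans ?_)
    rw [H.card_hits_biUnion, Finset.sum_congr rfl fun j _ => hone j]
    simp
  have hzero : ∀ f ∈ F, f ∉ insert e J → (∀ j, f ∉ C j) → Γ.hit U f = 0 := by
    intro f hf hfJ hfC
    rw [← zmod_two_ne]
    intro h1
    have h2 : f ∈ Γ.hits (F \ insert e J) U := mem_hits.2 ⟨Finset.mem_sdiff.2 ⟨hf, hfJ⟩, h1⟩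
    rw [← heq] at h2
    obtain ⟨j, -, hj⟩ := Finset.mem_biUnion.1 (mem_hits.1 h2).1
    exact hfC j hj
  have hTC : ∀ f ∈ T.image Prod.fst, ∀ j, f ∉ C j := fun f hf j hj =>
    Finset.disjoint_left.1 (H.CT j) hj hf
  have hne : ∀ f ∈ T.image Prod.fst, f ≠ e := fun f hf h => H.eT (h ▸ hf)
  refine ⟨⟨?_, fun f hf hfD hfe hfC => hzero f hf ?_ hfC, hone⟩, fun f hf h1 => ?_⟩
  -- No edge of `K` is hit, so the odd cycle formed by `e` and `K` must be hit at `e`.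
  · have h1 := hKo U
    rw [Finset.sum_insert fun h => H.eT (hK h), Finset.sum_eq_zero, add_zero] at h1
    · exact h1
    · intro f hf
      refine hzero f (H.TF (hK hf)) ?_ (hTC f (hK hf))
      rw [Finset.mem_insert, not_or]
      exact ⟨hne f (hK hf), Finset.disjoint_left.1 hJK hf⟩
  · rw [Finset.mem_insert, not_or]
    exact ⟨hfe, fun h => hfD (hJ h)⟩
  · by_contra h2
    have h3 := hzero f (H.TF hf) (by rw [Finset.mem_insert, not_or]; exact ⟨hne f hf, h2⟩)
      (hTC f hf)
    rw [h3] at h1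
    exact absurd h1 (by decide)

/-- A tight switching without hits on the paths has only `n + 1` hits: `e` and one in each further
cycle. -/
lemma not_good_empty (H : Γ.Config F e T C) (hcost : ∀ U, n + 3 ≤ (Γ.hits F U).card) :
    ¬ Γ.Good F e (T.image Prod.fst) C ∅ := by
  rintro ⟨U, hU, hD⟩
  have hsub : Γ.hits F U ⊆ insert e (Γ.hits (Finset.univ.biUnion C) U) := by
    intro f hf
    obtain ⟨hfF, hf1⟩ := mem_hits.1 hf
    by_contra hcon
    rw [Finset.mem_insert, not_or, mem_hits, not_and] at hcon
    have h1 : ∀ j, f ∉ C j := fun j hj =>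
      hcon.2 (Finset.mem_biUnion.2 ⟨j, Finset.mem_univ j, hj⟩) hf1
    have h2 := hU.out f hfF (fun h => by simpa using hD f h hf1) hcon.1 h1
    rw [hf1] at h2
    exact absurd h2 (by decide)
  have h1 := (Finset.card_le_card hsub).trans (Finset.card_insert_le _ _)
  rw [H.card_hits_biUnion, Finset.sum_congr rfl fun j _ => hU.one j] at h1
  have h2 := hcost U
  simp at h1
  omega

end Config

end SignedGraph

end OddPacking

/-! ### Mates of the three paths, and the tripod they produce -/

namespace OddPacking

lemma IsDipath.const {V A M : Type*} {tl hd : A → V} [DecidableEq A] {u v : V} {Q : Finset A}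
    (h : IsDipath tl hd v u Q) {w : V → M} (hw : ∀ a ∈ Q, w (tl a) = w (hd a)) :
    w u = w v ∧ ∀ a ∈ Q, w (tl a) = w v := by
  induction h with
  | nil => exact ⟨rfl, by simp⟩
  | cons a Q h ha hQ ih =>
    obtain ⟨h1, h2⟩ := ih fun b hb => hw b (Finset.mem_insert_of_mem hb)
    have h3 : w (tl a) = w v := (hw a (Finset.mem_insert_self _ _)).trans h1
    refine ⟨h3, fun b hb => ?_⟩
    rcases Finset.mem_insert.1 hb with rfl | hb
    · exact h3
    · exact h2 b hb

namespace SignedGraph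

variable {V E : Type*} {Γ : SignedGraph V E} [DecidableEq E]

namespace Config

variable {F : Finset E} {e : E} {T : Finset (E × Bool)} {n : ℕ} {C : Fin n → Finset E}

/-- Every path in `T` between the ends of `e` forms an odd cycle with `e`. -/
lemma oddCycle_of_isJoin (H : Γ.Config F e T C) {P : Fin 3 → Finset (E × Bool)}
    (hT : T = Finset.univ.biUnion P) (hP : ∀ i, IsDipath Γ.tl Γ.hd (Γ.tgt e) (Γ.src e) (P i))
    (hdisj : ∀ i j, i ≠ j → Disjoint ((P i).image Prod.fst) ((P j).image Prod.fst))
    (hodd : ∀ i, Γ.OddCycle (insert e ((P i).image Prod.fst)))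
    (hmate : ∀ J ⊆ F, e ∈ J → Γ.OddCycle J → ∃ U, (Γ.hits (F \ J) U).card ≤ n)
    {J : Finset E} (hJ : J ⊆ T.image Prod.fst) (hJj : Γ.IsJoin (Γ.src e) (Γ.tgt e) J) :
    Γ.OddCycle (insert e J) := by
  have hPT : ∀ i, (P i).image Prod.fst ⊆ T.image Prod.fst := fun i => by
    rw [hT]
    exact Finset.image_subset_image (Finset.subset_biUnion_of_mem P (Finset.mem_univ i))
  -- The mate of each path; another of the three paths serves as witness that the mate hits `e`.
  have hex : ∀ i, ∃ U, Γ.Tight F e (T.image Prod.fst) C U ∧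
      (∀ f ∈ T.image Prod.fst, Γ.hit U f = 1 → f ∈ (P i).image Prod.fst) ∧ U (Γ.src e) = 0 := by
    intro i
    obtain ⟨U, hU⟩ := hmate (insert e ((P i).image Prod.fst))
      (Finset.insert_subset H.eF ((hPT i).trans H.TF)) (Finset.mem_insert_self _ _) (hodd i)
    have hi : ∀ i : Fin 3, i + 1 ≠ i := by decide
    exact Good.normalize ⟨U, H.tight_of_card_le (hPT i) (hPT (i + 1)) (hdisj _ _ (hi i))
      (hodd (i + 1)) hU⟩ _
  choose U hUt hUP hU0 using hex
  have hzero : ∀ i j, j ≠ i → ∀ f ∈ (P i).image Prod.fst, Γ.hit (U j) f = 0 := by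
    intro i j hij f hf
    rw [← zmod_two_ne]
    intro h1
    exact Finset.disjoint_left.1 (hdisj i j hij.symm) hf (hUP j f (hPT i hf) h1)
  have hv : ∀ i j, U i (Γ.tgt e) = U j (Γ.tgt e) := by
    intro i j
    have h1 := (hUt i).he
    have h2 := (hUt j).he
    rw [hit, hU0] at h1 h2
    rw [add_zero] at h1 h2
    exact add_left_cancel (h1.trans h2.symm)
  have hconst : ∀ i j k, j ≠ i → k ≠ i → ∀ a ∈ P i, U j (Γ.tl a) = U k (Γ.tl a) := by
    intro i j k hj hk a ha
    have h1 := ((hP i).const (w := fun x => U j x + U k x) fun b hb => by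
      have hb' := Finset.mem_image_of_mem Prod.fst hb
      have h1 := hzero i j hj _ hb'
      have h2 := hzero i k hk _ hb'
      rw [(joins_tl_hd b).hit] at h1 h2
      generalize Γ.sg b.1 = s at h1 h2
      revert h1 h2
      generalize U j (Γ.tl b) = x1
      generalize U j (Γ.hd b) = x2
      generalize U k (Γ.tl b) = x3
      generalize U k (Γ.hd b) = x4
      revert s x1 x2 x3 x4
      decide).2 a ha
    simp only [hv j k] at h1
    revert h1
    generalize U j (Γ.tl a) = x1
    generalize U k (Γ.tl a) = x2
    generalize U k (Γ.tgt e) = x3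
    revert x1 x2 x3
    decide
  -- `W` is the majority of the three mates. Along a path the other two mates agree and hit nothing,
  -- so `W` follows them: it hits no edge of `T`, but it hits `e`.
  set W : V → ZMod 2 := fun x => U 0 x + U 1 x + U 2 x +
    (1 + (1 + U 0 x + U 1 x) * (1 + U 1 x + U 2 x)) with hW
  have hWe : Γ.hit W e = 1 := by
    have h0 := (hUt 0).he
    simp only [hit, hW, hU0, hv 1 0, hv 2 0] at h0 ⊢
    generalize Γ.sg e = s at h0 ⊢
    generalize U 0 (Γ.tgt e) = x at h0 ⊢
    revert s x
    decide
  have key0 : ∀ s x y y' z z' : ZMod 2, s + y + y' = 0 → s + z + z' = 0 → y = z → ∀ x',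
      s + (x + y + z + (1 + (1 + x + y) * (1 + y + z))) +
      (x' + y' + z' + (1 + (1 + x' + y') * (1 + y' + z'))) = 0 := by decide
  have key1 : ∀ s x y y' z z' : ZMod 2, s + y + y' = 0 → s + z + z' = 0 → y = z → ∀ x',
      s + (y + x + z + (1 + (1 + y + x) * (1 + x + z))) +
      (y' + x' + z' + (1 + (1 + y' + x') * (1 + x' + z'))) = 0 := by decide
  have key2 : ∀ s x y y' z z' : ZMod 2, s + y + y' = 0 → s + z + z' = 0 → y = z → ∀ x',
      s + (y + z + x + (1 + (1 + y + z) * (1 + z + x))) +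
      (y' + z' + x' + (1 + (1 + y' + z') * (1 + z' + x'))) = 0 := by decide
  have hWD : ∀ f ∈ T.image Prod.fst, Γ.hit W f = 0 := by
    intro f hf
    obtain ⟨a, haT, rfl⟩ := Finset.mem_image.1 hf
    rw [hT] at haT
    obtain ⟨i, -, ha⟩ := Finset.mem_biUnion.1 haT
    have ha' := Finset.mem_image_of_mem Prod.fst ha
    have h1 := fun j hj => hzero i j hj _ ha'
    simp only [(joins_tl_hd a).hit] at h1 ⊢
    have h2 := fun j k hj hk => hconst i j k hj hk a ha
    fin_cases i
    · exact key0 _ _ _ _ _ _ (h1 1 (by decide)) (h1 2 (by decide))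
        (h2 1 2 (by decide) (by decide)) _
    · exact key1 _ _ _ _ _ _ (h1 0 (by decide)) (h1 2 (by decide))
        (h2 0 2 (by decide) (by decide)) _
    · exact key2 _ _ _ _ _ _ (h1 0 (by decide)) (h1 1 (by decide))
        (h2 0 1 (by decide) (by decide)) _
  refine hJj.oddCycle (fun h => H.eT (hJ h)) (U := W) ?_
  rw [Finset.sum_insert fun h => H.eT (hJ h), hWe,
    Finset.sum_eq_zero fun f hf => hWD f (hJ hf), add_zero]

variable [Fintype V] [DecidableEq V]

/-- The flow starts with `N` the single vertex `Γ.src e`. The edge set of a walk to `Γ.tgt e` is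
good because it contains a path whose mate is tight: removing that path leaves a flow of value two,
hence a disjoint path to witness the hit at `e`. -/
lemma exists_tripod (H : Γ.Config F e T C) {P : Fin 3 → Finset (E × Bool)}
    (hT : T = Finset.univ.biUnion P) (hP : ∀ i, IsDipath Γ.tl Γ.hd (Γ.tgt e) (Γ.src e) (P i))
    (hne : Γ.src e ≠ Γ.tgt e)
    (hdisj : ∀ i j, i ≠ j → Disjoint ((P i).image Prod.fst) ((P j).image Prod.fst))
    (hodd : ∀ i, Γ.OddCycle (insert e ((P i).image Prod.fst)))
    (hmate : ∀ J ⊆ F, e ∈ J → Γ.OddCycle J → ∃ U, (Γ.hits (F \ J) U).card ≤ n)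
    (hcost : ∀ U, n + 3 ≤ (Γ.hits F U).card) :
    ∃ Nu Nv Z L S I, Tripod Γ.tl Γ.hd
      (fun X => Γ.Good F e (T.image Prod.fst) C (X.image Prod.fst)) T (Γ.src e) (Γ.tgt e)
      Nu Nv Z L S I := by
  have hout : ∀ (f : E × Bool → V) x, outdeg f T x =
      outdeg f (P 0) x + outdeg f (P 1) x + outdeg f (P 2) x := by
    intro f x
    rw [← Fin.sum_univ_three (fun i => outdeg f (P i) x), hT, outdeg, Finset.filter_biUnion,
      Finset.card_biUnion]
    · rfl
    · refine fun i _ j _ hij => Finset.disjoint_filter_filter (Finset.disjoint_left.2 ?_)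
      exact fun a hi hj => Finset.disjoint_left.1 (hdisj i j hij)
        (Finset.mem_image_of_mem _ hi) (Finset.mem_image_of_mem _ hj)
  have hflow : ∀ x, outdeg Γ.tl T x + (if x = Γ.tgt e then 3 else 0) =
      outdeg Γ.hd T x + if x = Γ.src e then 3 else 0 := by
    intro x
    have h0 := (hP 0).div x
    have h1 := (hP 1).div x
    have h2 := (hP 2).div x
    rw [hout, hout]
    split_ifs at * <;> omega
  refine FlowState.exists_tripod (N := {Γ.src e}) (L := ∅) (Z := ∅) (T := T)
    (fun X Y hXY => Good.mono (Finset.image_subset_image hXY)) ?_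
  refine ⟨rfl, ?_, ?_, Finset.disjoint_empty_left _, Finset.disjoint_empty_left _,
    Finset.disjoint_empty_left _, Finset.empty_subset _, Finset.empty_subset _, subset_rfl, ?_, ?_,
    ?_⟩
  · exact fun h => hne h.symm
  · rintro x rfl; exact .refl
  · intro x hx
    have := hflow x
    rw [if_neg (show x ≠ Γ.src e from hx)] at this
    exact this
  · rintro X hX p rfl hr
    obtain ⟨Q, hQX, hQ⟩ := exists_isDipath hr
    have hQT := hQX.trans hX
    have hr2 : Reach Γ.tl Γ.hd (T \ Q) (Γ.src e) (Γ.tgt e) := by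
      refine reach_of_flow (m := 2) (by norm_num) fun x => ?_
      have h1 := hflow x
      have h2 := hQ.div x
      have h3 := outdeg_sdiff (f := Γ.tl) hQT x
      have h4 := outdeg_sdiff (f := Γ.hd) hQT x
      split_ifs at * <;> omega
    obtain ⟨K, hK, hKp⟩ := exists_isDipath hr2
    have hKT := hK.trans Finset.sdiff_subset
    have hJ : Q.image Prod.fst ⊆ T.image Prod.fst := Finset.image_subset_image hQT
    obtain ⟨U, hU⟩ := hmate (insert e (Q.image Prod.fst))
      (Finset.insert_subset H.eF (hJ.trans H.TF)) (Finset.mem_insert_self _ _)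
      (H.oddCycle_of_isJoin hT hP hdisj hodd hmate hJ hQ.isJoin)
    refine Good.mono (X := Q.image Prod.fst) ?_ ⟨U, H.tight_of_card_le hJ
      (Finset.image_subset_image hKT) ?_ (H.oddCycle_of_isJoin hT hP hdisj hodd hmate
        (Finset.image_subset_image hKT) hKp.isJoin) hU⟩
    · exact Finset.image_subset_image (hQX.trans Finset.subset_union_right)
    · refine Finset.disjoint_left.2 fun f hf hf' => ?_
      obtain ⟨a, ha, rfl⟩ := Finset.mem_image.1 hf
      obtain ⟨b, hb, hba⟩ := Finset.mem_image.1 hf'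
      have : b = a := H.inj (hQT hb) (hKT ha) hba
      subst this
      exact (Finset.mem_sdiff.1 (hK ha)).2 hb
  · rw [Finset.image_empty]
    exact H.not_good_empty hcost

end Config

end SignedGraph

end OddPacking

/-! ### Comparing the tight switchings of the three arcs -/

namespace OddPacking

/-- The value at `i` differs from the other two. -/
def Differs (i : Fin 3) (w : Fin 3 → ZMod 2) : Prop := ∀ j, j ≠ i → w j ≠ w i

instance (i : Fin 3) (w : Fin 3 → ZMod 2) : Decidable (Differs i w) :=
  inferInstanceAs (Decidable (∀ j, j ≠ i → w j ≠ w i))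

lemma differs_cases : ∀ w : Fin 3 → ZMod 2, (∀ i j, w i = w j) ∨ ∃ i, Differs i w := by
  decide

lemma Differs.unique : ∀ {i j : Fin 3} {w : Fin 3 → ZMod 2}, Differs i w → Differs j w → i = j := by
  decide

lemma differs_of_ne : ∀ {i j : Fin 3} {w : Fin 3 → ZMod 2}, w i ≠ w j → Differs i w ∨ Differs j w := by
  decide

lemma Differs.eq : ∀ {i : Fin 3} {w : Fin 3 → ZMod 2}, Differs i w → ∀ j k, j ≠ i → k ≠ i →
    w j = w k := by
  decide

namespace SignedGraph

variable {V E : Type*} {Γ : SignedGraph V E} [DecidableEq E]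

lemma Joins.hit_add {f : E} {p q : V} (h : Γ.Joins f p q) (U U' : V → ZMod 2) :
    Γ.hit U f + Γ.hit U' f = (U p + U' p) + (U q + U' q) := by
  rw [h.hit, h.hit]
  have e1 : ∀ s a b c d : ZMod 2, s + a + b + (s + c + d) = a + c + (b + d) := by decide
  exact e1 _ _ _ _ _

variable (Γ) in
/-- A tripod together with normalized tight switchings for its three arcs. -/
structure Pot (F : Finset E) (e : E) (T : Finset (E × Bool)) {n : ℕ} (C : Fin n → Finset E)
    (Nu Nv : Set V) (Z L : Finset (E × Bool)) (S : Fin 3 → Finset (E × Bool))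
    (I : Fin 3 → Set V) (U : Fin 3 → V → ZMod 2) : Prop where
  cfg : Γ.Config F e T C
  tri : Tripod Γ.tl Γ.hd (fun X => Γ.Good F e (T.image Prod.fst) C (X.image Prod.fst)) T
    (Γ.src e) (Γ.tgt e) Nu Nv Z L S I
  tight : ∀ i, Γ.Tight F e (T.image Prod.fst) C (U i)
  sub : ∀ i, ∀ f ∈ T.image Prod.fst, Γ.hit (U i) f = 1 → f ∈ (Z ∪ S i).image Prod.fst
  zero : ∀ i, U i (Γ.src e) = 0

namespace Pot

variable {F : Finset E} {e : E} {T : Finset (E × Bool)} {n : ℕ} {C : Fin n → Finset E}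
  {Nu Nv : Set V} {Z L : Finset (E × Bool)} {S : Fin 3 → Finset (E × Bool)}
  {I : Fin 3 → Set V} {U : Fin 3 → V → ZMod 2}

lemma hit_eq_zero (H : Γ.Pot F e T C Nu Nv Z L S I U) {i : Fin 3} {a : E × Bool} (ha : a ∈ T)
    (haZ : a ∉ Z) (haS : a ∉ S i) : Γ.hit (U i) a.1 = 0 := by
  rw [← zmod_two_ne]
  intro h1
  obtain ⟨b, hb, hba⟩ := Finset.mem_image.1 (H.sub i _ (Finset.mem_image_of_mem _ ha) h1)
  have hbT : b ∈ T := (Finset.union_subset H.tri.Zsub (H.tri.Ssub i)) hb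
  have : b = a := H.cfg.inj hbT ha hba
  subst this
  rcases Finset.mem_union.1 hb with h | h
  · exact haZ h
  · exact haS h

lemma hit_L (H : Γ.Pot F e T C Nu Nv Z L S I U) (i : Fin 3) {a : E × Bool} (ha : a ∈ L) :
    Γ.hit (U i) a.1 = 0 :=
  H.hit_eq_zero (H.tri.Lsub ha) (Finset.disjoint_left.1 H.tri.LZ ha)
    (Finset.disjoint_left.1 (H.tri.LS i) ha)

lemma hit_S (H : Γ.Pot F e T C Nu Nv Z L S I U) {i j : Fin 3} (hij : j ≠ i) {a : E × Bool}
    (ha : a ∈ S i) : Γ.hit (U j) a.1 = 0 :=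
  H.hit_eq_zero (H.tri.Ssub i ha) (Finset.disjoint_left.1 (H.tri.SZ i) ha)
    (Finset.disjoint_left.1 (H.tri.SS i j hij.symm) ha)

lemma eq_tgt (H : Γ.Pot F e T C Nu Nv Z L S I U) (i j : Fin 3) :
    U i (Γ.tgt e) = U j (Γ.tgt e) := by
  have h1 := (H.tight i).he
  have h2 := (H.tight j).he
  rw [hit, H.zero, add_zero] at h1 h2
  exact add_left_cancel (h1.trans h2.symm)

/-- An edge that neither switching hits has the same value of `W + W'` at both ends. -/
lemma const_of_joined {X : Finset (E × Bool)} {N : Set V} {W W' : V → ZMod 2}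
    (h : ∀ a ∈ X, Γ.hit W a.1 = 0 ∧ Γ.hit W' a.1 = 0) {p q : V}
    (hpq : Relation.ReflTransGen (Joined Γ.tl Γ.hd X N) p q) : W p + W' p = W q + W' q := by
  induction hpq with
  | refl => rfl
  | tail _ hs ih =>
    obtain ⟨-, -, a, ha, hja⟩ := hs
    rw [ih]
    have h1 := (joins_tl_hd (Γ := Γ) a).hit_add W W'
    rw [(h a ha).1, (h a ha).2] at h1
    have e1 : ∀ x y : ZMod 2, 0 + 0 = x + y → x = y := by decide
    rcases hja with ⟨rfl, rfl⟩ | ⟨rfl, rfl⟩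
    · exact e1 _ _ h1
    · exact (e1 _ _ h1).symm

lemma zmod_two_eq_of_add {a b : ZMod 2} (h : a + b = 0) : a = b := by
  revert a b; decide

lemma zmod_two_add_self (a : ZMod 2) : a + a = 0 := by
  revert a; decide

lemma eq_of_conn (H : Γ.Pot F e T C Nu Nv Z L S I U) {N : Set V} {x₀ : V}
    (hx₀ : x₀ ∈ N) (h₀ : ∀ i j, U i x₀ = U j x₀)
    (hc : ∃ r ∈ N, ∀ x ∈ N, Relation.ReflTransGen (Joined Γ.tl Γ.hd L N) r x)
    {x : V} (hx : x ∈ N) (i j : Fin 3) : U i x = U j x := by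
  obtain ⟨r, -, hr⟩ := hc
  have hL := fun a (ha : a ∈ L) => And.intro (H.hit_L i ha) (H.hit_L j ha)
  have h1 := const_of_joined hL (hr x hx)
  have h2 := const_of_joined hL (hr x₀ hx₀)
  rw [h1, h₀ i j, zmod_two_add_self] at h2
  exact zmod_two_eq_of_add h2

lemma eq_Nu (H : Γ.Pot F e T C Nu Nv Z L S I U) {x : V} (hx : x ∈ Nu) (i j : Fin 3) :
    U i x = U j x :=
  H.eq_of_conn H.tri.memu (fun i j => by rw [H.zero, H.zero]) H.tri.connu hx i j

lemma eq_Nv (H : Γ.Pot F e T C Nu Nv Z L S I U) {x : V} (hx : x ∈ Nv) (i j : Fin 3) :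
    U i x = U j x :=
  H.eq_of_conn H.tri.memv H.eq_tgt H.tri.connv hx i j

/-- The switchings of the other two arcs hit nothing on this arc and agree where it leaves `Nu`. -/
lemma eq_I (H : Γ.Pot F e T C Nu Nv Z L S I U) {x : V} {i : Fin 3} (hx : x ∈ I i) {j k : Fin 3}
    (hj : j ≠ i) (hk : k ≠ i) : U j x = U k x := by
  obtain ⟨a, ha, haN, haI, hc⟩ := H.tri.first i ⟨x, hx⟩
  have hS := fun a (ha : a ∈ S i) => And.intro (H.hit_S hj ha) (H.hit_S hk ha)
  have h1 := const_of_joined hS (hc x hx)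
  have h2 := (joins_tl_hd (Γ := Γ) a).hit_add (U j) (U k)
  rw [(hS a ha).1, (hS a ha).2, H.eq_Nu haN j k, zmod_two_add_self, zmod_two_add_self, h1,
    zero_add] at h2
  exact zmod_two_eq_of_add h2.symm

lemma ne_imp_differs (H : Γ.Pot F e T C Nu Nv Z L S I U) {x : V} {i : Fin 3} (hx : x ∈ I i)
    {j k : Fin 3} (h : U j x ≠ U k x) : Differs i (fun m => U m x) := by
  rcases differs_cases (fun m => U m x) with h1 | ⟨l, hl⟩
  · exact absurd (h1 j k) h
  · by_cases hli : l = i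
    · rwa [hli] at hl
    · exfalso
      obtain ⟨m, hm1, hm2⟩ : ∃ m, m ≠ i ∧ m ≠ l := by
        clear h hl hx
        revert i l
        decide
      exact hl m hm2 (H.eq_I hx hm1 hli)

lemma eq_ends (H : Γ.Pot F e T C Nu Nv Z L S I U) {i : Fin 3} {a : E × Bool} (ha : a ∈ S i)
    {x : V} (hx : x = Γ.tl a ∨ x = Γ.hd a) : x ∈ I i ∨ ∀ j k, U j x = U k x := by
  obtain ⟨h1, h2⟩ := H.tri.ends i a ha
  rcases hx with rfl | rfl
  · exact h1.elim (fun h => Or.inr (H.eq_Nu h)) Or.inl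
  · exact h2.elim (fun h => Or.inr (H.eq_Nv h)) Or.inl

/-- If `U i` agreed with another `U j` along the whole arc, it would hit no edge of `S i`, and `Z`
would be good. -/
lemma exists_root (H : Γ.Pot F e T C Nu Nv Z L S I U) (i : Fin 3) :
    ∃ x ∈ I i, Differs i (fun m => U m x) := by
  by_contra hcon
  push Not at hcon
  refine H.tri.bad ⟨U i, H.tight i, fun f hf h1 => ?_⟩
  obtain ⟨a, ha, rfl⟩ := Finset.mem_image.1 (H.sub i f hf h1)
  rcases Finset.mem_union.1 ha with ha | ha
  · exact Finset.mem_image_of_mem _ ha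
  exfalso
  have hne : ∀ i : Fin 3, ∃ j, j ≠ i := by decide
  obtain ⟨j, hj⟩ := hne i
  have hends : ∀ x, x = Γ.tl a ∨ x = Γ.hd a → U i x = U j x := by
    intro x hx
    rcases H.eq_ends ha hx with h2 | h2
    · by_contra h3
      exact hcon x h2 (H.ne_imp_differs h2 h3)
    · exact h2 i j
  have h2 := (joins_tl_hd (Γ := Γ) a).hit_add (U i) (U j)
  rw [h1, H.hit_S hj ha, hends _ (Or.inl rfl), hends _ (Or.inr rfl), zmod_two_add_self,
    zmod_two_add_self] at h2
  exact absurd h2 (by decide)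

variable (Γ) in
/-- Adjacency by an edge of `F` that is hit neither by `W` nor by `W'`. -/
def Clear (F : Finset E) (W W' : V → ZMod 2) (p q : V) : Prop :=
  ∃ f ∈ F, Γ.hit W f = 0 ∧ Γ.hit W' f = 0 ∧ Γ.Joins f p q

lemma const_of_clear {W W' : V → ZMod 2} {p q : V}
    (h : Relation.ReflTransGen (Clear Γ F W W') p q) : W p + W' p = W q + W' q := by
  induction h with
  | refl => rfl
  | tail _ hs ih =>
    obtain ⟨f, -, h1, h2, hj⟩ := hs
    have h3 := hj.hit_add W W'
    rw [h1, h2] at h3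
    have e1 : ∀ x y : ZMod 2, 0 + 0 = x + y → x = y := by decide
    rw [ih, e1 _ _ h3]

/-- Two arcs of the tripod are linked by edges that are hit by neither of their switchings. -/
lemma exists_link (H : Γ.Pot F e T C Nu Nv Z L S I U) {i j : Fin 3} (hij : i ≠ j) :
    ∃ x ∈ I i, ∃ y ∈ I j, Differs i (fun m => U m x) ∧ Differs j (fun m => U m y) ∧
      Relation.ReflTransGen (Clear Γ F (U i) (U j)) x y := by
  classical
  by_contra hcon
  -- If no link exists, switch `U i` on the set `Y` reached from the differing vertices of arc `i`.
  -- The result is tight and hits the flow only in `Z`, contradicting badness.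
  set Y : Set V := {y | ∃ x ∈ I i, Differs i (fun m => U m x) ∧
    Relation.ReflTransGen (Clear Γ F (U i) (U j)) x y} with hY
  have hYne : ∀ y ∈ Y, U i y ≠ U j y := by
    rintro y ⟨x, hx, hd, hxy⟩ heq
    have h1 := const_of_clear hxy
    rw [heq, zmod_two_add_self] at h1
    exact hd j hij.symm (zmod_two_eq_of_add h1).symm
  have hYI : ∀ y ∈ I i, U i y ≠ U j y → y ∈ Y := fun y hy hne =>
    ⟨y, hy, H.ne_imp_differs hy hne, .refl⟩
  have hYJ : ∀ y ∈ I j, y ∉ Y := by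
    rintro y hy hyY
    obtain ⟨x, hx, hd, hxy⟩ := id hyY
    exact hcon ⟨x, hx, y, hy, hd, H.ne_imp_differs hy (hYne y hyY), hxy⟩
  set ind : V → ZMod 2 := fun x => if x ∈ Y then 1 else 0 with hind
  have hit' : ∀ f p q, Γ.Joins f p q →
      Γ.hit (fun x => U i x + ind x) f = Γ.hit (U i) f + (ind p + ind q) := by
    intro f p q hj
    rw [hj.hit, hj.hit]; ring
  have hclosed : ∀ f ∈ F, Γ.hit (U i) f = 0 → Γ.hit (U j) f = 0 →
      Γ.hit (fun x => U i x + ind x) f = 0 := by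
    intro f hf h1 h2
    have hj : Γ.Joins f (Γ.src f) (Γ.tgt f) := Or.inl ⟨rfl, rfl⟩
    rw [hit' f _ _ hj, h1]
    have h3 : Γ.src f ∈ Y ↔ Γ.tgt f ∈ Y := by
      constructor
      · rintro ⟨x, hx, hd, hxy⟩
        exact ⟨x, hx, hd, hxy.tail ⟨f, hf, h1, h2, hj⟩⟩
      · rintro ⟨x, hx, hd, hxy⟩
        exact ⟨x, hx, hd, hxy.tail ⟨f, hf, h1, h2, hj.symm⟩⟩
    have h4 : ind (Γ.src f) = ind (Γ.tgt f) := by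
      simp only [hind, h3]
    rw [h4, zmod_two_add_self, add_zero]
  have hindeq : ∀ x, U i x = U j x → ind x = 0 := fun x hx => by
    simp only [hind]
    exact if_neg fun h => hYne x h hx
  refine H.tri.bad ⟨fun x => U i x + ind x, ⟨?_, fun f hf hfD hfe hfC => ?_, fun k => ?_⟩,
    fun f hf h1 => ?_⟩
  · rw [hit' e _ _ (Or.inl ⟨rfl, rfl⟩), (H.tight i).he, hindeq _ (by rw [H.zero, H.zero]),
      hindeq _ (H.eq_tgt i j), add_zero, add_zero]
  · exact hclosed f hf ((H.tight i).out f hf hfD hfe hfC) ((H.tight j).out f hf hfD hfe hfC)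
  -- The new hits in `C k` lie among the single hits of `U i` and `U j`; there are at most two of
  -- them and an odd number, hence exactly one.
  · have hsub : Γ.hits (C k) (fun x => U i x + ind x) ⊆
        Γ.hits (C k) (U i) ∪ Γ.hits (C k) (U j) := by
      intro f hf
      obtain ⟨hfC, hf1⟩ := mem_hits.1 hf
      by_contra h2
      simp only [Finset.mem_union, mem_hits, hfC, true_and, not_or] at h2
      rw [hclosed f (H.cfg.CF k hfC) (zmod_two_ne.1 h2.1) (zmod_two_ne.1 h2.2)] at hf1
      exact absurd hf1 (by decide)
    have h1 := (Finset.card_le_card hsub).trans (Finset.card_union_le _ _)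
    rw [(H.tight i).one, (H.tight j).one] at h1
    obtain ⟨m, hm⟩ := (H.cfg.odd k).hits_odd (fun x => U i x + ind x)
    omega
  · have h2 : Γ.hit (U i) f = 1 ∨ Γ.hit (U j) f = 1 := by
      by_contra h2
      push Not at h2
      rw [hclosed f (H.cfg.TF hf) (zmod_two_ne.1 h2.1) (zmod_two_ne.1 h2.2)] at h1
      exact absurd h1 (by decide)
    have h3 : f ∈ Z.image Prod.fst ∨ ∃ a ∈ S i ∪ S j, a.1 = f := by
      have h4 : f ∈ (Z ∪ S i).image Prod.fst ∨ f ∈ (Z ∪ S j).image Prod.fst :=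
        h2.imp (H.sub i f hf) (H.sub j f hf)
      rcases h4 with h4 | h4 <;>
      · obtain ⟨a, ha, rfl⟩ := Finset.mem_image.1 h4
        rcases Finset.mem_union.1 ha with ha | ha
        · exact Or.inl (Finset.mem_image_of_mem _ ha)
        · exact Or.inr ⟨a, by simp [ha], rfl⟩
    rcases h3 with h3 | ⟨a, ha, rfl⟩
    · exact h3
    exfalso
    have hja := joins_tl_hd (Γ := Γ) a
    rw [hit' _ _ _ hja] at h1
    rcases Finset.mem_union.1 ha with ha | ha
    -- On arc `i` the new switching coincides with `U j`, and on arc `j` with `U i`; neither hits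
    -- the arc in question.
    · have hindI : ∀ x, x = Γ.tl a ∨ x = Γ.hd a → ind x = U i x + U j x := by
        intro x hx
        by_cases hxe : U i x = U j x
        · rw [hindeq x hxe, hxe, zmod_two_add_self]
        · have hxI : x ∈ I i := (H.eq_ends ha hx).resolve_right fun h => hxe (h i j)
          have : ind x = 1 := if_pos (hYI x hxI hxe)
          rw [this]
          have e1 : ∀ a b : ZMod 2, a ≠ b → 1 = a + b := by decide
          exact e1 _ _ hxe
      have h4 := hja.hit_add (U i) (U j)
      rw [H.hit_S hij.symm ha, add_zero] at h4
      rw [hindI _ (Or.inl rfl), hindI _ (Or.inr rfl), h4, zmod_two_add_self] at h1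
      exact absurd h1 (by decide)
    · have hindJ : ∀ x, x = Γ.tl a ∨ x = Γ.hd a → ind x = 0 := by
        intro x hx
        rcases H.eq_ends ha hx with h4 | h4
        · exact if_neg (hYJ x h4)
        · exact hindeq x (h4 i j)
      rw [hindJ _ (Or.inl rfl), hindJ _ (Or.inr rfl), H.hit_S hij ha] at h1
      exact absurd h1 (by decide)

end Pot

end SignedGraph

end OddPacking

/-! ### Assembling the odd `K₅` -/

namespace OddPacking

namespace SignedGraph

variable {V E : Type*} {Γ : SignedGraph V E} [DecidableEq E]

namespace Pot

variable {F : Finset E} {e : E} {T : Finset (E × Bool)} {n : ℕ} {C : Fin n → Finset E}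
  {Nu Nv : Set V} {Z L : Finset (E × Bool)} {S : Fin 3 → Finset (E × Bool)}
  {I : Fin 3 → Set V} {U : Fin 3 → V → ZMod 2}

/-- Summing an odd number of switchings reproduces the sign of the edge once, since `3 = 1` modulo
2. -/
lemma hit_sum (U : Fin 3 → V → ZMod 2) (f : E) :
    Γ.hit (fun x => ∑ i, U i x) f = ∑ i, Γ.hit (U i) f := by
  simp only [hit, Fin.sum_univ_three]
  have e1 : ∀ s a b c a' b' c' : ZMod 2, s + (a + b + c) + (a' + b' + c') =
    s + a + a' + (s + b + b') + (s + c + c') := by decide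
  exact e1 _ _ _ _ _ _ _

lemma sum_eq_single {w : Fin 3 → ZMod 2} {i : Fin 3} (h : ∀ j, j ≠ i → w j = 0) :
    ∑ j, w j = w i :=
  Finset.sum_eq_single i (fun j _ hj => h j hj) (by simp)

lemma hit_sum_L (H : Γ.Pot F e T C Nu Nv Z L S I U) {a : E × Bool} (ha : a ∈ L) :
    Γ.hit (fun x => ∑ i, U i x) a.1 = 0 := by
  rw [hit_sum]
  exact Finset.sum_eq_zero fun i _ => H.hit_L i ha

/-- On an arc, the sum of the switchings detects changes of class. -/
lemma hit_sum_S (H : Γ.Pot F e T C Nu Nv Z L S I U) {i j : Fin 3} (hij : j ≠ i) {a : E × Bool}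
    (ha : a ∈ S i) : Γ.hit (fun x => ∑ i, U i x) a.1 =
      (U i (Γ.tl a) + U j (Γ.tl a)) + (U i (Γ.hd a) + U j (Γ.hd a)) := by
  rw [hit_sum, sum_eq_single fun j hj => H.hit_S hj ha, ← (joins_tl_hd a).hit_add,
    H.hit_S hij ha, add_zero]

lemma hit_sum_e (H : Γ.Pot F e T C Nu Nv Z L S I U) : Γ.hit (fun x => ∑ i, U i x) e = 1 := by
  rw [hit_sum, Finset.sum_congr rfl fun i _ => (H.tight i).he]
  decide

/-- Only the third switching can contribute. It agrees with `U j` at vertices of colour `i` and with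
`U i` at vertices of colour `j`. So it misses the edge, like `U i` and `U j`, if the colours of the
ends are equal, and hits it otherwise. -/
lemma hit_sum_clear {U : Fin 3 → V → ZMod 2} {f : E} {p q : V} {i j c c' : Fin 3} (hij : i ≠ j)
    (hf : Γ.Joins f p q) (hi : Γ.hit (U i) f = 0) (hj : Γ.hit (U j) f = 0)
    (hc : Differs c (fun m => U m p)) (hc' : Differs c' (fun m => U m q))
    (hcij : c = i ∨ c = j) (hcij' : c' = i ∨ c' = j) :
    Γ.hit (fun x => ∑ i, U i x) f = if c = c' then 0 else 1 := by
  obtain ⟨l, hli, hlj, hl⟩ : ∃ l, l ≠ i ∧ l ≠ j ∧ ∀ k, k ≠ l → k = i ∨ k = j := by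
    clear hi hj hcij hcij'
    revert i j
    decide
  rw [hit_sum, sum_eq_single (i := l) fun k hk => by rcases hl k hk with rfl | rfl <;> assumption]
  rw [hf.hit] at hi hj ⊢
  have hs : ∀ {c : Fin 3} {x : V}, Differs c (fun m => U m x) → c = i ∨ c = j →
      U i x ≠ U j x ∧ U l x = if c = i then U j x else U i x := by
    intro c x hc hcij
    rcases hcij with rfl | rfl
    · rw [if_pos rfl]
      exact ⟨(hc j hij.symm).symm, hc.eq l j hli hij.symm⟩
    · rw [if_neg hij.symm]
      exact ⟨hc i hij, hc.eq l i hlj hij⟩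
  obtain ⟨h1, h2⟩ := hs hc hcij
  obtain ⟨h3, h4⟩ := hs hc' hcij'
  rw [h2, h4]
  clear hs h2 h4 hc hc' hf
  generalize U i p = a at *
  generalize U i q = a' at *
  generalize U j p = b at *
  generalize U j q = b' at *
  generalize Γ.sg f = s at *
  have hne : ∀ a b : ZMod 2, a ≠ b → b = a + 1 := by decide
  obtain rfl := hne _ _ h1
  obtain rfl := hne _ _ h3
  rcases hcij with rfl | rfl <;> rcases hcij' with rfl | rfl <;>
    simp only [if_true, if_neg hij, if_neg hij.symm] <;>
    clear * - hi hj <;> revert s a a' <;> decide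

variable [Fintype V]

/-- The tripod and the links between its arcs give an odd `K₅` minor. -/
theorem hasOddK5 (H : Γ.Pot F e T C Nu Nv Z L S I U) : Γ.HasOddK5 := by
  classical
  choose ρ hρI hρd using H.exists_root
  -- the set `R i` of vertices of the `i`-th arc where `U i` differs
  set R : Fin 3 → Set V := fun i => {x | x ∈ I i ∧ Differs i (fun m => U m x)} with hR
  have hRdisj : ∀ {i j x}, x ∈ R i → x ∈ R j → i = j := fun hi hj => hi.2.unique hj.2
  set col : V → Fin 3 := fun x => if h : ∃ i, Differs i (fun m => U m x) then h.choose else 0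
    with hcol
  have hcold : ∀ {x i}, Differs i (fun m => U m x) → col x = i := by
    intro x i hi
    have h : ∃ i, Differs i (fun m => U m x) := ⟨i, hi⟩
    have h1 : col x = h.choose := dif_pos h
    rw [h1]
    exact h.choose_spec.unique hi
  -- `π` shrinks the differing vertices of each arc to one representative, which becomes the root of
  -- that colour.
  set π : V → V := fun x => if h : ∃ i, x ∈ R i then ρ h.choose else x with hπ
  have hπR : ∀ {x i}, x ∈ R i → π x = ρ i := by
    intro x i hi
    have h : ∃ i, x ∈ R i := ⟨i, hi⟩
    have h1 : π x = ρ h.choose := dif_pos h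
    rw [h1, hRdisj h.choose_spec hi]
  have hπn : ∀ {x}, (∀ i, x ∉ R i) → π x = x := fun h => dif_neg fun ⟨i, hi⟩ => h i hi
  have hρR : ∀ i, ρ i ∈ R i := fun i => ⟨hρI i, hρd i⟩
  have hπcases : ∀ x, (∃ i, x ∈ R i ∧ π x = ρ i) ∨ ((∀ i, x ∉ R i) ∧ π x = x) := by
    intro x
    by_cases h : ∃ i, x ∈ R i
    · obtain ⟨i, hi⟩ := h
      exact Or.inl ⟨i, hi, hπR hi⟩
    · push Not at h
      exact Or.inr ⟨h, hπn h⟩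
  have hπd : ∀ {x i}, Differs i (fun m => U m x) → Differs i (fun m => U m (π x)) := by
    intro x i hi
    rcases hπcases x with ⟨j, hj, hjx⟩ | ⟨-, hx⟩
    · rw [hjx, hi.unique hj.2]; exact hρd j
    · rwa [hx]
  have hπd' : ∀ {x i}, Differs i (fun m => U m (π x)) → Differs i (fun m => U m x) := by
    intro x i hi
    rcases hπcases x with ⟨j, hj, hjx⟩ | ⟨-, hx⟩
    · rw [hjx] at hi
      rw [hi.unique (hρd j)]; exact hj.2
    · rwa [hx] at hi
  have hπρ : ∀ {x i}, π x = ρ i → x ∈ R i := by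
    intro x i hi
    rcases hπcases x with ⟨j, hj, hjx⟩ | ⟨hx, hx'⟩
    · have : j = i := hRdisj (x := ρ i) (by rw [← hi, hjx]; exact hρR j) (hρR i)
      rwa [this] at hj
    · exact absurd (hρR i) (by rw [← hi, hx']; exact hx i)
  set Y : Finset V := Finset.univ.filter (fun x => ∃ i, Differs i (fun m => U m x)) with hY
  have hYmem : ∀ {x}, x ∈ Y ↔ ∃ i, Differs i (fun m => U m x) := by simp [hY]
  -- Only edges whose sign under the sum of the three switchings is the colour difference are kept;
  -- the links between arcs consist of such edges.
  set Adj : V → V → Prop := fun p q => ∃ x y f, π x = p ∧ π y = q ∧ Γ.Joins f x y ∧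
    Γ.hit (fun x => ∑ i, U i x) f = colDiff col p q with hAdj
  have hsymm : ∀ p q, Adj p q → Adj q p := by
    rintro p q ⟨x, y, f, h1, h2, h3, h4⟩
    exact ⟨y, x, f, h2, h1, h3.symm, by rw [h4, colDiff_comm]⟩
  have hchain : ∀ i j, i ≠ j →
      Relation.ReflTransGen (Link Adj (kempe col Y i j)) (ρ i) (ρ j) := by
    intro i j hij
    obtain ⟨x, hx, y, hy, hdx, hdy, hxy⟩ := H.exists_link hij
    rw [← hπR (i := i) ⟨hx, hdx⟩, ← hπR (i := j) ⟨hy, hdy⟩]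
    have key : ∀ y, Relation.ReflTransGen (Clear Γ F (U i) (U j)) x y →
        Relation.ReflTransGen (Link Adj (kempe col Y i j)) (π x) (π y) ∧
        ∃ c, (c = i ∨ c = j) ∧ Differs c (fun m => U m y) := by
      intro y hy
      induction hy with
      | refl => exact ⟨.refl, i, Or.inl rfl, hdx⟩
      | @tail p q hxp hpq ih =>
        obtain ⟨h1, c, hc, hcp⟩ := ih
        have hq : U i q ≠ U j q := by
          intro heq
          have h2 := const_of_clear (hxp.tail hpq)
          rw [heq, zmod_two_add_self] at h2
          exact hdx j hij.symm (zmod_two_eq_of_add h2).symm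
        obtain ⟨c', hc', hcq⟩ : ∃ c', (c' = i ∨ c' = j) ∧ Differs c' (fun m => U m q) := by
          rcases differs_of_ne (w := fun m => U m q) hq with h | h
          · exact ⟨i, Or.inl rfl, h⟩
          · exact ⟨j, Or.inr rfl, h⟩
        refine ⟨h1.tail ⟨⟨hYmem.2 ⟨c, hπd hcp⟩, ?_⟩, ⟨hYmem.2 ⟨c', hπd hcq⟩, ?_⟩, ?_⟩,
          c', hc', hcq⟩
        · rw [hcold (hπd hcp)]; exact hc
        · rw [hcold (hπd hcq)]; exact hc'
        · obtain ⟨f, -, hfi, hfj, hjo⟩ := hpq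
          refine ⟨p, q, f, rfl, rfl, hjo, ?_⟩
          rw [hit_sum_clear hij hjo hfi hfj hcp hcq hc hc', colDiff, hcold (hπd hcp),
            hcold (hπd hcq)]
    exact (key y hxy).1
  obtain ⟨M, t, HM⟩ := exists_oddTriangle col Adj hsymm Y ρ (fun i => hYmem.2 ⟨i, hρd i⟩)
    (fun i => hcold (hρd i)) hchain
  have hMd : ∀ {x i}, M (π x) = some i → ∃ j, Differs j (fun m => U m x) := by
    intro x i h
    obtain ⟨j, hj⟩ := hYmem.1 (HM.sub _ _ h)
    exact ⟨j, hπd' hj⟩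
  have heqd : ∀ {x}, (∀ i j, U i x = U j x) → ¬ ∃ j, Differs j (fun m => U m x) := by
    rintro x hx ⟨j, hj⟩
    have hne : ∀ j : Fin 3, j + 1 ≠ j := by decide
    exact hj (j + 1) (hne j) (hx _ _)
  -- On the interior of an arc, `τ` is 0 at differing vertices and 1 at the others. This makes all
  -- edges inside the arc even and its first and last edges odd.
  set τ : V → ZMod 2 := fun x => if ∃ j, Differs j (fun m => U m x) then t (π x) else
    if ∃ i, x ∈ I i then 1 else 0 with hτ
  have hτd : ∀ {x}, (∃ j, Differs j (fun m => U m x)) → τ x = t (π x) := fun h => if_pos h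
  have hτM : ∀ {x i}, M (π x) = some i → τ x = t (π x) := fun h => hτd (hMd h)
  have hτu : ∀ {x}, x ∈ Nu → τ x = 0 := by
    intro x hx
    have h1 : ¬ ∃ i, x ∈ I i := fun ⟨i, hi⟩ => Set.disjoint_left.1 (H.tri.Iu i) hi hx
    simp only [hτ, if_neg (heqd (H.eq_Nu hx)), if_neg h1]
  have hτv : ∀ {x}, x ∈ Nv → τ x = 0 := by
    intro x hx
    have h1 : ¬ ∃ i, x ∈ I i := fun ⟨i, hi⟩ => Set.disjoint_left.1 (H.tri.Iv i) hi hx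
    simp only [hτ, if_neg (heqd (H.eq_Nv hx)), if_neg h1]
  have hτI : ∀ {x i j}, x ∈ I i → j ≠ i → τ x = 1 + (U i x + U j x) := by
    intro x i j hx hji
    by_cases hne : U i x = U j x
    · have h1 : ∀ k l, U k x = U l x := by
        have h2 : ∀ k, U k x = U j x := fun k => by
          by_cases hk : k = i
          · rw [hk, hne]
          · exact H.eq_I hx hk hji
        exact fun k l => (h2 k).trans (h2 l).symm
      have h3 : ∃ i, x ∈ I i := ⟨i, hx⟩
      simp only [hτ, if_neg (heqd h1), if_pos h3]
      rw [hne, zmod_two_add_self, add_zero]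
    · have hd := H.ne_imp_differs hx hne
      rw [hτd ⟨i, hd⟩, hπR (i := i) ⟨hx, hd⟩, HM.troot]
      have e1 : ∀ a b : ZMod 2, a ≠ b → 0 = 1 + (a + b) := by decide
      exact e1 _ _ hne
  set s : V → ZMod 2 := fun x => (∑ i, U i x) + τ x with hs
  have hits : ∀ {f p q}, Γ.Joins f p q →
      Γ.hit s f = Γ.hit (fun x => ∑ i, U i x) f + (τ p + τ q) := by
    intro f p q hj
    rw [hj.hit, hj.hit]; ring
  have hnext : ∀ i : Fin 3, i + 1 ≠ i := by decide
  set B : Fin 3 → Set V := fun i => {x | x ∈ I i ∨ M (π x) = some i} with hB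
  have hRB : ∀ {x i j}, x ∈ R i → M (π x) = some j → i = j := by
    intro x i j hx hj
    rw [hπR hx, HM.root] at hj
    exact Option.some.inj hj
  have hIM : ∀ {x i j}, x ∈ I i → M (π x) = some j → x ∈ R i := by
    intro x i j hx hj
    obtain ⟨k, hk⟩ := hMd hj
    exact ⟨hx, H.ne_imp_differs hx (hk (k + 1) (hnext k))⟩
  have hconnN : ∀ {N : Set V}, (∀ {x}, x ∈ N → τ x = 0) →
      ∀ {p q}, Relation.ReflTransGen (Joined Γ.tl Γ.hd L N) p q →
      Relation.ReflTransGen (Γ.EvenAdj s N) p q := by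
    intro N hN p q h
    refine Relation.ReflTransGen.mono ?_ _ _ h
    rintro p q ⟨hp, hq, a, ha, hja⟩
    have hj : Γ.Joins a.1 p q := by
      rcases hja with ⟨rfl, rfl⟩ | ⟨rfl, rfl⟩
      · exact joins_tl_hd a
      · exact (joins_tl_hd a).symm
    refine ⟨hp, hq, a.1, ?_, hj⟩
    rw [hits hj, H.hit_sum_L ha, hN hp, hN hq]; rfl
  have hfirst : ∀ i, ∃ f, Γ.hit s f = 1 ∧ ∃ p ∈ Nu, ∃ q ∈ B i, Γ.Joins f p q := by
    intro i
    obtain ⟨a, ha, haN, haI, -⟩ := H.tri.first i ⟨ρ i, hρI i⟩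
    refine ⟨a.1, ?_, _, haN, _, Or.inl haI, joins_tl_hd a⟩
    rw [hits (joins_tl_hd a), H.hit_sum_S (hnext i) ha, hτu haN, hτI haI (hnext i),
      H.eq_Nu haN i (i + 1), zmod_two_add_self]
    have e1 : ∀ a : ZMod 2, 0 + a + (0 + (1 + a)) = 1 := by decide
    exact e1 _
  have hlast : ∀ i, ∃ f, Γ.hit s f = 1 ∧ ∃ p ∈ Nv, ∃ q ∈ B i, Γ.Joins f p q := by
    intro i
    obtain ⟨a, ha, haI, haN⟩ := H.tri.last i ⟨ρ i, hρI i⟩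
    refine ⟨a.1, ?_, _, haN, _, Or.inl haI, (joins_tl_hd a).symm⟩
    rw [hits (joins_tl_hd a), H.hit_sum_S (hnext i) ha, hτv haN, hτI haI (hnext i),
      H.eq_Nv haN i (i + 1), zmod_two_add_self]
    have e1 : ∀ a : ZMod 2, a + 0 + (1 + a + 0) = 1 := by decide
    exact e1 _
  have hswap : ∀ {N N' : Set V}, (∃ f, Γ.hit s f = 1 ∧ ∃ p ∈ N, ∃ q ∈ N', Γ.Joins f p q) →
      ∃ f, Γ.hit s f = 1 ∧ ∃ p ∈ N', ∃ q ∈ N, Γ.Joins f p q := by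
    rintro N N' ⟨f, hf, p, hp, q, hq, hj⟩
    exact ⟨f, hf, q, hq, p, hp, hj.symm⟩
  have huv : ∃ f, Γ.hit s f = 1 ∧ ∃ p ∈ Nu, ∃ q ∈ Nv, Γ.Joins f p q := by
    refine ⟨e, ?_, _, H.tri.memu, _, H.tri.memv, Or.inl ⟨rfl, rfl⟩⟩
    rw [hits (Or.inl ⟨rfl, rfl⟩ : Γ.Joins e _ _), H.hit_sum_e, hτu H.tri.memu, hτv H.tri.memv]
    rfl
  have huB : ∀ i, Disjoint Nu (B i) := fun i => Set.disjoint_left.2 fun x hx hxB =>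
    hxB.elim (fun h => Set.disjoint_left.1 (H.tri.Iu i) h hx) fun h => heqd (H.eq_Nu hx) (hMd h)
  have hvB : ∀ i, Disjoint Nv (B i) := fun i => Set.disjoint_left.2 fun x hx hxB =>
    hxB.elim (fun h => Set.disjoint_left.1 (H.tri.Iv i) h hx) fun h => heqd (H.eq_Nv hx) (hMd h)
  have hBB : ∀ i j, i ≠ j → Disjoint (B i) (B j) := by
    intro i j hij
    refine Set.disjoint_left.2 ?_
    rintro x (hx | hx) (hx' | hx')
    · exact Set.disjoint_left.1 (H.tri.II i j hij) hx hx'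
    · exact hij (hRB (hIM hx hx') hx')
    · exact hij (hRB (hIM hx' hx) hx).symm
    · rw [hx] at hx'
      exact hij (Option.some.inj hx')
  have hBodd : ∀ i j, i ≠ j → ∃ f, Γ.hit s f = 1 ∧ ∃ p ∈ B i, ∃ q ∈ B j, Γ.Joins f p q := by
    intro i j hij
    obtain ⟨p, q, hp, hq, ⟨x, y, f, rfl, rfl, hj, hf⟩, htt⟩ := HM.odd i j hij
    refine ⟨f, ?_, x, Or.inr hp, y, Or.inr hq, hj⟩
    rw [hits hj, hf, hτM hp, hτM hq, htt]
    have e1 : ∀ a : ZMod 2, a + (1 + a) = 1 := by decide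
    exact e1 _
  have hBconn : ∀ i, ∃ r ∈ B i, ∀ x ∈ B i, Relation.ReflTransGen (Γ.EvenAdj s (B i)) r x := by
    intro i
    obtain ⟨a, ha, haN, haI, hc⟩ := H.tri.first i ⟨ρ i, hρI i⟩
    have hI : ∀ x ∈ I i, Relation.ReflTransGen (Γ.EvenAdj s (B i)) (Γ.hd a) x := by
      intro x hx
      refine Relation.ReflTransGen.mono ?_ _ _ (hc x hx)
      rintro p q ⟨hp, hq, b, hb, hjb⟩
      have hj : Γ.Joins b.1 p q := by
        rcases hjb with ⟨rfl, rfl⟩ | ⟨rfl, rfl⟩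
        · exact joins_tl_hd b
        · exact (joins_tl_hd b).symm
      refine ⟨Or.inl hp, Or.inl hq, b.1, ?_, hj⟩
      have h1 := H.hit_sum_S (hnext i) hb
      have h2 : Γ.hit (fun x => ∑ i, U i x) b.1 =
          (U i p + U (i + 1) p) + (U i q + U (i + 1) q) := by
        rw [h1]
        rcases hjb with ⟨rfl, rfl⟩ | ⟨rfl, rfl⟩
        · rfl
        · rw [add_comm]
      rw [hits hj, h2, hτI hp (hnext i), hτI hq (hnext i)]
      have e1 : ∀ a b : ZMod 2, a + b + (1 + a + (1 + b)) = 0 := by decide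
      exact e1 _ _
    refine ⟨Γ.hd a, Or.inl haI, ?_⟩
    have hM : ∀ q, Relation.ReflTransGen (fun p q => M p = some i ∧ M q = some i ∧ Adj p q ∧
        t p + t q = colDiff col p q) (ρ i) q →
        ∀ y, π y = q → Relation.ReflTransGen (Γ.EvenAdj s (B i)) (Γ.hd a) y := by
      intro q hq
      induction hq with
      | refl => exact fun y hy => hI y (hπρ hy).1
      | @tail p q _ hpq ih =>
        obtain ⟨hp, hq, ⟨x, y, f, rfl, rfl, hj, hf⟩, htt⟩ := hpq
        intro y' hy'
        have hxy : Γ.EvenAdj s (B i) x y := by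
          refine ⟨Or.inr hp, Or.inr hq, f, ?_, hj⟩
          rw [hits hj, hf, hτM hp, hτM hq, htt, zmod_two_add_self]
        rcases hπcases y' with ⟨k, hk, -⟩ | ⟨hn, hy''⟩
        · have hki : k = i := hRB hk (by rw [hy']; exact hq)
          exact hI y' (hki ▸ hk.1)
        · rcases hπcases y with ⟨k, hk, hky⟩ | ⟨-, hyy⟩
          · exfalso
            refine hn k ?_
            rw [← hy'', hy', hky]
            exact hρR k
          · rw [← hy'', hy', hyy]
            exact (ih x rfl).tail hxy
    rintro x (hx | hx)
    · exact hI x hx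
    · exact hM _ (HM.conn _ _ hx) x rfl
  refine IsOddModel.hasOddK5 (ι := Option (Option (Fin 3))) (by simp) (s := s)
    (N := fun k => k.elim Nu fun k' => k'.elim Nv B) ⟨?_, ?_, ?_⟩
  · rintro (_ | _ | i) (_ | _ | j) hij
    · exact absurd rfl hij
    · exact H.tri.disj
    · exact huB j
    · exact H.tri.disj.symm
    · exact absurd rfl hij
    · exact hvB j
    · exact (huB i).symm
    · exact (hvB i).symm
    · exact hBB i j fun h => hij (by rw [h])
  · rintro (_ | _ | i)
    · obtain ⟨r, hr, h⟩ := H.tri.connu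
      exact ⟨r, hr, fun x hx => hconnN hτu (h x hx)⟩
    · obtain ⟨r, hr, h⟩ := H.tri.connv
      exact ⟨r, hr, fun x hx => hconnN hτv (h x hx)⟩
    · exact hBconn i
  · rintro (_ | _ | i) (_ | _ | j) hij
    · exact absurd rfl hij
    · exact huv
    · exact hfirst j
    · exact hswap huv
    · exact absurd rfl hij
    · exact hlast j
    · exact hswap (hfirst i)
    · exact hswap (hlast i)
    · exact hBodd i j fun h => hij (by rw [h])

end Pot

/-- Three paths and further odd cycles, none of which can be improved, give an odd
`K₅` minor. -/
theorem Config.hasOddK5 [Fintype V] [DecidableEq V] {F : Finset E} {e : E}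
    {T : Finset (E × Bool)} {n : ℕ} {C : Fin n → Finset E} (H : Γ.Config F e T C)
    {P : Fin 3 → Finset (E × Bool)}
    (hT : T = Finset.univ.biUnion P) (hP : ∀ i, IsDipath Γ.tl Γ.hd (Γ.tgt e) (Γ.src e) (P i))
    (hne : Γ.src e ≠ Γ.tgt e)
    (hdisj : ∀ i j, i ≠ j → Disjoint ((P i).image Prod.fst) ((P j).image Prod.fst))
    (hodd : ∀ i, Γ.OddCycle (insert e ((P i).image Prod.fst)))
    (hmate : ∀ J ⊆ F, e ∈ J → Γ.OddCycle J → ∃ U, (Γ.hits (F \ J) U).card ≤ n)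
    (hcost : ∀ U, n + 3 ≤ (Γ.hits F U).card) : Γ.HasOddK5 := by
  obtain ⟨Nu, Nv, Z, L, S, I, tri⟩ := H.exists_tripod hT hP hne hdisj hodd hmate hcost
  choose U h1 h2 h3 using fun i => (tri.good i).normalize (Γ.src e)
  exact Pot.hasOddK5 ⟨H, tri, h1, h2, h3⟩

end SignedGraph

end OddPacking

namespace OddPacking

/-! ### Packings that use parallel edges -/

namespace SignedGraph

variable {V E : Type*} {Γ : SignedGraph V E}

lemma OddCycle.sum_bd {C : Finset E} (h : Γ.OddCycle C) (U : V → ZMod 2) :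
    ∑ f ∈ C, (U (Γ.src f) + U (Γ.tgt f)) = 0 := by
  have h1 := h U
  have h2 := h 0
  have h3 : ∑ f ∈ C, Γ.hit U f = ∑ f ∈ C, Γ.hit 0 f + ∑ f ∈ C, (U (Γ.src f) + U (Γ.tgt f)) := by
    rw [← Finset.sum_add_distrib]
    exact Finset.sum_congr rfl fun f _ => by simp [hit, add_assoc]
  rw [h1, h2] at h3
  simpa using h3

variable (Γ) in
/-- `f` and `g` have the same ends and the same sign. -/
def Parallel (f g : E) : Prop := Γ.src f = Γ.src g ∧ Γ.tgt f = Γ.tgt g ∧ Γ.sg f = Γ.sg g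

lemma Parallel.symm {f g : E} (h : Γ.Parallel f g) : Γ.Parallel g f :=
  ⟨h.1.symm, h.2.1.symm, h.2.2.symm⟩

lemma Parallel.trans {f g g' : E} (h : Γ.Parallel f g) (h' : Γ.Parallel g g') :
    Γ.Parallel f g' :=
  ⟨h.1.trans h'.1, h.2.1.trans h'.2.1, h.2.2.trans h'.2.2⟩

lemma Parallel.hit {f g : E} (h : Γ.Parallel f g) (U : V → ZMod 2) : Γ.hit U f = Γ.hit U g := by
  rw [SignedGraph.hit, SignedGraph.hit, h.1, h.2.1, h.2.2]

variable [DecidableEq E]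

/-- A cycle through `x` contains a path between the ends of `x` that avoids `x`. -/
lemma OddCycle.exists_isDipath {C : Finset E} (h : Γ.OddCycle C) {x : E} (hx : x ∈ C) :
    ∃ Q : Finset (E × Bool), IsDipath Γ.tl Γ.hd (Γ.tgt x) (Γ.src x) Q ∧
      Q.image Prod.fst ⊆ C.erase x := by
  classical
  set X : Finset (E × Bool) := C.erase x ×ˢ Finset.univ with hX
  have hfst : ∀ Q ⊆ X, Q.image Prod.fst ⊆ C.erase x := by
    intro Q hQ f hf
    obtain ⟨a, ha, rfl⟩ := Finset.mem_image.1 hf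
    exact (Finset.mem_product.1 (hQ ha)).1
  by_cases hr : Reach Γ.tl Γ.hd X (Γ.src x) (Γ.tgt x)
  · obtain ⟨Q, hQ, hp⟩ := OddPacking.exists_isDipath hr
    exact ⟨Q, hp, hfst Q hQ⟩
  exfalso
  -- If the ends of `x` were separated in `C - x`, then `x` would be the only edge of the cycle
  -- across the set reached from `Γ.src x`, but a cycle meets every cut evenly.
  have h1 := h.sum_bd fun y => if Reach Γ.tl Γ.hd X (Γ.src x) y then 1 else 0
  rw [← Finset.insert_erase hx, Finset.sum_insert (Finset.notMem_erase x C),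
    if_pos Relation.ReflTransGen.refl, if_neg hr, Finset.sum_eq_zero] at h1
  · simp at h1
  · intro f hf
    have h2 : Reach Γ.tl Γ.hd X (Γ.src x) (Γ.src f) ↔ Reach Γ.tl Γ.hd X (Γ.src x) (Γ.tgt f) :=
      ⟨fun h => h.tail ⟨(f, false), by simp [hX, Finset.mem_erase.1 hf], rfl, rfl⟩,
        fun h => h.tail ⟨(f, true), by simp [hX, Finset.mem_erase.1 hf], rfl, rfl⟩⟩
    simp only [h2]
    exact Pot.zmod_two_add_self _

lemma Packs.swap {G : Finset E} {a b : E} {k : ℕ} (hab : Γ.Parallel a b) (ha : a ∉ G)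
    (hb : b ∉ G) (h : Γ.Packs (insert a G) k) : Γ.Packs (insert b G) k := by
  have hhit : ∀ U f, Γ.hit U (Equiv.swap a b f) = Γ.hit U f := by
    intro U f
    by_cases h1 : f = a
    · rw [h1, Equiv.swap_apply_left, hab.symm.hit]
    by_cases h2 : f = b
    · rw [h2, Equiv.swap_apply_right, hab.hit]
    · rw [Equiv.swap_apply_of_ne_of_ne h1 h2]
  obtain ⟨C, h1, h2, h3⟩ := h
  refine ⟨fun i => (C i).map (Equiv.swap a b).toEmbedding, fun i f hf => ?_, fun i U => ?_,
    fun i j hij => ?_⟩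
  · obtain ⟨g, hg, rfl⟩ := Finset.mem_map.1 hf
    rcases Finset.mem_insert.1 (h1 i hg) with rfl | hgG
    · simp
    · have hga : g ≠ a := fun h => ha (h ▸ hgG)
      have hgb : g ≠ b := fun h => hb (h ▸ hgG)
      simp [Equiv.swap_apply_of_ne_of_ne hga hgb, hgG]
  · rw [Finset.sum_map]
    rw [← h2 i U]
    exact Finset.sum_congr rfl fun f _ => hhit U f
  · rw [Finset.disjoint_map]
    exact h3 i j hij

/-- Replace one cycle of a packing. -/
lemma packs_update {F' : Finset E} {k : ℕ} {C : Fin k → Finset E}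
    (hodd : ∀ i, Γ.OddCycle (C i)) (hdisj : ∀ i j, i ≠ j → Disjoint (C i) (C j)) {i : Fin k}
    {D : Finset E} (hD : Γ.OddCycle D) (hDF : D ⊆ F') (hCF : ∀ j, j ≠ i → C j ⊆ F')
    (hDC : ∀ j, j ≠ i → Disjoint D (C j)) : Γ.Packs F' k := by
  refine ⟨Function.update C i D, fun j => ?_, fun j => ?_, fun j l hjl => ?_⟩
  · by_cases hj : j = i
    · subst hj; rwa [Function.update_self]
    · rw [Function.update_of_ne hj]; exact hCF j hj
  · by_cases hj : j = i
    · subst hj; rwa [Function.update_self]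
    · rw [Function.update_of_ne hj]; exact hodd j
  · by_cases hj : j = i
    · subst hj
      rw [Function.update_self, Function.update_of_ne hjl.symm]
      exact hDC l hjl.symm
    · rw [Function.update_of_ne hj]
      by_cases hl : l = i
      · subst hl
        rw [Function.update_self]
        exact (hDC j hj).symm
      · rw [Function.update_of_ne hl]
        exact hdisj j l hjl

lemma sum_erase_pair {C : Finset E} {a b : E} (ha : a ∈ C) (hb : b ∈ C) (hab : a ≠ b)
    (hp : Γ.Parallel a b) (U : V → ZMod 2) :
    ∑ f ∈ (C.erase a).erase b, Γ.hit U f = ∑ f ∈ C, Γ.hit U f := by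
  rw [← Finset.add_sum_erase C _ ha, ← Finset.add_sum_erase (C.erase a) _
    (Finset.mem_erase.2 ⟨hab.symm, hb⟩), hp.hit, ← add_assoc, Pot.zmod_two_add_self, zero_add]

/-- A packing uses each of the parallel edges `a`, `b`, `c` if it cannot do with one of them. -/
lemma exists_mem_of_not_packs {G : Finset E} {a b c : E} {k : ℕ} (hab : a ≠ b)
    (hp : Γ.Parallel a b) (hn : ¬ Γ.Packs (insert c G) k)
    (hsum : ∀ U, ∑ f ∈ insert a (insert b (insert c G)), Γ.hit U f = k)
    {C : Fin k → Finset E} (hC : ∀ i, C i ⊆ insert a (insert b (insert c G)))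
    (hodd : ∀ i, Γ.OddCycle (C i)) (hdisj : ∀ i j, i ≠ j → Disjoint (C i) (C j)) :
    ∃ i, a ∈ C i := by
  by_contra hcon
  push Not at hcon
  have hsub : ∀ X ⊆ insert a (insert b (insert c G)), a ∉ X → b ∉ X → X ⊆ insert c G := by
    intro X hX ha hb f hf
    have := hX hf
    rw [Finset.mem_insert, Finset.mem_insert] at this
    rcases this with rfl | rfl | h
    · exact absurd hf ha
    · exact absurd hf hb
    · exact h
  by_cases hb : ∃ i, b ∈ C i
  swap
  · push Not at hb
    exact hn ⟨C, fun i => hsub _ (hC i) (hcon i) (hb i), hodd, hdisj⟩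
  obtain ⟨i, hbi⟩ := hb
  set B := Finset.univ.biUnion C with hB
  set R := insert a (insert b (insert c G)) \ B with hR
  have hBsub : B ⊆ insert a (insert b (insert c G)) := Finset.biUnion_subset.2 fun j _ => hC j
  have hCB : ∀ j, C j ⊆ B := fun j => Finset.subset_biUnion_of_mem C (Finset.mem_univ j)
  -- The total is `k` and the `k` odd cycles account for all of it modulo 2, so the leftover `R` is
  -- an even cycle. Adding `R` to the cycle through `b` and cancelling the parallel pair `a`, `b`
  -- avoids both.
  have hRsum : ∀ U, ∑ f ∈ R, Γ.hit U f = 0 := by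
    intro U
    have h1 := hsum U
    rw [← Finset.sum_sdiff hBsub] at h1
    have h2 : ∑ f ∈ B, Γ.hit U f = k := by
      rw [hB, Finset.sum_biUnion fun i _ j _ hij => hdisj i j hij,
        Finset.sum_congr rfl fun j _ => hodd j U]
      simp
    rw [h2] at h1
    simpa using h1
  have hRC : ∀ j, Disjoint R (C j) := fun j =>
    Finset.disjoint_of_subset_right (hCB j) Finset.sdiff_disjoint
  have haR : a ∈ R := by
    rw [hR, Finset.mem_sdiff]
    refine ⟨Finset.mem_insert_self _ _, fun h => ?_⟩
    obtain ⟨j, -, hj⟩ := Finset.mem_biUnion.1 h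
    exact hcon j hj
  have hbC : ∀ j, j ≠ i → b ∉ C j := fun j hj h =>
    Finset.disjoint_left.1 (hdisj j i hj) h hbi
  have hDsub : ((R ∪ C i).erase a).erase b ⊆ R ∪ C i :=
    (Finset.erase_subset _ _).trans (Finset.erase_subset _ _)
  refine hn (packs_update hodd hdisj (i := i) (D := ((R ∪ C i).erase a).erase b) ?_ ?_ ?_ ?_)
  · intro U
    rw [sum_erase_pair (by simp [haR]) (by simp [hbi]) hab hp, Finset.sum_union (hRC i), hRsum,
      hodd i U, zero_add]
  · refine hsub _ (hDsub.trans (Finset.union_subset Finset.sdiff_subset (hC i))) ?_ ?_ <;> simp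
  · exact fun j hj => hsub _ (hC j) (hcon j) (hbC j hj)
  · exact fun j hj => Finset.disjoint_of_subset_left hDsub
      (Finset.disjoint_union_left.2 ⟨hRC j, hdisj i j hj.symm⟩)

/-- A packing uses parallel edges in different cycles if it cannot do without them. -/
lemma ne_of_not_packs {G : Finset E} {a b c : E} {k : ℕ} (hab : a ≠ b)
    (hp : Γ.Parallel a b) (hn : ¬ Γ.Packs (insert c G) k)
    {C : Fin k → Finset E} (hC : ∀ i, C i ⊆ insert a (insert b (insert c G)))
    (hodd : ∀ i, Γ.OddCycle (C i)) (hdisj : ∀ i j, i ≠ j → Disjoint (C i) (C j))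
    {i j : Fin k} (hi : a ∈ C i) (hj : b ∈ C j) : i ≠ j := by
  rintro rfl
  have hsub : ∀ X ⊆ insert a (insert b (insert c G)), a ∉ X → b ∉ X → X ⊆ insert c G := by
    intro X hX ha hb f hf
    have := hX hf
    rw [Finset.mem_insert, Finset.mem_insert] at this
    rcases this with rfl | rfl | h
    · exact absurd hf ha
    · exact absurd hf hb
    · exact h
  have hDsub : ((C i).erase a).erase b ⊆ C i :=
    (Finset.erase_subset _ _).trans (Finset.erase_subset _ _)
  refine hn (packs_update hodd hdisj (i := i) (D := ((C i).erase a).erase b) ?_ ?_ ?_ ?_)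
  · intro U
    rw [sum_erase_pair hi hj hab hp, hodd i U]
  · exact hsub _ (hDsub.trans (hC i)) (by simp) (by simp)
  · exact fun j hj' => hsub _ (hC j) (fun h => Finset.disjoint_left.1 (hdisj j i hj') h hi)
      (fun h => Finset.disjoint_left.1 (hdisj j i hj') h hj)
  · exact fun j hj' => Finset.disjoint_of_subset_left hDsub (hdisj i j hj'.symm)

/-- Two extra copies of `e` are not needed. -/
theorem packs_of_packs_insert [Fintype V] {F : Finset E} {k : ℕ} {e e' e'' : E}
    (heF : e ∈ F) (he' : e' ∉ F) (he'' : e'' ∉ F) (hne : e' ≠ e'') (hp' : Γ.Parallel e' e)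
    (hp'' : Γ.Parallel e'' e) (hloop : Γ.src e ≠ Γ.tgt e) (hK5 : ¬ Γ.HasOddK5)
    (hsum : ∀ U, ∑ f ∈ F, Γ.hit U f = k) (hcost : ∀ U, k ≤ (Γ.hits F U).card)
    (ih : ∀ k' < k, ∀ F' : Finset E, (∀ U, ∑ f ∈ F', Γ.hit U f = k') →
      (∀ U, k' ≤ (Γ.hits F' U).card) → Γ.Packs F' k')
    (hpack : Γ.Packs (insert e' (insert e'' F)) k) : Γ.Packs F k := by
  classical
  by_contra hn
  obtain ⟨G, heG, rfl⟩ : ∃ G, e ∉ G ∧ insert e G = F := ⟨F.erase e, by simp, by simp [heF]⟩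
  have he'e : e' ≠ e := fun h => he' (by simp [h])
  have he''e : e'' ≠ e := fun h => he'' (by simp [h])
  have he'G : e' ∉ G := fun h => he' (by simp [h])
  have he''G : e'' ∉ G := fun h => he'' (by simp [h])
  -- The three copies are interchangeable, so keeping any single one of them is not enough. Hence
  -- every packing must use all three, in three different cycles.
  have hn' : ¬ Γ.Packs (insert e' G) k := fun h => hn (h.swap hp' he'G heG)
  have hn'' : ¬ Γ.Packs (insert e'' G) k := fun h => hn (h.swap hp'' he''G heG)
  set x : Fin 3 → E := ![e', e'', e] with hx
  have hxpar : ∀ i, Γ.Parallel (x i) e := by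
    intro i
    fin_cases i
    · exact hp'
    · exact hp''
    · exact ⟨rfl, rfl, rfl⟩
  have hxne : ∀ i j, i ≠ j → x i ≠ x j := by
    intro i j hij
    fin_cases i <;> fin_cases j <;> simp [hx, hne, hne.symm, he'e, he'e.symm, he''e, he''e.symm]
      at hij ⊢
  have hxG : ∀ i, x i ∉ G := by
    intro i
    fin_cases i
    · exact he'G
    · exact he''G
    · exact heG
  have hxn : ∀ i, ¬ Γ.Packs (insert (x i) G) k := by
    intro i
    fin_cases i
    · exact hn'
    · exact hn''
    · exact hn
  set Fp := insert e' (insert e'' (insert e G)) with hFp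
  have hFpx : ∀ i, Fp = insert (x i) (insert (x (i + 1)) (insert (x (i + 2)) G)) := by
    intro i
    fin_cases i
    · rfl
    · ext f; simp [hFp, hx]; tauto
    · ext f; simp [hFp, hx]; tauto
  have hsump : ∀ U, ∑ f ∈ Fp, Γ.hit U f = k := by
    intro U
    have h1 : e'' ∉ insert e G := he''
    rw [hFp, Finset.sum_insert (by simp [hne, he'e, he'G]), Finset.sum_insert h1, hsum U, hp'.hit,
      hp''.hit, ← add_assoc, Pot.zmod_two_add_self, zero_add]
  have hi1 : ∀ i : Fin 3, i ≠ i + 1 := by decide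
  have used : ∀ C : Fin k → Finset E, (∀ i, C i ⊆ Fp) → (∀ i, Γ.OddCycle (C i)) →
      (∀ i j, i ≠ j → Disjoint (C i) (C j)) → ∀ i, ∃ j, x i ∈ C j := by
    intro C hC hodd hdisj i
    refine exists_mem_of_not_packs (hxne i (i + 1) (hi1 i))
      ((hxpar i).trans (hxpar (i + 1)).symm) (hxn (i + 2)) ?_ (fun j => ?_) hodd hdisj
    · rw [← hFpx]; exact hsump
    · rw [← hFpx]; exact hC j
  obtain ⟨C, hC, hodd, hdisj⟩ := hpack
  choose ι hι using used C hC hodd hdisj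
  have hιne1 : ∀ i, ι i ≠ ι (i + 1) := by
    intro i
    refine ne_of_not_packs (hxne i (i + 1) (hi1 i)) ((hxpar i).trans (hxpar (i + 1)).symm)
      (hxn (i + 2)) (fun j => ?_) hodd hdisj (hι i) (hι (i + 1))
    rw [← hFpx]; exact hC j
  have hιne : ∀ i j, i ≠ j → ι i ≠ ι j := by
    intro i j hij
    have h1 : j = i + 1 ∨ i = j + 1 := by
      revert i j; decide
    rcases h1 with rfl | rfl
    · exact hιne1 i
    · exact (hιne1 j).symm
  -- paths through the three cycles
  choose P hP hPC using fun i => (hodd (ι i)).exists_isDipath (hι i)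
  have hxC : ∀ i j, j ≠ ι i → x i ∉ C j := fun i j hj h =>
    Finset.disjoint_left.1 (hdisj j (ι i) hj) h (hι i)
  have hPC' : ∀ i, (P i).image Prod.fst ⊆ C (ι i) := fun i =>
    (hPC i).trans (Finset.erase_subset _ _)
  have hPx : ∀ i j, x j ∉ (P i).image Prod.fst := by
    intro i j h
    by_cases hij : i = j
    · subst hij
      exact Finset.notMem_erase _ _ (hPC i h)
    · exact hxC j (ι i) (hιne i j hij) (hPC' i h)
  have hP' : ∀ i, IsDipath Γ.tl Γ.hd (Γ.tgt e) (Γ.src e) (P i) := by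
    intro i
    rw [← (hxpar i).1, ← (hxpar i).2.1]
    exact hP i
  have he2 : ∀ i, e ∉ (P i).image Prod.fst := fun i => hPx i 2
  have hPodd : ∀ i, Γ.OddCycle (insert e ((P i).image Prod.fst)) := by
    intro i
    by_contra hcon
    have hzero : ∀ U, ∑ f ∈ insert (x i) ((P i).image Prod.fst), Γ.hit U f = 0 := by
      intro U
      rw [← zmod_two_ne]
      intro h1
      refine hcon ((hP' i).isJoin.oddCycle (he2 i) (U := U) ?_)
      rw [Finset.sum_insert (hPx i i), (hxpar i).hit] at h1
      rwa [Finset.sum_insert (he2 i)]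
    have hsub : insert (x i) ((P i).image Prod.fst) ⊆ C (ι i) :=
      Finset.insert_subset (hι i) (hPC' i)
    -- If the path closed by `x i` were even, removing it from its odd cycle would give a packing
    -- that does not use `x i`.
    obtain ⟨j, hj⟩ := used (Function.update C (ι i) (C (ι i) \ insert (x i) ((P i).image Prod.fst)))
      (fun j => by
        by_cases hj : j = ι i
        · subst hj; rw [Function.update_self]; exact Finset.sdiff_subset.trans (hC _)
        · rw [Function.update_of_ne hj]; exact hC j)
      (fun j => by
        by_cases hj : j = ι i
        · subst hj
          rw [Function.update_self]
          intro U
          have h1 := hodd (ι i) U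
          rw [← Finset.sum_sdiff hsub, hzero, add_zero] at h1
          exact h1
        · rw [Function.update_of_ne hj]; exact hodd j)
      (fun j l hjl => by
        by_cases hj : j = ι i
        · subst hj
          rw [Function.update_self, Function.update_of_ne hjl.symm]
          exact Finset.disjoint_of_subset_left Finset.sdiff_subset (hdisj _ l hjl)
        · rw [Function.update_of_ne hj]
          by_cases hl : l = ι i
          · subst hl
            rw [Function.update_self]
            exact Finset.disjoint_of_subset_right Finset.sdiff_subset (hdisj j _ hjl)
          · rw [Function.update_of_ne hl]; exact hdisj j l hjl) i
    by_cases hji : j = ι i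
    · subst hji
      rw [Function.update_self] at hj
      simp at hj
    · rw [Function.update_of_ne hji] at hj
      exact hxC i j hji hj
  -- the remaining cycles
  have hcard : (Finset.univ \ Finset.univ.image ι : Finset (Fin k)).card = k - 3 := by
    rw [Finset.card_sdiff_of_subset (Finset.subset_univ _),
      Finset.card_image_of_injective _ fun i j h => by_contra fun h' => hιne i j h' h]
    simp
  have hk : 3 ≤ k := by
    have := Finset.card_le_univ (Finset.univ.image ι)
    rw [Finset.card_image_of_injective _ fun i j h => by_contra fun h' => hιne i j h' h] at this
    simpa using this
  obtain ⟨σ⟩ : Nonempty (Fin (k - 3) ≃ (Finset.univ \ Finset.univ.image ι : Finset (Fin k))) :=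
    ⟨(Finset.equivFinOfCardEq hcard).symm⟩
  have hσ : ∀ j i, (σ j : Fin k) ≠ ι i := by
    intro j i h
    have := (σ j).2
    rw [h] at this
    simp at this
  have hFsub : ∀ X ⊆ Fp, (∀ i, i ≠ 2 → x i ∉ X) → X ⊆ insert e G := by
    intro X hX hxX f hf
    have := hX hf
    rw [hFp, Finset.mem_insert, Finset.mem_insert] at this
    rcases this with rfl | rfl | h
    · exact absurd hf (hxX 0 (by decide))
    · exact absurd hf (hxX 1 (by decide))
    · exact h
  have hdisjP : ∀ i j, i ≠ j → Disjoint ((P i).image Prod.fst) ((P j).image Prod.fst) :=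
    fun i j hij => (hdisj _ _ (hιne i j hij)).mono (hPC' i) (hPC' j)
  have hTmem : ∀ f, f ∈ (Finset.univ.biUnion P).image Prod.fst →
      ∃ i, f ∈ (P i).image Prod.fst := by
    intro f hf
    obtain ⟨a, ha, rfl⟩ := Finset.mem_image.1 hf
    obtain ⟨i, -, hi⟩ := Finset.mem_biUnion.1 ha
    exact ⟨i, Finset.mem_image_of_mem _ hi⟩
  have hcfg : Γ.Config (insert e G) e (Finset.univ.biUnion P) (fun j => C (σ j)) := by
    constructor
    · simp
    · intro f hf
      obtain ⟨i, hi⟩ := hTmem f hf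
      exact hFsub _ ((hPC' i).trans (hC _)) (fun j _ => hPx i j) hi
    · intro h
      obtain ⟨i, hi⟩ := hTmem e h
      exact he2 i hi
    · intro a ha b hb hab
      obtain ⟨i, -, hi⟩ := Finset.mem_biUnion.1 (Finset.mem_coe.1 ha)
      obtain ⟨j, -, hj⟩ := Finset.mem_biUnion.1 (Finset.mem_coe.1 hb)
      by_cases hij : i = j
      · subst hij
        exact (hP i).injOn_fst hi hj hab
      · exfalso
        refine Finset.disjoint_left.1 (hdisjP i j hij) (Finset.mem_image_of_mem _ hi) ?_
        rw [hab]
        exact Finset.mem_image_of_mem _ hj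
    · exact fun j => hFsub _ (hC _) fun i _ => hxC i _ (hσ j i)
    · exact fun j => hxC 2 _ (hσ j 2)
    · refine fun j => Finset.disjoint_left.2 fun f hf hf' => ?_
      obtain ⟨i, hi⟩ := hTmem f hf'
      exact Finset.disjoint_left.1 (hdisj _ _ (hσ j i)) hf (hPC' i hi)
    · exact fun i j hij => hdisj _ _ fun h => hij (σ.injective (Subtype.ext h))
    · exact fun j => hodd _
  refine hK5 (hcfg.hasOddK5 rfl hP' hloop hdisjP hPodd ?_ ?_)
  · intro J hJ heJ hJo
    by_contra hcon
    push Not at hcon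
    have hsumJ : ∀ U, ∑ f ∈ insert e G \ J, Γ.hit U f = ((k - 1 : ℕ) : ZMod 2) := by
      intro U
      have h1 := hsum U
      rw [← Finset.sum_sdiff hJ, hJo U] at h1
      rw [Nat.cast_sub (by omega), ← h1]
      simp
    -- More than `k - 3` hits of parity `k - 1` means at least `k - 1` hits, so induction packs the
    -- rest and `J` completes a packing of size `k`.
    have hcostJ : ∀ U, k - 1 ≤ (Γ.hits (insert e G \ J) U).card := by
      intro U
      have h1 := hcon U
      have h2 := hsumJ U
      rw [sum_hit_eq_card, ZMod.natCast_eq_natCast_iff'] at h2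
      omega
    obtain ⟨D, hD1, hD2, hD3⟩ := ih (k - 1) (by omega) _ hsumJ hcostJ
    refine hn ?_
    obtain ⟨m, rfl⟩ : ∃ m, k = m + 1 := ⟨k - 1, by omega⟩
    refine ⟨Fin.cons J D, ?_, ?_, ?_⟩
    · intro i
      refine Fin.cases ?_ (fun i => ?_) i
      · exact hJ
      · exact (hD1 i).trans Finset.sdiff_subset
    · intro i
      refine Fin.cases ?_ (fun i => ?_) i
      · exact hJo
      · exact hD2 i
    · have hJD : ∀ i, Disjoint J (D i) := fun i =>
        Finset.disjoint_of_subset_right (hD1 i) Finset.disjoint_sdiff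
      intro i j
      refine Fin.cases ?_ (fun i => ?_) i <;> refine Fin.cases ?_ (fun j => ?_) j
      · exact fun h => absurd rfl h
      · exact fun _ => hJD j
      · exact fun _ => (hJD i).symm
      · exact fun h => hD3 i j fun h' => h (by rw [h'])
  · intro U
    have := hcost U
    omega

end SignedGraph

end OddPacking

namespace OddPacking

/-! ### Contraction and the packing theorem for signed graphs -/

namespace SignedGraph

universe u w

variable {V : Type u} {E : Type w}

/-- Every edge is replaced by infinitely many parallel copies. -/
def copies (Γ : SignedGraph V E) : SignedGraph V (E × ℕ) :=
  ⟨fun f => Γ.src f.1, fun f => Γ.tgt f.1, fun f => Γ.sg f.1⟩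

lemma HasOddK5.of_copies {Γ : SignedGraph V E} (h : Γ.copies.HasOddK5) : Γ.HasOddK5 := by
  obtain ⟨s, N, h1, h2, h3⟩ := h
  refine ⟨s, N, h1, fun i => ?_, fun i j hij => ?_⟩
  · obtain ⟨r, hr, hx⟩ := h2 i
    refine ⟨r, hr, fun x hxN => Relation.ReflTransGen.mono ?_ _ _ (hx x hxN)⟩
    rintro p q ⟨hp, hq, f, hf, hj⟩
    exact ⟨hp, hq, f.1, hf, hj⟩
  · obtain ⟨f, hf, hj⟩ := h3 i j hij
    exact ⟨f.1, hf, hj⟩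

section Contract

variable [DecidableEq V]

/-- Identify the ends of `e`. -/
def proj (Γ : SignedGraph V E) (e : E) (h : Γ.src e ≠ Γ.tgt e) (x : V) : {x // x ≠ Γ.tgt e} :=
  if hx : x = Γ.tgt e then ⟨Γ.src e, h⟩ else ⟨x, hx⟩

/-- A switching that makes `e` even. -/
def evenSwitch (Γ : SignedGraph V E) (e : E) (x : V) : ZMod 2 :=
  if x = Γ.tgt e then Γ.sg e else 0

/-- Switch so that `e` is even, and identify its ends. -/
def contract (Γ : SignedGraph V E) (e : E) (h : Γ.src e ≠ Γ.tgt e) :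
    SignedGraph {x // x ≠ Γ.tgt e} E :=
  ⟨fun f => Γ.proj e h (Γ.src f), fun f => Γ.proj e h (Γ.tgt f), Γ.hit (Γ.evenSwitch e)⟩

variable {Γ : SignedGraph V E} {e : E} {h : Γ.src e ≠ Γ.tgt e}

lemma contract_hit (U : {x // x ≠ Γ.tgt e} → ZMod 2) (f : E) :
    (Γ.contract e h).hit U f = Γ.hit (fun x => Γ.evenSwitch e x + U (Γ.proj e h x)) f := by
  simp only [hit, contract]
  ring

lemma proj_src : Γ.proj e h (Γ.src e) = Γ.proj e h (Γ.tgt e) := by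
  simp [proj, h]

lemma proj_eq {x y : V} (hxy : Γ.proj e h x = Γ.proj e h y) :
    x = y ∨ (x = Γ.src e ∧ y = Γ.tgt e) ∨ (x = Γ.tgt e ∧ y = Γ.src e) := by
  unfold proj at hxy
  split_ifs at hxy with h1 h2 h2
  · exact Or.inl (h1.trans h2.symm)
  · exact Or.inr (Or.inr ⟨h1, (congrArg Subtype.val hxy).symm⟩)
  · exact Or.inr (Or.inl ⟨congrArg Subtype.val hxy, h2⟩)
  · exact Or.inl (congrArg Subtype.val hxy)

lemma contract_hit_self (U : {x // x ≠ Γ.tgt e} → ZMod 2) :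
    Γ.hit (fun x => Γ.evenSwitch e x + U (Γ.proj e h x)) e = 0 := by
  simp only [hit, proj_src, evenSwitch, if_neg h, if_true]
  generalize U _ = a
  generalize Γ.sg e = b
  revert a b
  decide

lemma exists_proj (x : {x // x ≠ Γ.tgt e}) : Γ.proj e h x = x := by
  simp [proj, x.2]

/-- Pull the branch sets back along the projection; the two vertices over the contracted one are
joined by `e`, which the pulled-back switching makes even. -/
lemma HasOddK5.of_contract (hK : (Γ.contract e h).HasOddK5) : Γ.HasOddK5 := by
  obtain ⟨s, N, h1, h2, h3⟩ := hK
  set s' : V → ZMod 2 := fun x => Γ.evenSwitch e x + s (Γ.proj e h x) with hs'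
  refine ⟨s', fun i => Γ.proj e h ⁻¹' N i, fun i j hij => (h1 i j hij).preimage _, fun i => ?_,
    fun i j hij => ?_⟩
  · obtain ⟨r, hr, hx⟩ := h2 i
    have fib : ∀ x y, Γ.proj e h x ∈ N i → Γ.proj e h x = Γ.proj e h y →
        Relation.ReflTransGen (Γ.EvenAdj s' (Γ.proj e h ⁻¹' N i)) x y := by
      intro x y hxN hxy
      rcases proj_eq hxy with rfl | ⟨hx, hy⟩ | ⟨hx, hy⟩
      · exact .refl
      · exact .single ⟨hxN, by rwa [Set.mem_preimage, ← hxy], e, contract_hit_self s,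
          Or.inl ⟨hx.symm, hy.symm⟩⟩
      · exact .single ⟨hxN, by rwa [Set.mem_preimage, ← hxy], e, contract_hit_self s,
          Or.inr ⟨hy.symm, hx.symm⟩⟩
    refine ⟨r, by rwa [Set.mem_preimage, exists_proj], ?_⟩
    have key : ∀ q, Relation.ReflTransGen ((Γ.contract e h).EvenAdj s (N i)) r q →
        ∀ y, Γ.proj e h y = q →
          Relation.ReflTransGen (Γ.EvenAdj s' (Γ.proj e h ⁻¹' N i)) r y := by
      intro q hq
      induction hq with
      | refl =>
        intro y hy
        exact fib _ _ (by rwa [exists_proj]) (by rw [exists_proj, hy])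
      | @tail p q _ hpq ih =>
        obtain ⟨hp, hq, f, hf, hj⟩ := hpq
        rw [contract_hit] at hf
        intro y hy
        rcases hj with ⟨rfl, rfl⟩ | ⟨rfl, rfl⟩
        · refine (ih (Γ.src f) rfl).trans (.head (b := Γ.tgt f)
            ⟨hp, hq, f, hf, Or.inl ⟨rfl, rfl⟩⟩ (fib _ _ hq ?_))
          rw [hy]; rfl
        · refine (ih (Γ.tgt f) rfl).trans (.head (b := Γ.src f)
            ⟨hp, hq, f, hf, Or.inr ⟨rfl, rfl⟩⟩ (fib _ _ hq ?_))
          rw [hy]; rfl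
    exact fun x hxN => key _ (hx _ hxN) x rfl
  · obtain ⟨f, hf, p, hp, q, hq, hj⟩ := h3 i j hij
    rw [contract_hit] at hf
    rcases hj with ⟨rfl, rfl⟩ | ⟨rfl, rfl⟩
    · exact ⟨f, hf, Γ.src f, hp, Γ.tgt f, hq, Or.inl ⟨rfl, rfl⟩⟩
    · exact ⟨f, hf, Γ.tgt f, hp, Γ.src f, hq, Or.inr ⟨rfl, rfl⟩⟩

/-- An odd cycle of the contraction becomes one of the graph, possibly after adding `e`. -/
lemma sum_hit_of_contract {C : Finset (E × ℕ)} (hC : (Γ.contract e h).copies.OddCycle C) :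
    ∃ d : ZMod 2, ∀ U, ∑ f ∈ C, Γ.copies.hit U f = 1 + d * Γ.hit U e := by
  have h1 : ∀ U, Γ.hit U e = 0 → ∑ f ∈ C, Γ.copies.hit U f = 1 := by
    intro U hU
    have hU' : U = fun x => Γ.evenSwitch e x +
        (fun y : {x // x ≠ Γ.tgt e} => U y) (Γ.proj e h x) := by
      funext x
      by_cases hx : x = Γ.tgt e
      · simp only [hit] at hU
        simp only [evenSwitch, proj, hx, if_true, dif_pos]
        revert hU
        generalize Γ.sg e = a
        generalize U (Γ.src e) = b
        generalize U (Γ.tgt e) = c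
        revert a b c
        decide
      · simp [evenSwitch, proj, hx]
    rw [← hC fun y => U y]
    refine Finset.sum_congr rfl fun f _ => ?_
    have := contract_hit (Γ := Γ) (h := h) (fun y => U y) f.1
    rw [← hU'] at this
    exact this.symm
  set χ : V → ZMod 2 := fun x => if x = Γ.tgt e then 1 else 0 with hχ
  -- `d` is the boundary of `C` at `Γ.tgt e` modulo 2, and it tells whether `e` must be added. A
  -- switching that hits `e` is compared with its flip at `Γ.tgt e`, which comes from the
  -- contraction.
  refine ⟨∑ f ∈ C, (χ (Γ.src f.1) + χ (Γ.tgt f.1)), fun U => ?_⟩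
  by_cases hU : Γ.hit U e = 0
  · rw [h1 U hU, hU, mul_zero, add_zero]
  · have hU1 : Γ.hit U e = 1 := by
      by_contra h2; exact hU (zmod_two_ne.1 h2)
    have h2 : Γ.hit (fun x => U x + χ x) e = 0 := by
      simp only [hit, hχ, if_neg h, if_true, add_zero] at hU1 ⊢
      rw [← add_assoc, hU1]; decide
    have h3 := h1 _ h2
    rw [hU1, mul_one, ← h3, ← Finset.sum_add_distrib]
    refine Finset.sum_congr rfl fun f _ => ?_
    simp only [hit, copies]
    generalize Γ.sg f.1 = a
    generalize U (Γ.src f.1) = b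
    generalize U (Γ.tgt f.1) = c
    generalize χ (Γ.src f.1) = b'
    generalize χ (Γ.tgt f.1) = c'
    revert a b c b' c'
    decide

end Contract

/-- Switching never changes the sign of a loop, so every odd loop is by itself an odd cycle. -/
lemma packs_of_loops {Γ : SignedGraph V E} {F : Finset E} {k : ℕ}
    (hloop : ∀ f ∈ F, Γ.src f = Γ.tgt f) (hcost : k ≤ (Γ.hits F 0).card) : Γ.Packs F k := by
  obtain ⟨X, hX, hXc⟩ := Finset.exists_subset_card_eq hcost
  have φ := (Finset.equivFinOfCardEq hXc).symm
  refine ⟨fun i => {(φ i : E)}, fun i => ?_, fun i U => ?_, fun i j hij => ?_⟩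
  · exact Finset.singleton_subset_iff.2 (mem_hits.1 (hX (φ i).2)).1
  · obtain ⟨h1, h2⟩ := mem_hits.1 (hX (φ i).2)
    rw [Finset.sum_singleton, ← h2]
    simp [hit, hloop _ h1, add_assoc, Pot.zmod_two_add_self]
  · simp only [Finset.disjoint_singleton]
    exact fun h => hij (φ.injective (Subtype.ext h))

/-- **Packing theorem.** In a signed graph without odd `K₅` minor whose edge multiset `F` satisfies
the parity condition, the minimum size of an odd cycle cover is attained by a packing. -/
theorem packs_of_le_card_hits [DecidableEq E] (m : ℕ) : ∀ (V : Type u) [Fintype V]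
    (Γ : SignedGraph V E), Fintype.card V = m → ¬ Γ.HasOddK5 →
    ∀ (k : ℕ) (F : Finset (E × ℕ)), (∀ U, ∑ f ∈ F, Γ.copies.hit U f = k) →
      (∀ U, k ≤ (Γ.copies.hits F U).card) → Γ.copies.Packs F k := by
  classical
  induction m using Nat.strong_induction_on with
  | _ m ihm =>
  intro V _ Γ hm hK5 k
  induction k using Nat.strong_induction_on with
  | _ k ihk =>
  intro F hsum hcost
  by_cases hloop : ∀ f ∈ F, Γ.copies.src f = Γ.copies.tgt f
  · exact packs_of_loops hloop (hcost 0)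
  push Not at hloop
  obtain ⟨e, heF, hne⟩ := hloop
  have hne' : Γ.src e.1 ≠ Γ.tgt e.1 := hne
  obtain ⟨C, hC, hodd, hdisj⟩ := ihm (m - 1)
    (by have := Fintype.card_pos_iff.2 ⟨Γ.src e.1⟩; omega) {x // x ≠ Γ.tgt e.1}
    (Γ.contract e.1 hne') (by rw [Fintype.card_subtype_compl]; simp [hm])
    (fun h => hK5 h.of_contract) k F
    (fun U => by
      rw [← hsum fun x => Γ.evenSwitch e.1 x + U (Γ.proj e.1 hne' x)]
      exact Finset.sum_congr rfl fun f _ => contract_hit U f.1)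
    (fun U => by
      refine (hcost fun x => Γ.evenSwitch e.1 x + U (Γ.proj e.1 hne' x)).trans (le_of_eq ?_)
      congr 1
      refine Finset.filter_congr fun f _ => ?_
      rw [show (Γ.contract e.1 hne').copies.hit U f = _ from contract_hit U f.1]
      rfl)
  -- fresh copies of `e`
  obtain ⟨N, hN⟩ : ∃ N, ∀ i, N ≤ i → (e.1, i) ∉ F := by
    refine ⟨F.sup Prod.snd + 1, fun i hi h => ?_⟩
    have := Finset.le_sup (f := Prod.snd) h
    simp only at this
    omega
  set A : ℕ → Finset (E × ℕ) := fun t => F ∪ (Finset.range t).image (fun i => (e.1, N + i)) with hA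
  have hAsucc : ∀ t, A (t + 1) = insert (e.1, N + t) (A t) := by
    intro t
    ext f
    simp only [hA, Finset.range_add_one, Finset.image_insert, Finset.mem_union, Finset.mem_insert]
    tauto
  have hAmem : ∀ t i, t ≤ i → (e.1, N + i) ∉ A t := by
    intro t i hti h
    simp only [hA, Finset.mem_union, Finset.mem_image, Finset.mem_range, Prod.mk.injEq,
      true_and] at h
    rcases h with h | ⟨j, hj, h⟩
    · exact hN _ (by omega) h
    · omega
  have hFA : ∀ t, F ⊆ A t := fun t => Finset.subset_union_left
  have hpar : ∀ i, Γ.copies.Parallel (e.1, i) e := fun i => ⟨rfl, rfl, rfl⟩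
  -- Parallel copies contribute equally, so adding them in pairs preserves the parity condition.
  have hAsum : ∀ t U, ∑ f ∈ A (2 * t), Γ.copies.hit U f = k := by
    intro t U
    induction t with
    | zero => simpa [hA] using hsum U
    | succ t ih =>
      have h1 : (e.1, N + (2 * t + 1)) ∉ insert (e.1, N + 2 * t) (A (2 * t)) := by
        rw [← hAsucc]
        exact hAmem _ _ le_rfl
      rw [show 2 * (t + 1) = 2 * t + 1 + 1 by ring, hAsucc, hAsucc, Finset.sum_insert h1,
        Finset.sum_insert (hAmem _ _ le_rfl), ih, (hpar _).hit, (hpar (N + 2 * t)).hit, ← add_assoc,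
        Pot.zmod_two_add_self, zero_add]
  have hAcost : ∀ t U, k ≤ (Γ.copies.hits (A t) U).card := fun t U =>
    (hcost U).trans (Finset.card_le_card (Finset.filter_subset_filter _ (hFA t)))
  have hpackA : ∃ t, Γ.copies.Packs (A (2 * t)) k := by
    -- At most one copy of `e` per lifted cycle is needed, and `2 * k` copies are available.
    refine ⟨k, ?_⟩
    choose d hd using fun i => sum_hit_of_contract (hodd i)
    refine ⟨fun i => if d i = 0 then C i else insert (e.1, N + i.1) (C i), fun i => ?_, fun i U => ?_,
      fun i j hij => ?_⟩
    · have h1 : (e.1, N + i.1) ∈ A (2 * k) := by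
        simp only [hA, Finset.mem_union, Finset.mem_image, Finset.mem_range]
        exact Or.inr ⟨i, by omega, rfl⟩
      dsimp only
      split_ifs
      · exact (hC i).trans (hFA _)
      · exact Finset.insert_subset h1 ((hC i).trans (hFA _))
    · dsimp only
      split_ifs with h1
      · rw [hd, h1, zero_mul, add_zero]
      · have h2 : d i = 1 := by
          by_contra h3; exact h1 (zmod_two_ne.1 h3)
        rw [Finset.sum_insert fun h => hN _ (by omega) (hC i h), hd, h2, one_mul, (hpar _).hit]
        rw [add_left_comm]
        rw [show Γ.hit U e.1 = Γ.copies.hit U e from rfl, Pot.zmod_two_add_self, add_zero]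
    · have h1 : ∀ i j : Fin k, (e.1, N + i.1) ∉ C j := fun i j h => hN _ (by omega) (hC j h)
      have h2 : (e.1, N + i.1) ≠ (e.1, N + j.1) := by
        intro h
        rw [Prod.mk.injEq] at h
        exact hij (Fin.ext (by omega))
      have h3 := hdisj i j hij
      dsimp only
      split_ifs
      · exact h3
      · exact Finset.disjoint_insert_right.2 ⟨h1 j i, h3⟩
      · exact Finset.disjoint_insert_left.2 ⟨h1 i j, h3⟩
      · rw [Finset.disjoint_insert_left, Finset.mem_insert, not_or, Finset.disjoint_insert_right]
        exact ⟨⟨h2, h1 i j⟩, h1 j i, h3⟩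
  have hlast : ∀ t, Γ.copies.Packs (A (2 * t)) k → Γ.copies.Packs F k := by
    intro t
    induction t with
    | zero => intro h; simpa [hA] using h
    | succ t ih =>
      intro h
      refine ih ?_
      rw [show 2 * (t + 1) = 2 * t + 1 + 1 by ring, hAsucc, hAsucc] at h
      refine packs_of_packs_insert (hFA _ heF) (hAmem _ _ (by omega)) (hAmem _ _ le_rfl) ?_
        (hpar _) (hpar _) hne (fun h => hK5 h.of_copies) (hAsum t) (hAcost _) ihk h
      intro h
      rw [Prod.mk.injEq] at h
      omega
  obtain ⟨t, ht⟩ := hpackA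
  exact hlast t ht

end SignedGraph

end OddPacking

namespace OddPacking

/-! ### Odd cycles and odd circuits of a graph -/

lemma IsDipath.outdeg_le {V A : Type*} {tl hd : A → V} [DecidableEq A] [DecidableEq V] {u v : V}
    {Q : Finset A} (h : IsDipath tl hd v u Q) (x : V) : outdeg tl Q x ≤ 1 := by
  induction h with
  | nil => simp [outdeg]
  | cons a Q h ha hQ ih =>
    rw [outdeg_insert fun h1 => hQ a h1 rfl]
    split_ifs with hx
    · rw [outdeg_eq_zero.2 fun b hb => hx ▸ hQ b hb]
    · omega

lemma IsDipath.reach_of_mem {V A : Type*} {tl hd : A → V} [DecidableEq A] {u v : V}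
    {Q : Finset A} (h : IsDipath tl hd v u Q) {a : A} (ha : a ∈ Q) :
    Reach tl hd Q (tl a) v ∧ Reach tl hd Q (hd a) v := by
  have h1 : ∀ b ∈ Q, Reach tl hd Q (tl b) v := fun b hb => by
    obtain ⟨Q', hQ', hp⟩ := h.suffix hb
    exact reach_mono hQ' hp.reach
  refine ⟨h1 a ha, ?_⟩
  rcases h.hd_mem ha with h2 | ⟨c, hc, h2⟩
  · rw [h2]
  · rw [← h2]; exact h1 c hc

namespace SignedGraph

variable {V E : Type*} {Γ : SignedGraph V E} [DecidableEq E]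

/-- Every odd cycle contains one that consists of an edge and a path joining its ends. -/
lemma OddCycle.exists_circuit {C : Finset E} (h : Γ.OddCycle C) :
    ∃ x, ∃ Q : Finset (E × Bool), IsDipath Γ.tl Γ.hd (Γ.tgt x) (Γ.src x) Q ∧
      x ∉ Q.image Prod.fst ∧ insert x (Q.image Prod.fst) ⊆ C ∧
      Γ.OddCycle (insert x (Q.image Prod.fst)) := by
  induction hn : C.card using Nat.strong_induction_on generalizing C with
  | _ n ih =>
  obtain ⟨x, hx⟩ := Finset.card_pos.1 (h.hits_nonempty 0)
  have hxC := (mem_hits.1 hx).1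
  obtain ⟨Q, hQ, hQC⟩ := h.exists_isDipath hxC
  have hxQ : x ∉ Q.image Prod.fst := fun h1 => Finset.notMem_erase _ _ (hQC h1)
  have hsub : insert x (Q.image Prod.fst) ⊆ C :=
    Finset.insert_subset hxC (hQC.trans (Finset.erase_subset _ _))
  by_cases hodd : Γ.OddCycle (insert x (Q.image Prod.fst))
  · exact ⟨x, Q, hQ, hxQ, hsub, hodd⟩
  have hzero : ∀ U, ∑ f ∈ insert x (Q.image Prod.fst), Γ.hit U f = 0 := fun U => by
    rw [← zmod_two_ne]
    exact fun h1 => hodd (hQ.isJoin.oddCycle hxQ h1)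
  -- When the circuit found is even, its complement in `C` is a smaller odd cycle.
  have h1 : Γ.OddCycle (C \ insert x (Q.image Prod.fst)) := fun U => by
    have h2 := h U
    rwa [← Finset.sum_sdiff hsub, hzero, add_zero] at h2
  obtain ⟨y, Q', h2, h3, h4, h5⟩ := ih _ (by
    rw [← hn]
    exact Finset.card_lt_card (Finset.sdiff_ssubset hsub (Finset.insert_nonempty _ _))) h1 rfl
  exact ⟨y, Q', h2, h3, h4.trans Finset.sdiff_subset, h5⟩

/-- The number of edges of `D` at `x`, loops counted twice. -/
def deg [DecidableEq V] (Γ : SignedGraph V E) (D : Finset E) (x : V) : ℕ :=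
  outdeg Γ.src D x + outdeg Γ.tgt D x

lemma deg_insert [DecidableEq V] {D : Finset E} {f : E} (hf : f ∉ D) (x : V) :
    Γ.deg (insert f D) x = Γ.deg D x + ((if x = Γ.src f then 1 else 0) +
      if x = Γ.tgt f then 1 else 0) := by
  rw [deg, outdeg_insert hf, outdeg_insert hf, deg]
  ring

lemma _root_.OddPacking.IsDipath.deg_image [DecidableEq V] {u v : V} {Q : Finset (E × Bool)}
    (h : IsDipath Γ.tl Γ.hd v u Q) (x : V) :
    Γ.deg (Q.image Prod.fst) x = outdeg Γ.tl Q x + outdeg Γ.hd Q x := by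
  induction h with
  | nil => simp [deg, outdeg]
  | cons a Q h ha hQ ih =>
    rw [Finset.image_insert, deg_insert (h.fst_notMem ha hQ), ih,
      outdeg_insert fun h1 => hQ a h1 rfl, outdeg_insert fun h1 => hQ a h1 rfl]
    obtain ⟨f, b⟩ := a
    cases b <;> simp [tl, hd] <;> ring

lemma sum_bd_eq_zero [DecidableEq V] [Fintype V] {D : Finset E} (h : ∀ x, Even (Γ.deg D x))
    (U : V → ZMod 2) : ∑ f ∈ D, (U (Γ.src f) + U (Γ.tgt f)) = 0 := by
  have h1 : ∀ g : E → V, ∑ f ∈ D, U (g f) = ∑ x, (outdeg g D x : ZMod 2) * U x := by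
    intro g
    rw [← Finset.sum_fiberwise D g]
    refine Finset.sum_congr rfl fun x _ => ?_
    rw [Finset.sum_congr rfl fun f hf => by rw [(Finset.mem_filter.1 hf).2]]
    rw [Finset.sum_const, nsmul_eq_mul]
    rfl
  rw [Finset.sum_add_distrib, h1, h1, ← Finset.sum_add_distrib]
  refine Finset.sum_eq_zero fun x _ => ?_
  rw [← add_mul, ← Nat.cast_add, show ((outdeg Γ.src D x + outdeg Γ.tgt D x : ℕ) : ZMod 2) = 0
    from (ZMod.natCast_eq_zero_iff_even).2 (h x), zero_mul]

end SignedGraph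

/-! ### Multigraphs as signed graphs with all edges odd -/

section Translate

open Graph

variable {α β : Type*}

/-- The signed graph of `G`, in which all edges are odd. -/
noncomputable def toSigned (G : Graph α β) : SignedGraph G.vertexSet G.edgeSet where
  src e := ⟨_, (G.exists_isLink_of_mem_edgeSet e.2).choose_spec.choose_spec.left_mem⟩
  tgt e := ⟨_, (G.exists_isLink_of_mem_edgeSet e.2).choose_spec.choose_spec.right_mem⟩
  sg _ := 1

variable {G : Graph α β}

lemma toSigned_isLink (e : G.edgeSet) :
    G.IsLink e ((toSigned G).src e) ((toSigned G).tgt e) :=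
  (G.exists_isLink_of_mem_edgeSet e.2).choose_spec.choose_spec

lemma isLink_iff_joins (e : G.edgeSet) (x y : G.vertexSet) :
    G.IsLink e x y ↔ (toSigned G).Joins e x y := by
  rw [(toSigned_isLink e).isLink_iff]
  simp only [SignedGraph.Joins, Subtype.ext_iff]

lemma toSigned_inc (e : G.edgeSet) (x : G.vertexSet) :
    G.Inc e x ↔ (toSigned G).src e = x ∨ (toSigned G).tgt e = x := by
  constructor
  · rintro ⟨y, hy⟩
    rcases (isLink_iff_joins e x ⟨y, hy.right_mem⟩).1 hy with ⟨h1, -⟩ | ⟨-, h1⟩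
    · exact Or.inl h1
    · exact Or.inr h1
  · rintro (rfl | rfl)
    · exact (toSigned_isLink e).inc_left
    · exact (toSigned_isLink e).inc_right

lemma toSigned_isLoopAt (e : G.edgeSet) (x : G.vertexSet) :
    G.IsLoopAt e x ↔ (toSigned G).src e = x ∧ (toSigned G).tgt e = x := by
  rw [← isLink_self_iff, isLink_iff_joins]
  simp [SignedGraph.Joins]

open Classical in
/-- Degrees in a subgraph with edge set `D`. -/
lemma degree_eq_deg {H : Graph α β} {D : Finset G.edgeSet}
    (hH : ∀ e x y, H.IsLink e x y ↔ e ∈ Subtype.val '' (D : Set G.edgeSet) ∧ G.IsLink e x y)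
    (x : G.vertexSet) : H.degree x = (toSigned G).deg D x := by
  have h1 : H.incidenceSet x = Subtype.val '' ((D.filter fun f => (toSigned G).src f = x ∨
      (toSigned G).tgt f = x : Finset G.edgeSet) : Set G.edgeSet) := by
    ext e
    simp only [mem_incidenceSet, Graph.Inc, hH, exists_and_left]
    constructor
    · rintro ⟨⟨f, hf, rfl⟩, hi⟩
      exact ⟨f, by simpa using ⟨hf, (toSigned_inc f x).1 hi⟩, rfl⟩
    · rintro ⟨f, hf, rfl⟩
      simp only [Finset.coe_filter, Set.mem_ofPred_eq] at hf
      exact ⟨⟨f, hf.1, rfl⟩, (toSigned_inc f x).2 hf.2⟩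
  have h2 : H.loopSet x = Subtype.val '' ((D.filter fun f => (toSigned G).src f = x ∧
      (toSigned G).tgt f = x : Finset G.edgeSet) : Set G.edgeSet) := by
    ext e
    simp only [mem_loopSet, ← isLink_self_iff, hH]
    constructor
    · rintro ⟨⟨f, hf, rfl⟩, hi⟩
      exact ⟨f, by simpa using ⟨hf, (toSigned_isLoopAt f x).1 hi⟩, rfl⟩
    · rintro ⟨f, hf, rfl⟩
      simp only [Finset.coe_filter, Set.mem_ofPred_eq] at hf
      exact ⟨⟨f, hf.1, rfl⟩, (toSigned_isLoopAt f x).2 hf.2⟩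
  rw [Graph.degree, h1, h2, Set.ncard_image_of_injective _ Subtype.val_injective,
    Set.ncard_image_of_injective _ Subtype.val_injective, Set.ncard_coe_finset,
    Set.ncard_coe_finset, Finset.filter_or, Finset.filter_and, Finset.card_union_add_card_inter]
  rfl

lemma edgeInduce_isLink {C : Set β} (e : β) (x y : α) :
    (G.edgeInduce C).IsLink e x y ↔ e ∈ C ∧ G.IsLink e x y := by
  simp only [edgeInduce, Graph.induce_isLink, Graph.restrict_isLink, Set.mem_ofPred_eq]
  constructor
  · exact fun h => h.1
  · exact fun h => ⟨h, ⟨e, h.1, h.2.inc_left⟩, ⟨e, h.1, h.2.inc_right⟩⟩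

lemma toSigned_hit (U : G.vertexSet → ZMod 2) (f : G.edgeSet) :
    (toSigned G).hit U f = 1 + (U ((toSigned G).src f) + U ((toSigned G).tgt f)) := by
  rw [SignedGraph.hit, add_assoc]
  rfl

lemma oddCycle_of_odd_card {D : Finset G.edgeSet} (h : ∀ U : G.vertexSet → ZMod 2,
    ∑ f ∈ D, (U ((toSigned G).src f) + U ((toSigned G).tgt f)) = 0) (hodd : Odd D.card) :
    (toSigned G).OddCycle D := by
  intro U
  rw [Finset.sum_congr rfl fun f _ => toSigned_hit U f, Finset.sum_add_distrib, h, add_zero,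
    Finset.sum_const, nsmul_eq_mul, mul_one, (ZMod.natCast_eq_one_iff_odd).2 hodd]

lemma odd_card_of_oddCycle {D : Finset G.edgeSet} (h : (toSigned G).OddCycle D) : Odd D.card := by
  have h1 := h 0
  rw [Finset.sum_congr rfl fun f _ => toSigned_hit 0 f] at h1
  simpa [ZMod.natCast_eq_one_iff_odd] using h1

/-- An odd circuit is an odd cycle. -/
lemma oddCycle_of_isOddCircuit [Fintype G.vertexSet] {C : Set β} (h : G.IsOddCircuit C)
    {D : Finset G.edgeSet} (hD : Subtype.val '' (D : Set G.edgeSet) = C) :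
    (toSigned G).OddCycle D := by
  classical
  refine oddCycle_of_odd_card (SignedGraph.sum_bd_eq_zero fun x => ?_) ?_
  · have hdeg := degree_eq_deg (H := G.edgeInduce C) (D := D)
      (fun e x y => by rw [edgeInduce_isLink, hD]) x
    by_cases hx : (x : α) ∈ (G.edgeInduce C).vertexSet
    · rw [← hdeg, h.1.2.2 x hx]
      exact even_two
    · have hn : ∀ f ∈ D, ¬ G.Inc f x := fun f hf hi =>
        hx ⟨f, by rw [← hD]; exact ⟨f, hf, rfl⟩, hi⟩
      rw [SignedGraph.deg, outdeg_eq_zero.2, outdeg_eq_zero.2]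
      · exact Even.zero
      · exact fun f hf h1 => hn f hf ((toSigned_inc f x).2 (Or.inr h1))
      · exact fun f hf h1 => hn f hf ((toSigned_inc f x).2 (Or.inl h1))
  · have h1 := h.2
    rwa [← hD, Set.ncard_image_of_injective _ Subtype.val_injective, Set.ncard_coe_finset] at h1

/-- Every odd cycle contains an odd circuit. -/
lemma exists_isOddCircuit {C : Finset G.edgeSet} (h : (toSigned G).OddCycle C) :
    ∃ D ⊆ C, G.IsOddCircuit (Subtype.val '' (D : Set G.edgeSet)) := by
  classical
  obtain ⟨x, Q, hQ, hxQ, hsub, hodd⟩ := h.exists_circuit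
  set D := insert x (Q.image Prod.fst) with hD
  refine ⟨D, hsub, ⟨⟨?_, ?_, ?_⟩, ?_⟩⟩
  · rintro - ⟨f, -, rfl⟩
    exact f.2
  · set H := G.edgeInduce (Subtype.val '' (D : Set G.edgeSet)) with hH
    have hadj : ∀ f ∈ D, H.Adj ((toSigned G).src f) ((toSigned G).tgt f) := fun f hf =>
      ⟨f, (edgeInduce_isLink _ _ _).2 ⟨⟨f, hf, rfl⟩, toSigned_isLink f⟩⟩
    have hQadj : ∀ p q, Reach (toSigned G).tl (toSigned G).hd Q p q →
        Relation.ReflTransGen H.Adj (p : α) q := by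
      intro p q hpq
      induction hpq with
      | refl => exact .refl
      | tail _ hs ih =>
        obtain ⟨a, ha, rfl, rfl⟩ := hs
        refine ih.tail ?_
        have h1 := hadj a.1 (Finset.mem_insert_of_mem (Finset.mem_image_of_mem _ ha))
        rcases SignedGraph.joins_tl_hd (Γ := toSigned G) a with ⟨h2, h3⟩ | ⟨h2, h3⟩
        · rwa [h2, h3] at h1
        · rw [h2, h3] at h1
          exact h1.symm
    have hsymm : ∀ p q : α, Relation.ReflTransGen H.Adj p q → Relation.ReflTransGen H.Adj q p := by
      intro p q hpq
      induction hpq with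
      | refl => exact .refl
      | tail _ hs ih => exact .head hs.symm ih
    have hto : ∀ y ∈ H.vertexSet, Relation.ReflTransGen H.Adj y ((toSigned G).tgt x) := by
      rintro y ⟨e, ⟨f, hf, rfl⟩, hi⟩
      lift y to G.vertexSet using hi.vertex_mem
      rw [toSigned_inc] at hi
      rcases Finset.mem_insert.1 (Finset.mem_coe.1 hf) with rfl | hf
      · rcases hi with rfl | rfl
        · exact .single (hadj _ (Finset.mem_insert_self _ _))
        · exact .refl
      · obtain ⟨a, ha, rfl⟩ := Finset.mem_image.1 hf
        obtain ⟨h1, h2⟩ := hQ.reach_of_mem ha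
        have h3 : y = (toSigned G).tl a ∨ y = (toSigned G).hd a := by
          rcases SignedGraph.joins_tl_hd (Γ := toSigned G) a with ⟨h4, h5⟩ | ⟨h4, h5⟩
          · rw [h4, h5] at hi
            exact hi.imp Eq.symm Eq.symm
          · rw [h4, h5] at hi
            exact (hi.imp Eq.symm Eq.symm).symm
        rcases h3 with rfl | rfl
        · exact hQadj _ _ h1
        · exact hQadj _ _ h2
    refine ⟨⟨(toSigned G).tgt x, x, ⟨x, Finset.mem_insert_self _ _, rfl⟩,
      (toSigned_isLink x).inc_right⟩, fun y hy z hz => (hto y hy).trans (hsymm _ _ (hto z hz))⟩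
  · rintro y ⟨e, ⟨f, hf, rfl⟩, hi⟩
    lift y to G.vertexSet using hi.vertex_mem
    rw [degree_eq_deg (D := D) fun e x y => edgeInduce_isLink e x y]
    have hpos : 0 < (toSigned G).deg D y := by
      rw [toSigned_inc] at hi
      rw [SignedGraph.deg]
      rcases hi with hi | hi
      · have : 0 < outdeg (toSigned G).src D y := outdeg_pos.2 ⟨f, hf, hi⟩
        omega
      · have : 0 < outdeg (toSigned G).tgt D y := outdeg_pos.2 ⟨f, hf, hi⟩
        omega
    rw [hD, SignedGraph.deg_insert hxQ, hQ.deg_image] at hpos ⊢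
    have h1 := hQ.div y
    have h2 := hQ.outdeg_le y
    have h3 : y = (toSigned G).tgt x → outdeg (toSigned G).tl Q y = 0 := fun h =>
      outdeg_eq_zero.2 fun a ha => h ▸ hQ.tl_ne ha
    split_ifs at * with h4 h5 h5
    · have := h3 h5; omega
    · omega
    · have := h3 h5; omega
    · omega
  · rw [Set.ncard_image_of_injective _ Subtype.val_injective, Set.ncard_coe_finset]
    exact odd_card_of_oddCycle hodd

end Translate

end OddPacking

namespace OddPacking

/-! ### From a signed `K₅` model to an odd minor -/

section OddMinor

open Graph

variable {α β : Type*} {G : Graph α β}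

/-- A model of `K₅` in the signed graph of `G` yields an odd `K₅` minor of `G`. -/
theorem isOddMinor_of_hasOddK5 (h : (toSigned G).HasOddK5) : Graph.IsOddMinor Graph.K5 G := by
  classical
  obtain ⟨s, N, hdisj, hconn, hodd⟩ := h
  set Γ := toSigned G with hΓ
  set ℓ : α → Fin 5 := fun a => if h : ∃ (ha : a ∈ G.vertexSet) (i : Fin 5), ⟨a, ha⟩ ∈ N i
    then h.choose_spec.choose else 0 with hℓdef
  have hℓ : ∀ {x : G.vertexSet} {i : Fin 5}, x ∈ N i → ℓ x = i := by
    intro x i hx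
    have h : ∃ (ha : (x : α) ∈ G.vertexSet) (i : Fin 5), ⟨(x : α), ha⟩ ∈ N i := ⟨x.2, i, hx⟩
    have h1 : ℓ x = h.choose_spec.choose := dif_pos h
    rw [h1]
    by_contra hne
    exact Set.disjoint_left.1 (hdisj _ _ hne) h.choose_spec.choose_spec hx
  set X : Set α := Subtype.val '' (⋃ i, N i) with hX
  have hNX : ∀ {x : G.vertexSet} {i : Fin 5}, x ∈ N i → (x : α) ∈ X := fun hx =>
    ⟨_, Set.mem_iUnion.2 ⟨_, hx⟩, rfl⟩
  -- an odd edge for every edge of `K₅`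
  have hex : ∀ p : K5.edgeSet, ∃ f : G.edgeSet, Γ.hit s f = 1 ∧
      (p : Sym2 (Fin 5)) = s(ℓ (Γ.src f), ℓ (Γ.tgt f)) ∧ (∃ i, Γ.src f ∈ N i) ∧
      ∃ i, Γ.tgt f ∈ N i := by
    rintro ⟨p, hp⟩
    induction p with
    | h i j =>
      have hij : i ≠ j := by simpa [K5] using hp
      obtain ⟨f, hf, a, ha, b, hb, hab⟩ := hodd i j hij
      refine ⟨f, hf, ?_⟩
      rcases hab with ⟨rfl, rfl⟩ | ⟨rfl, rfl⟩
      · exact ⟨by rw [hℓ ha, hℓ hb], ⟨i, ha⟩, ⟨j, hb⟩⟩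
      · exact ⟨by rw [hℓ ha, hℓ hb]; exact Sym2.eq_swap, ⟨j, hb⟩, ⟨i, ha⟩⟩
  choose o ho hop hosrc hotgt using hex
  -- The subgraph keeps the even edges inside branch sets and one odd edge `o p` per edge of `K₅`.
  set T : Set β := Subtype.val '' {f : G.edgeSet | Γ.hit s f = 0 ∧ ∃ i, Γ.src f ∈ N i ∧
    Γ.tgt f ∈ N i} with hT
  set O : Set β := Set.range fun p => (o p : β) with hO
  have hTmem : ∀ {f : G.edgeSet}, (f : β) ∈ T → Γ.hit s f = 0 ∧ ∃ i, Γ.src f ∈ N i ∧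
      Γ.tgt f ∈ N i := by
    rintro f ⟨g, hg, hgf⟩
    rwa [Subtype.val_injective hgf] at hg
  have hends : ∀ {f : G.edgeSet}, (f : β) ∈ T ∪ O → (Γ.src f : α) ∈ X ∧ (Γ.tgt f : α) ∈ X := by
    rintro f (hf | ⟨p, hp⟩)
    · obtain ⟨-, i, h1, h2⟩ := hTmem hf
      exact ⟨hNX h1, hNX h2⟩
    · obtain rfl : o p = f := Subtype.val_injective hp
      obtain ⟨i, hi⟩ := hosrc p
      obtain ⟨j, hj⟩ := hotgt p
      exact ⟨hNX hi, hNX hj⟩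
  have hcases : ∀ {f : G.edgeSet} {x y : α}, G.IsLink f x y →
      (x = Γ.src f ∧ y = Γ.tgt f) ∨ (x = Γ.tgt f ∧ y = Γ.src f) := by
    intro f x y hl
    rcases (toSigned_isLink f).isLink_iff.1 hl with ⟨h1, h2⟩ | ⟨h1, h2⟩
    · exact Or.inl ⟨h1.symm, h2.symm⟩
    · exact Or.inr ⟨h2.symm, h1.symm⟩
  set G' := (G.restrict (T ∪ O)).induce X with hG'
  have hlink : ∀ e x y, G'.IsLink e x y ↔ e ∈ T ∪ O ∧ G.IsLink e x y := by
    intro e x y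
    simp only [hG', Graph.induce_isLink, Graph.restrict_isLink]
    refine ⟨fun h => h.1, fun h => ⟨h, ?_⟩⟩
    obtain ⟨f, rfl⟩ : ∃ f : G.edgeSet, (f : β) = e := ⟨⟨e, h.2.edge_mem⟩, rfl⟩
    obtain ⟨h1, h2⟩ := hends h.1
    rcases hcases h.2 with ⟨rfl, rfl⟩ | ⟨rfl, rfl⟩
    · exact ⟨h1, h2⟩
    · exact ⟨h2, h1⟩
  have hXV : X ⊆ G.vertexSet := by
    rintro - ⟨x, -, rfl⟩
    exact x.2
  have hle : G' ≤ G := (Graph.induce_le (G := G.restrict (T ∪ O)) hXV).trans Graph.restrict_le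
  -- All original signs are odd, so an edge is even after switching by `s` exactly when `s` differs
  -- at its ends. Hence `T` is the cut of `W`.
  set W : Set α := Subtype.val '' {x : G.vertexSet | s x = 1 ∧ x ∈ ⋃ i, N i} with hW
  have hWmem : ∀ {x : G.vertexSet}, (x : α) ∈ X → ((x : α) ∈ W ↔ s x = 1) := by
    rintro x ⟨y, hy, hyx⟩
    rw [Subtype.val_injective hyx] at hy
    constructor
    · rintro ⟨z, hz, hzx⟩
      rw [Subtype.val_injective hzx] at hz
      exact hz.1
    · exact fun h => ⟨x, ⟨h, hy⟩, rfl⟩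
  have hhit0 : ∀ a b : ZMod 2, 1 + (a + b) = 0 → (a = 1 ∧ b ≠ 1) ∨ (b = 1 ∧ a ≠ 1) := by decide
  have hhit1 : ∀ a b : ZMod 2, 1 + (a + b) = 1 → a = b := by decide
  have hoT : ∀ p, (o p : β) ∉ T := by
    intro p hp
    have h1 := (hTmem hp).1
    rw [ho] at h1
    exact absurd h1 (by decide)
  have hcut : G'.cut W = T := by
    ext e
    constructor
    · rintro ⟨x, hx, y, hy, hl⟩
      obtain ⟨he, hl⟩ := (hlink _ _ _).1 hl
      rcases he with he | ⟨p, rfl⟩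
      · exact he
      exfalso
      obtain ⟨h1, h2⟩ := hends (f := o p) (Or.inr ⟨p, rfl⟩)
      have h3 := ho p
      rw [toSigned_hit] at h3
      have h4 := hhit1 _ _ h3
      have h5 : (Γ.src (o p) : α) ∈ W ↔ (Γ.tgt (o p) : α) ∈ W := by
        rw [hWmem h1, hWmem h2, h4]
      rcases hcases hl with ⟨rfl, rfl⟩ | ⟨rfl, rfl⟩
      · exact hy (h5.1 hx)
      · exact hy (h5.2 hx)
    · rintro ⟨f, hf, rfl⟩
      have hfT : (f : β) ∈ T ∪ O := Or.inl ⟨f, hf, rfl⟩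
      obtain ⟨h1, h2⟩ := hends hfT
      have h3 := hf.1
      rw [toSigned_hit] at h3
      have hl : G'.IsLink f (Γ.src f) (Γ.tgt f) := (hlink _ _ _).2 ⟨hfT, toSigned_isLink f⟩
      rcases hhit0 _ _ h3 with ⟨h4, h5⟩ | ⟨h4, h5⟩
      · exact ⟨_, (hWmem h1).2 h4, _, fun h => h5 ((hWmem h2).1 h), hl⟩
      · exact ⟨_, (hWmem h2).2 h4, _, fun h => h5 ((hWmem h1).1 h), hl.symm⟩
  refine ⟨G', hle, W, ?_, ?_⟩
  · rintro - ⟨x, hx, rfl⟩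
    exact ⟨x, hx.2, rfl⟩
  rw [hcut]
  set r : α → α → Prop := fun x y => ∃ e ∈ T, G'.IsLink e x y with hr
  have hHlink : ∀ e p q, (G'.contract T).IsLink e p q ↔
      Relation.Map (G'.IsLink e) (Quot.mk r) (Quot.mk r) p q ∧ e ∉ T := by
    intro e p q
    simp only [Graph.contract, Graph.deleteEdges_isLink, Graph.map_isLink]
    rfl
  have hlift : ∀ x y, r x y → ℓ x = ℓ y := by
    rintro x y ⟨e, he, hl⟩
    have hl' := ((hlink _ _ _).1 hl).2
    obtain ⟨f, rfl⟩ : ∃ f : G.edgeSet, (f : β) = e := ⟨⟨e, hl'.edge_mem⟩, rfl⟩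
    obtain ⟨-, i, h1, h2⟩ := hTmem he
    rcases hcases hl' with ⟨rfl, rfl⟩ | ⟨rfl, rfl⟩
    · rw [hℓ h1, hℓ h2]
    · rw [hℓ h1, hℓ h2]
  have hmk : ∀ i (x y : G.vertexSet), x ∈ N i → y ∈ N i → Quot.mk r (x : α) = Quot.mk r y := by
    intro i
    obtain ⟨c, -, hc⟩ := hconn i
    have key : ∀ x : G.vertexSet, Relation.ReflTransGen (Γ.EvenAdj s (N i)) c x →
        Quot.mk r (c : α) = Quot.mk r x := by
      intro x hx
      induction hx with
      | refl => rfl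
      | @tail p q _ hpq ih =>
        obtain ⟨hp, hq, f, hf, hj⟩ := hpq
        rw [ih]
        have hfT : (f : β) ∈ T := by
          refine ⟨f, ⟨hf, i, ?_⟩, rfl⟩
          rcases hj with ⟨rfl, rfl⟩ | ⟨rfl, rfl⟩
          · exact ⟨hp, hq⟩
          · exact ⟨hq, hp⟩
        exact Quot.sound ⟨f, hfT, (hlink _ _ _).2 ⟨Or.inl hfT, (isLink_iff_joins f p q).2 hj⟩⟩
    exact fun x y hx hy => (key x (hc x hx)).symm.trans (key y (hc y hy))
  have hVmem : ∀ q, q ∈ (G'.contract T).vertexSet ↔ ∃ x ∈ X, Quot.mk r x = q := fun q => Iff.rfl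
  have hfbij : Function.Bijective (fun q : (G'.contract T).vertexSet =>
      (⟨Quot.lift ℓ hlift q.1, trivial⟩ : K5.vertexSet)) := by
    constructor
    · rintro ⟨p, hp⟩ ⟨q, hq⟩ hpq
      obtain ⟨-, ⟨x, hx, rfl⟩, rfl⟩ := (hVmem p).1 hp
      obtain ⟨-, ⟨y, hy, rfl⟩, rfl⟩ := (hVmem q).1 hq
      obtain ⟨i, hi⟩ := Set.mem_iUnion.1 hx
      obtain ⟨j, hj⟩ := Set.mem_iUnion.1 hy
      have h1 : ℓ x = ℓ y := congrArg Subtype.val hpq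
      rw [hℓ hi, hℓ hj] at h1
      subst h1
      exact Subtype.ext (hmk i x y hi hj)
    · rintro ⟨i, hi⟩
      obtain ⟨c, hc, -⟩ := hconn i
      exact ⟨⟨Quot.mk r c, (hVmem _).2 ⟨c, hNX hc, rfl⟩⟩, Subtype.ext (hℓ hc)⟩
  have hE : ∀ p, (o p : β) ∈ (G'.contract T).edgeSet := by
    intro p
    rw [Graph.edge_mem_iff_exists_isLink]
    exact ⟨_, _, (hHlink _ _ _).2 ⟨⟨_, _, (hlink _ _ _).2 ⟨Or.inr ⟨p, rfl⟩, toSigned_isLink (o p)⟩,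
      rfl, rfl⟩, hoT p⟩⟩
  have hgbij : Function.Bijective (fun p : K5.edgeSet =>
      (⟨(o p : β), hE p⟩ : (G'.contract T).edgeSet)) := by
    constructor
    · intro p q hpq
      have h1 : o p = o q := Subtype.ext (Subtype.mk.inj hpq)
      exact Subtype.ext (by rw [hop p, hop q, h1])
    · rintro ⟨e, he⟩
      obtain ⟨x, y, hl⟩ := (Graph.edge_mem_iff_exists_isLink _ _).1 he
      obtain ⟨⟨a, b, hab, -, -⟩, heT⟩ := (hHlink _ _ _).1 hl
      obtain ⟨p, hp⟩ := ((hlink _ _ _).1 hab).1.resolve_left heT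
      exact ⟨p, Subtype.ext hp⟩
  refine ⟨Equiv.ofBijective _ hfbij, (Equiv.ofBijective _ hgbij).symm, fun e x y => ?_⟩
  obtain ⟨p, rfl⟩ := (Equiv.ofBijective _ hgbij).surjective e
  rw [Equiv.symm_apply_apply]
  have hKlink : ∀ i j, K5.IsLink (p : Sym2 (Fin 5)) i j ↔ (p : Sym2 (Fin 5)) = s(i, j) :=
    fun i j => ⟨fun h => h.1, fun h => ⟨h, p.2⟩⟩
  rw [hKlink]
  change (G'.contract T).IsLink (o p : β) x y ↔
    (p : Sym2 (Fin 5)) = s(Quot.lift ℓ hlift x.1, Quot.lift ℓ hlift y.1)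
  have hsl : G'.IsLink (o p) (Γ.src (o p)) (Γ.tgt (o p)) :=
    (hlink _ _ _).2 ⟨Or.inr ⟨p, rfl⟩, toSigned_isLink (o p)⟩
  rw [hHlink, hop p]
  constructor
  · rintro ⟨⟨a, b, hab, hax, hby⟩, -⟩
    rw [← hax, ← hby]
    rcases hcases ((hlink _ _ _).1 hab).2 with ⟨rfl, rfl⟩ | ⟨rfl, rfl⟩
    · rfl
    · exact Sym2.eq_swap
  · intro h1
    have hinj : ∀ (z : (G'.contract T).vertexSet) (w : G.vertexSet), (w : α) ∈ X →
        ℓ w = Quot.lift ℓ hlift z.1 → Quot.mk r (w : α) = z.1 := by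
      intro z w hw hwz
      exact congrArg Subtype.val (hfbij.1 (a₁ := ⟨Quot.mk r (w : α), (hVmem _).2 ⟨w, hw, rfl⟩⟩)
        (a₂ := z) (Subtype.ext hwz))
    obtain ⟨h2, h3⟩ := hends (f := o p) (Or.inr ⟨p, rfl⟩)
    refine ⟨?_, hoT p⟩
    rcases Sym2.eq_iff.1 h1 with ⟨h4, h5⟩ | ⟨h4, h5⟩
    · exact ⟨_, _, hsl, hinj x _ h2 h4, hinj y _ h3 h5⟩
    · exact ⟨_, _, hsl.symm, hinj x _ h3 h5, hinj y _ h2 h4⟩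

end OddMinor

/-! ### Covers, packings and the min-max equality -/

section Packing

open Graph

variable {α β : Type*} {G : Graph α β}

lemma IsOddCircuitPacking.card_le {P : Finset (Set β)} {B : Finset β}
    (hP : G.IsOddCircuitPacking P) (hB : G.IsOddCircuitCover B) : P.card ≤ B.card := by
  classical
  rcases isEmpty_or_nonempty β with hβ | hβ
  · have hP0 : P = ∅ := Finset.eq_empty_of_forall_notMem fun C hC =>
      hβ.false (hB.2 C (hP.1 C hC)).some
    simp [hP0]
  choose! b hb using fun C (hC : C ∈ P) => hB.2 C (hP.1 C hC)
  refine Finset.card_le_card_of_injOn b (fun C hC => (hb C hC).1) fun C hC D hD hCD => ?_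
  by_contra hne
  refine Set.disjoint_left.1 (hP.2 hC hD hne) (hb C hC).2 ?_
  rw [hCD]
  exact (hb D hD).2

/-- Edges that are hit by a switching cover all odd circuits. -/
lemma isOddCircuitCover_hits [Fintype G.vertexSet] [Fintype G.edgeSet]
    (U : G.vertexSet → ZMod 2) : G.IsOddCircuitCover
      (((toSigned G).hits Finset.univ U).map (Function.Embedding.subtype _)) := by
  classical
  refine ⟨fun e he => ?_, fun C hC => ?_⟩
  · obtain ⟨f, -, rfl⟩ := Finset.mem_map.1 (Finset.mem_coe.1 he)
    exact f.2
  · have hD : Subtype.val '' ((Finset.univ.filter fun f : G.edgeSet => (f : β) ∈ C :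
        Finset G.edgeSet) : Set G.edgeSet) = C := by
      ext e
      constructor
      · rintro ⟨f, hf, rfl⟩
        simpa using hf
      · exact fun he => ⟨⟨e, hC.1.1 he⟩, by simpa using he, rfl⟩
    obtain ⟨f, hf⟩ := Finset.card_pos.1 ((oddCycle_of_isOddCircuit hC hD).hits_nonempty U)
    obtain ⟨h1, h2⟩ := SignedGraph.mem_hits.1 hf
    refine ⟨f, Finset.mem_coe.2 (Finset.mem_map.2 ⟨f, SignedGraph.mem_hits.2
      ⟨Finset.mem_univ _, h2⟩, rfl⟩), ?_⟩
    simpa using h1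

/-- A packing of odd cycles gives a packing of odd circuits. -/
lemma exists_isOddCircuitPacking {F : Finset G.edgeSet} {k : ℕ} (h : (toSigned G).Packs F k) :
    ∃ P : Finset (Set β), G.IsOddCircuitPacking P ∧ P.card = k := by
  classical
  obtain ⟨C, -, hodd, hdisj⟩ := h
  choose D hDC hD using fun i => exists_isOddCircuit (hodd i)
  have hdisj' : ∀ i j, i ≠ j → Disjoint (Subtype.val '' (D i : Set G.edgeSet) : Set β)
      (Subtype.val '' (D j : Set G.edgeSet)) := by
    intro i j hij
    rw [Set.disjoint_image_iff Subtype.val_injective, Finset.disjoint_coe]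
    exact (hdisj i j hij).mono (hDC i) (hDC j)
  have hne : ∀ i, (Subtype.val '' (D i : Set G.edgeSet) : Set β).Nonempty := fun i =>
    Set.nonempty_of_ncard_ne_zero (hD i).2.pos.ne'
  have hinj : Function.Injective fun i => (Subtype.val '' (D i : Set G.edgeSet) : Set β) := by
    intro i j hij
    by_contra hcon
    have h1 := hdisj' i j hcon
    simp only at hij
    rw [← hij, disjoint_self, Set.bot_eq_empty] at h1
    exact (hne i).ne_empty h1
  refine ⟨Finset.univ.image fun i => (Subtype.val '' (D i : Set G.edgeSet) : Set β), ⟨?_, ?_⟩, ?_⟩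
  · intro S hS
    obtain ⟨i, -, rfl⟩ := Finset.mem_image.1 hS
    exact hD i
  · intro S hS S' hS' hSS
    obtain ⟨i, -, rfl⟩ := Finset.mem_image.1 (Finset.mem_coe.1 hS)
    obtain ⟨j, -, rfl⟩ := Finset.mem_image.1 (Finset.mem_coe.1 hS')
    exact hdisj' i j fun h => hSS (by rw [h])
  · rw [Finset.card_image_of_injective _ hinj, Finset.card_univ, Fintype.card_fin]

/-- The minimum number of hits is the number of cycles in a packing. -/
lemma packs_min_hits [Fintype G.vertexSet] [Fintype G.edgeSet]
    (heven : ∀ v ∈ G.vertexSet, Even (G.degree v)) (hK5 : ¬ Graph.IsOddMinor Graph.K5 G)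
    {U₀ : G.vertexSet → ZMod 2} (hU₀ : ∀ U, ((toSigned G).hits Finset.univ U₀).card ≤
      ((toSigned G).hits Finset.univ U).card) :
    (toSigned G).Packs Finset.univ ((toSigned G).hits Finset.univ U₀).card := by
  classical
  set Γ := toSigned G with hΓ
  have hbd := SignedGraph.sum_bd_eq_zero (Γ := Γ) (D := Finset.univ) fun x => by
    rw [← degree_eq_deg (H := G) (D := Finset.univ) (fun e x y => ?_) x]
    · exact heven x x.2
    · constructor
      · exact fun h => ⟨⟨⟨e, h.edge_mem⟩, by simp, rfl⟩, h⟩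
      · exact fun h => h.2
  -- Even degrees make every cut even, so the number of hits has the parity of the number of edges,
  -- whatever the switching.
  have hcard : ∀ U, ∑ f, Γ.hit U f = ∑ _f : G.edgeSet, (1 : ZMod 2) := fun U => by
    rw [Finset.sum_congr rfl fun f _ => toSigned_hit U f, Finset.sum_add_distrib]
    exact add_eq_left.2 (hbd U)
  have hsum : ∀ U, ∑ f, Γ.hit U f = ((Γ.hits Finset.univ U₀).card : ZMod 2) := fun U => by
    rw [← SignedGraph.sum_hit_eq_card, hcard, hcard]
  have hemb : Function.Injective fun f : G.edgeSet => (f, 0) := fun f g h =>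
    (Prod.mk.injEq _ _ _ _ ▸ h : f = g ∧ (0 : ℕ) = 0).1
  set F : Finset (G.edgeSet × ℕ) := Finset.univ.map ⟨fun f => (f, 0), hemb⟩ with hF
  obtain ⟨C, hC, hodd, hdisj⟩ := SignedGraph.packs_of_le_card_hits _ G.vertexSet Γ rfl
    (fun h => hK5 (isOddMinor_of_hasOddK5 h)) (Γ.hits Finset.univ U₀).card F
    (fun U => by
      rw [hF, Finset.sum_map]
      exact hsum U)
    (fun U => by
      refine (hU₀ U).trans (le_of_eq ?_)
      rw [SignedGraph.hits, SignedGraph.hits, hF, Finset.filter_map, Finset.card_map]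
      rfl)
  have hinj : Set.InjOn Prod.fst (F : Set (G.edgeSet × ℕ)) := by
    intro a ha b hb hab
    obtain ⟨f, -, rfl⟩ := Finset.mem_map.1 (Finset.mem_coe.1 ha)
    obtain ⟨g, -, rfl⟩ := Finset.mem_map.1 (Finset.mem_coe.1 hb)
    exact congrArg (fun f => (f, 0)) hab
  refine ⟨fun i => (C i).image Prod.fst, fun i => Finset.subset_univ _, fun i U => ?_,
    fun i j hij => ?_⟩
  · rw [Finset.sum_image fun a ha b hb => hinj (hC i ha) (hC i hb)]
    exact hodd i U
  · refine Finset.disjoint_left.2 fun f hf hf' => ?_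
    obtain ⟨a, ha, rfl⟩ := Finset.mem_image.1 hf
    obtain ⟨b, hb, hab⟩ := Finset.mem_image.1 hf'
    have := hinj (hC j hb) (hC i ha) hab
    subst this
    exact Finset.disjoint_left.1 (hdisj i j hij) ha hb

end Packing

end OddPacking

theorem mainTheorem2 {α β : Type*} (G : Graph α β)
    (hV : G.vertexSet.Finite) (hE : G.edgeSet.Finite)
    (heven : ∀ v ∈ G.vertexSet, Even (G.degree v))
    (hK5 : ¬ Graph.IsOddMinor Graph.K5 G) :
    ∃ n : ℕ,
      IsLeast {k : ℕ | ∃ B : Finset β, G.IsOddCircuitCover B ∧ B.card = k} n ∧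
      IsGreatest {k : ℕ | ∃ P : Finset (Set β), G.IsOddCircuitPacking P ∧ P.card = k} n := by
  classical
  have : Fintype G.vertexSet := hV.fintype
  have : Fintype G.edgeSet := hE.fintype
  -- A switching with the fewest hits supplies both the cover and the size of the packing; that no
  -- packing exceeds a cover makes both optimal.
  obtain ⟨U, -, hU⟩ := Finset.exists_min_image Finset.univ
    (fun U => ((OddPacking.toSigned G).hits Finset.univ U).card) Finset.univ_nonempty
  obtain ⟨P, hP, hPcard⟩ := OddPacking.exists_isOddCircuitPacking
    (OddPacking.packs_min_hits heven hK5 fun U' => hU U' (Finset.mem_univ U'))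
  have hB := OddPacking.isOddCircuitCover_hits (G := G) U
  refine ⟨((OddPacking.toSigned G).hits Finset.univ U).card, ⟨⟨_, hB, Finset.card_map _⟩, ?_⟩,
    ⟨⟨P, hP, hPcard⟩, ?_⟩⟩
  · rintro k ⟨B, hB', rfl⟩
    rw [← hPcard]
    exact OddPacking.IsOddCircuitPacking.card_le hP hB'
  · rintro k ⟨P', hP', rfl⟩
    exact (OddPacking.IsOddCircuitPacking.card_le hP' hB).trans_eq (Finset.card_map _)
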